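/- For $0\le e<1$ let $u(t,e)$ be the solution of Kepler's equation $u-e\sin u=t$, let $r(t,e)=\tfrac12\,(1-e\cos u(t,e))$ and $$F(x,t,e)=\frac{x}{\bigl(x^2+r(t,e)^2\bigr)^{3/2}},$$ and consider the elliptic Sitnikov problem $(S_e)$: $\ddot x+F(x,t,e)=0$. Let $m,p\ge 1$ be integers. A family of odd $(m,p)$-periodic solutions is a family $\phi(t,e)$, $0\le e<e_0$ (for some $0<e_0\le 1$), of solutions of $(S_e)$ on $\mathbb R$ such that $\phi(0,e)=0$ and $\phi(m\pi,e)=0$ for all $e$, the velocity $\dot\phi(0,e)$ is continuous in $e$, $\dot\phi(0,0)>0$, and $\phi(\cdot,0)$ has minimal period $2m\pi/p$. A family of even $(m,p)$-periodic solutions is a family $\varphi(t,e)$, $0\le e<e_0$ (for some $0<e_0\le 1$), of solutions of $(S_e)$ on $\mathbb R$ such that $\dot\varphi(0,e)=0$ and $\dot\varphi(m\pi,e)=0$ for all $e$, the position $\varphi(0,e)$ is continuous in $e$, $\varphi(0,0)>0$, and $\varphi(\cdot,0)$ has minimal period $2m\pi/p$. For such a family $x(t,e)$ the trace is $\psi_1(2m\pi,e)+\dot\psi_2(2m\pi,e)$,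 where $\psi_1(\cdot,e),\psi_2(\cdot,e)$ are the solutions of the linearization $$\ddot y+\frac{\partial F}{\partial x}(x(t,e),t,e)\,y=0$$ with $(\psi_1,\dot\psi_1)(0,e)=(1,0)$ and $(\psi_2,\dot\psi_2)(0,e)=(0,1)$. It is denoted by $\tau_{\mathrm{odd},m,p}(e)$ for an odd family and by $\tau_{\mathrm{even},m,p}(e)$ for an even family. **Lemma.** Let $p,n\ge 1$ be integers. Families of odd and of even $(2pn,p)$-periodic solutions exist, the (right) derivatives $\tau'_{\mathrm{odd},2pn,p}(0)$ and $\tau'_{\mathrm{even},2pn,p}(0)$ at $e=0$ exist and do not depend on the choice of the families, and $$\tau'_{\mathrm{even},2pn,p}(0)=(-1)^n\,\tau'_{\mathrm{odd},2pn,p}(0).$$ -/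

import Mathlib

open Set Real

noncomputable section

namespace Sitnikov

/-- The eccentric anomaly `u(t,e)`: the solution `u` of Kepler's equation `u - e sin u = t`
(for `0 ≤ e < 1` it exists and is unique, see the two facts below). -/
def eccentricAnomaly (t e : ℝ) : ℝ :=
  Function.invFun (fun u : ℝ => u - e * Real.sin u) t

theorem eccentricAnomaly_spec (t e : ℝ) :
    eccentricAnomaly t e - e * Real.sin (eccentricAnomaly t e) = t := by
  have hc : Continuous (fun u : ℝ => u - e * Real.sin u) := by fun_prop
  have hb : ∀ u : ℝ, |e * Real.sin u| ≤ |e| := fun u => by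
    rw [abs_mul]
    exact mul_le_of_le_one_right (abs_nonneg e) (Real.abs_sin_le_one u)
  have h : ∃ u : ℝ, (fun u : ℝ => u - e * Real.sin u) u = t := by
    have h1 := abs_le.1 (hb (t - |e|))
    have h2 := abs_le.1 (hb (t + |e|))
    have hle : t - |e| ≤ t + |e| := by linarith [abs_nonneg e]
    obtain ⟨u, -, hu⟩ := intermediate_value_Icc hle hc.continuousOn
      (show t ∈ Icc _ _ from ⟨by linarith [h1.1, h1.2], by linarith [h2.1, h2.2]⟩)
    exact ⟨u, hu⟩
  exact Function.invFun_eq h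

theorem eccentricAnomaly_unique {t e u : ℝ} (he : |e| < 1) (hu : u - e * Real.sin u = t) :
    u = eccentricAnomaly t e := by
  have hv := eccentricAnomaly_spec t e
  set v := eccentricAnomaly t e
  by_contra hne
  have h1 : u - v = e * (Real.sin u - Real.sin v) := by linarith
  have h2 : |Real.sin u - Real.sin v| ≤ |u - v| := by
    simpa [Real.dist_eq] using Real.abs_sin_sub_sin_le u v
  have h3 : 0 < |u - v| := abs_pos.2 (sub_ne_zero.2 hne)
  have h4 : |u - v| = |e| * |Real.sin u - Real.sin v| := by
    conv_lhs => rw [h1]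
    exact abs_mul _ _
  nlinarith [abs_nonneg e]

/-- The distance `r(t,e) = (1/2) (1 - e cos u(t,e))` of the primaries to the origin. -/
def radius (t e : ℝ) : ℝ :=
  (1 / 2) * (1 - e * Real.cos (eccentricAnomaly t e))

/-- The force term `F(x,t,e) = x / (x² + r(t,e)²)^{3/2}` of the elliptic Sitnikov problem. -/
def force (x t e : ℝ) : ℝ :=
  x / (x ^ 2 + radius t e ^ 2) ^ ((3 : ℝ) / 2)

/-- `x` is a (classical, global) solution of the scalar second order equation
`x'' + G(x, t) = 0`. -/
def IsSolution (G : ℝ → ℝ → ℝ) (x : ℝ → ℝ) : Prop :=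
  Differentiable ℝ x ∧ ∀ t : ℝ, HasDerivAt (deriv x) (-G (x t) t) t

/-- The solution of Hill's equation `y'' + q(t) y = 0` with `y(0) = a`, `y'(0) = b`.
(It exists and is unique for continuous `q`.) -/
def hillSolution (q : ℝ → ℝ) (a b : ℝ) : ℝ → ℝ :=
  Classical.epsilon fun y : ℝ → ℝ =>
    IsSolution (fun x t => q t * x) y ∧ y 0 = a ∧ deriv y 0 = b

/-- The trace `ψ₁(T) + ψ₂'(T)` of the `T`-Poincaré matrix of `y'' + q(t) y = 0`, where
`ψ₁`, `ψ₂` are the fundamental solutions. -/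
def hillTrace (q : ℝ → ℝ) (T : ℝ) : ℝ :=
  hillSolution q 1 0 T + deriv (hillSolution q 0 1) T

/-- For a family `x(t,e)` of functions: the trace `τ(e)` of the `2mπ`-Poincaré matrix of the
linearization `y'' + ∂F/∂x(x(t,e),t,e) y = 0` along `x(·,e)`. -/
def linearizedTrace (m : ℕ) (x : ℝ → ℝ → ℝ) (e : ℝ) : ℝ :=
  hillTrace (fun t => deriv (fun z => force z t e) (x t e)) (2 * m * π)

/-- `T` is the minimal period of `x`. -/
def IsMinimalPeriod (x : ℝ → ℝ) (T : ℝ) : Prop :=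
  IsLeast {S : ℝ | 0 < S ∧ Function.Periodic x S} T

/-- `φ(t,e)`, `0 ≤ e < e₀`, is a family of odd `(m,p)`-periodic solutions of the elliptic
Sitnikov problem: `φ(·,e)` is the solution starting at `φ(0,e) = 0` with a velocity that depends
continuously on `e`, subject to the bifurcation equation `φ(mπ,e) = 0` (so that `φ(·,e)` is odd
and `2mπ`-periodic), and `φ(·,0)` is the odd solution of the circular problem with positive
initial velocity and minimal period `2mπ/p`. -/
structure IsOddFamily (m p : ℕ) (e₀ : ℝ) (φ : ℝ → ℝ → ℝ) : Prop where
  pos : 0 < e₀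
  le_one : e₀ ≤ 1
  solution : ∀ e ∈ Ico 0 e₀, IsSolution (fun x t => force x t e) (fun t => φ t e)
  initial : ∀ e ∈ Ico 0 e₀, φ 0 e = 0
  half_period : ∀ e ∈ Ico 0 e₀, φ (m * π) e = 0
  continuousOn_velocity : ContinuousOn (fun e => deriv (fun t => φ t e) 0) (Ico 0 e₀)
  velocity_pos : 0 < deriv (fun t => φ t 0) 0
  minimal_period : IsMinimalPeriod (fun t => φ t 0) (2 * m * π / p)

/-- `φ(t,e)`, `0 ≤ e < e₀`, is a family of even `(m,p)`-periodic solutions of the elliptic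
Sitnikov problem: `φ(·,e)` is the solution starting with `φ'(0,e) = 0` at a position that depends
continuously on `e`, subject to the bifurcation equation `φ'(mπ,e) = 0` (so that `φ(·,e)` is even
and `2mπ`-periodic), and `φ(·,0)` is the even solution of the circular problem with positive
initial position and minimal period `2mπ/p`. -/
structure IsEvenFamily (m p : ℕ) (e₀ : ℝ) (φ : ℝ → ℝ → ℝ) : Prop where
  pos : 0 < e₀
  le_one : e₀ ≤ 1
  solution : ∀ e ∈ Ico 0 e₀, IsSolution (fun x t => force x t e) (fun t => φ t e)
  initial : ∀ e ∈ Ico 0 e₀, deriv (fun t => φ t e) 0 = 0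
  half_period : ∀ e ∈ Ico 0 e₀, deriv (fun t => φ t e) (m * π) = 0
  continuousOn_position : ContinuousOn (fun e => φ 0 e) (Ico 0 e₀)
  position_pos : 0 < φ 0 0
  minimal_period : IsMinimalPeriod (fun t => φ t 0) (2 * m * π / p)

end Sitnikov

end

noncomputable section

namespace Sitnikov

open scoped NNReal Topology

/-! ### Second order equations: Grönwall's inequality, existence, uniqueness -/

/-! At `e = 0` the equation is autonomous, and with `m = 2pn` both families start from the same
closed orbit. Its period is `2s` with `s = 2nπ`. The odd solution `X` vanishes first at `s` and
satisfies `X(t+s) = -X(t)`; the even one is the quarter-period shift `X(t+s/2)`. Everything rests on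
`s/2 = nπ`: the shift turns `sin t` into `(-1)^n sin t`, so it suffices to express both trace
derivatives by one integral formula that transforms well under translation.

Along `X` the linearization has the solution `χ = X'` and a second solution `y` with `y(t+s) = -y(t)
+ dχ(t)`, `d ≠ 0` (`IsArch.exists_isParabolicFrame`). Thus the monodromy over `T = 2ps` is
parabolic, and `hasRightDeriv_hillTrace` gives `τ'(0) = 2pd ∫ q₁χ²`, where `q₁` is the first
variation of the potential. It contains `w`, the `e`-derivative of the family. Differentiating the
equation of `w` in time and pairing it with `χ` eliminates `w` (`integral_variation_mul_sq`),
because `w` is `T`-periodic. What remains is `τ'(0) = 2pd ∫ tidal(X) X' sin t` over `[0,T]`, which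
depends only on the orbit at `e = 0`. The even case has the same `d` with `X` translated by `s/2`,
and `IsArch.integral_shift` compares the integrals.

Independence of the family: the attraction divided by `x` decreases for `x > 0`, so an arch is
determined by its length (`IsArch.unique`). Hence every admissible family has the same member at `e
= 0`. Since `d ≠ 0`, the bifurcation equation is nondegenerate in the free initial datum. This
yields existence of the families and forces the free datum of any continuous family to have a right
derivative at `0` (`HasStrictPartials.exists_implicit`, `HasStrictPartials.hasRightDeriv`). The arch
itself comes from a shooting argument (`exists_isArch`).

Differentiability in parameters is obtained by hand: Grönwall estimates turn first order expansions
of the force, uniform in time, into expansions of solutions and of Hill traces. -/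

theorem gronwallBound_le_mul_exp {δ K ε t L : ℝ} (hδ : 0 ≤ δ) (hK : 1 ≤ K) (hε : 0 ≤ ε)
    (ht : t ≤ L) : gronwallBound δ K ε t ≤ (δ + ε) * exp (K * L) := by
  rw [gronwallBound_of_K_ne_0 (by positivity)]
  have h1 : exp (K * t) ≤ exp (K * L) := exp_le_exp.2 (by gcongr)
  have h2 : ε / K ≤ ε := div_le_self hε hK
  have h3 : 0 ≤ ε / K := by positivity
  have h4 := exp_pos (K * L)
  have h5 := exp_pos (K * t)
  nlinarith [mul_le_mul_of_nonneg_left h1 hδ, mul_le_mul_of_nonneg_left h1 h3,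
    mul_le_mul_of_nonneg_right h2 h4.le]

theorem abs_le_of_abs_deriv_deriv_le {x v a : ℝ → ℝ} {K ε δ L : ℝ} (hK : 1 ≤ K) (hε : 0 ≤ ε)
    (hδ : 0 ≤ δ) (hx : ∀ t, HasDerivAt x (v t) t) (hv : ∀ t, HasDerivAt v (a t) t)
    (h0 : |x 0| ≤ δ) (h0' : |v 0| ≤ δ) (ha : ∀ t ∈ Icc 0 L, |a t| ≤ K * |x t| + ε)
    {t : ℝ} (ht : t ∈ Icc 0 L) :
    |x t| ≤ (δ + ε) * exp (K * L) ∧ |v t| ≤ (δ + ε) * exp (K * L) := by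
  have hd : ∀ t, HasDerivAt (fun t => (x t, v t)) (v t, a t) t := fun t => (hx t).prodMk (hv t)
  have := norm_le_gronwallBound_of_norm_deriv_right_le (f := fun t => (x t, v t))
    (f' := fun t => (v t, a t)) (δ := δ) (K := K) (ε := ε) (a := 0) (b := L)
    (HasDerivAt.continuousOn fun t _ => hd t) (fun t _ => (hd t).hasDerivWithinAt)
    (by simp [Prod.norm_def, h0, h0'])
    (fun t ht => by
      have := ha t ⟨ht.1, ht.2.le⟩
      simp only [Prod.norm_def, Real.norm_eq_abs]
      have h1 : |x t| ≤ max |x t| |v t| := le_max_left _ _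
      have h2 : |v t| ≤ max |x t| |v t| := le_max_right _ _
      have h3 : 0 ≤ |v t| := abs_nonneg _
      refine max_le ?_ ?_ <;> nlinarith) t ht
  have h2 := this.trans (gronwallBound_le_mul_exp (L := L) hδ hK hε (by linarith [ht.2]))
  simpa [Prod.norm_def] using h2

/-- `G` is continuous in time, and Lipschitz in space, uniformly on compact time intervals. -/
def RegularForce (G : ℝ → ℝ → ℝ) : Prop :=
  (∀ x, Continuous (G x)) ∧
    ∀ L : ℝ, ∃ K : ℝ, ∀ t, |t| ≤ L → ∀ x y, |G x t - G y t| ≤ K * |x - y|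

theorem IsSolution.hasDerivAt {G : ℝ → ℝ → ℝ} {x : ℝ → ℝ} (h : IsSolution G x) (t : ℝ) :
    HasDerivAt x (deriv x t) t := (h.1 t).hasDerivAt

theorem isSolution_of_hasDerivAt {G : ℝ → ℝ → ℝ} {x v : ℝ → ℝ} (h : ∀ t, HasDerivAt x (v t) t)
    (h' : ∀ t, HasDerivAt v (-G (x t) t) t) : IsSolution G x ∧ deriv x = v := by
  have e : deriv x = v := funext fun t => (h t).deriv
  exact ⟨⟨fun t => (h t).differentiableAt, fun t => e ▸ h' t⟩, e⟩

theorem IsSolution.continuous {G : ℝ → ℝ → ℝ} {x : ℝ → ℝ} (h : IsSolution G x) : Continuous x :=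
  h.1.continuous

theorem IsSolution.continuous_deriv {G : ℝ → ℝ → ℝ} {x : ℝ → ℝ} (h : IsSolution G x) :
    Continuous (deriv x) :=
  continuous_iff_continuousAt.2 fun t => (h.2 t).continuousAt

theorem hasDerivAt_comp_neg {x : ℝ → ℝ} {x' t : ℝ} (h : HasDerivAt x x' (-t)) :
    HasDerivAt (fun t => x (-t)) (-x') t :=
  (h.comp t (hasDerivAt_neg t)).congr_deriv (by ring)

theorem IsSolution.comp_add_const {G : ℝ → ℝ → ℝ} {x : ℝ → ℝ} (h : IsSolution G x) (c : ℝ) :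
    IsSolution (fun x t => G x (t + c)) (fun t => x (t + c)) ∧
      deriv (fun t => x (t + c)) = fun t => deriv x (t + c) :=
  isSolution_of_hasDerivAt (fun t => (h.hasDerivAt (t + c)).comp_add_const t c)
    fun t => (h.2 (t + c)).comp_add_const t c

theorem IsSolution.comp_neg {G : ℝ → ℝ → ℝ} {x : ℝ → ℝ} (h : IsSolution G x) :
    IsSolution (fun x t => G x (-t)) (fun t => x (-t)) ∧
      deriv (fun t => x (-t)) = fun t => -deriv x (-t) :=
  isSolution_of_hasDerivAt (fun t => hasDerivAt_comp_neg (h.hasDerivAt (-t)))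
    fun t => (hasDerivAt_comp_neg (h.2 (-t))).neg.congr_deriv (by simp)

theorem IsSolution.neg {G : ℝ → ℝ → ℝ} {x : ℝ → ℝ} (h : IsSolution G x) :
    IsSolution (fun x t => -G (-x) t) (fun t => -x t) ∧
      deriv (fun t => -x t) = fun t => -deriv x t :=
  isSolution_of_hasDerivAt (fun t => (h.hasDerivAt t).neg) fun t =>
    (h.2 t).neg.congr_deriv (by simp)

/-- Picard–Lindelöf needs a bounded vector field to cover a prescribed interval. The field is
truncated at a radius which Grönwall's inequality shows the solution never exceeds, so the
truncation is inactive along it. -/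
theorem RegularForce.exists_isSolution_Icc {G : ℝ → ℝ → ℝ} (hG : RegularForce G) {N : ℝ}
    (hN : 0 < N) (a b : ℝ) : ∃ z : ℝ → ℝ × ℝ, z 0 = (a, b) ∧
      ∀ t ∈ Icc (-N) N, HasDerivWithinAt z ((z t).2, -G (z t).1 t) (Icc (-N) N) t := by
  obtain ⟨K₀, hK₀⟩ := hG.2 N
  obtain ⟨B₀, hB₀⟩ := (isCompact_Icc (a := -N) (b := N)).exists_bound_of_continuousOn
    (hG.1 0).continuousOn
  set K := |K₀| + 1 with hKdef
  have hK1 : 1 ≤ K := by have := abs_nonneg K₀; linarith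
  have hK : ∀ t ∈ Icc (-N) N, ∀ x y, |G x t - G y t| ≤ K * |x - y| := fun t ht x y =>
    (hK₀ t (abs_le.2 ht) x y).trans (by gcongr; linarith [le_abs_self K₀])
  set B := |B₀| with hBdef
  have hB : ∀ t ∈ Icc (-N) N, |G 0 t| ≤ B := fun t ht => (hB₀ t ht).trans (le_abs_self _)
  have hB0 : 0 ≤ B := abs_nonneg _
  have hGle : ∀ t ∈ Icc (-N) N, ∀ x, |G x t| ≤ K * |x| + B := fun t ht x => by
    have h1 := hK t ht x 0
    have h2 := abs_sub_abs_le_abs_sub (G x t) (G 0 t)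
    have h3 := hB t ht
    rw [sub_zero] at h1
    linarith
  -- The a priori bound: truncation does not increase norms, so the truncated field still satisfies
  -- `‖V‖ ≤ K‖z‖ + B`.
  set R := (‖(a, b)‖ + B) * exp (K * N) with hR
  have hR0 : 0 ≤ R := by positivity
  set cl : ℝ → ℝ := fun x => max (-R) (min R x) with hcl
  have cl_sub : ∀ x y, |cl x - cl y| ≤ |x - y| := fun x y =>
    (abs_max_sub_max_le_max _ _ _ _).trans (max_le (by simp)
      ((abs_min_sub_min_le_max _ _ _ _).trans (by simp)))
  have cl_le : ∀ x, |cl x| ≤ R := fun x => abs_le.2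
    ⟨le_max_left _ _, max_le (by linarith) (min_le_left _ _)⟩
  have cl0 : cl 0 = 0 := by simp [hcl, hR0]
  have cl_abs : ∀ x, |cl x| ≤ |x| := fun x => by simpa [cl0] using cl_sub x 0
  have cl_eq : ∀ x, |x| ≤ R → cl x = x := fun x hx => by
    simp only [hcl]
    rw [min_eq_right (abs_le.1 hx).2, max_eq_right (abs_le.1 hx).1]
  set V : ℝ → ℝ × ℝ → ℝ × ℝ := fun t z => (cl z.2, -G (cl z.1) t) with hV
  have hVle : ∀ t ∈ Icc (-N) N, ∀ z, ‖V t z‖ ≤ K * ‖z‖ + B := fun t ht z => by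
    have h1 := hGle t ht (cl z.1)
    have h2 := cl_abs z.1
    have h3 := cl_abs z.2
    have h4 : |z.1| ≤ ‖z‖ := norm_fst_le z
    have h5 : |z.2| ≤ ‖z‖ := norm_snd_le z
    have h6 := norm_nonneg z
    rw [Prod.norm_def]
    simp only [hV, norm_neg, Real.norm_eq_abs]
    refine max_le ?_ ?_ <;> nlinarith
  have hPL : IsPicardLindelof V (tmin := -N) (tmax := N) ⟨0, by constructor <;> linarith⟩ (a, b)
      ((K * R + B) * N).toNNReal 0 (K * R + B).toNNReal K.toNNReal := by
    have hK0 : (0 : ℝ) ≤ K := by positivity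
    have hKR : 0 ≤ K * R + B := by positivity
    have hKRN : 0 ≤ (K * R + B) * N := by positivity
    refine ⟨fun t ht => LipschitzOnWith.of_dist_le_mul fun z _ w _ => ?_, fun z _ => ?_,
      fun t ht z _ => ?_, ?_⟩
    · simp only [hV, Prod.dist_eq, Real.dist_eq, Real.coe_toNNReal _ hK0]
      have h1 := hK t ht (cl z.1) (cl w.1)
      have h2 := cl_sub z.1 w.1
      have h3 := cl_sub z.2 w.2
      have h4 : |z.1 - w.1| ≤ max |z.1 - w.1| |z.2 - w.2| := le_max_left _ _
      have h5 : |z.2 - w.2| ≤ max |z.1 - w.1| |z.2 - w.2| := le_max_right _ _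
      have h6 := abs_nonneg (z.1 - w.1)
      rw [show -G (cl z.1) t - -G (cl w.1) t = -(G (cl z.1) t - G (cl w.1) t) by ring, abs_neg]
      refine max_le ?_ ?_ <;> nlinarith
    · exact (continuous_const.prodMk (hG.1 (cl z.1)).neg).continuousOn
    · have h1 := hGle t ht (cl z.1)
      have h2 := cl_le z.1
      have h3 := cl_le z.2
      rw [Prod.norm_def]
      simp only [hV, norm_neg, Real.norm_eq_abs, Real.coe_toNNReal _ hKR]
      refine max_le ?_ ?_ <;> nlinarith
    · simp [Real.coe_toNNReal _ hKR, Real.coe_toNNReal _ hKRN]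
  obtain ⟨z, hz0, hz⟩ := hPL.exists_eq_forall_mem_Icc_hasDerivWithinAt₀
  simp only at hz0
  have hbd : ∀ t ∈ Icc (-N) N, ‖z t‖ ≤ R := by
    have hc : ContinuousOn z (Icc (-N) N) := fun t ht => (hz t ht).continuousWithinAt
    have h1 : ∀ t ∈ Icc 0 N, ‖z t‖ ≤ R := fun t ht => by
      refine (norm_le_gronwallBound_of_norm_deriv_right_le (f := z) (f' := fun t => V t (z t))
        (δ := ‖(a, b)‖) (K := K) (ε := B) (a := 0) (b := N)
        (hc.mono (Icc_subset_Icc_left (by linarith))) (fun t ht => ?_) (by rw [hz0])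
        (fun t ht => hVle t ⟨by linarith [ht.1], ht.2.le⟩ _) t ht).trans
        (gronwallBound_le_mul_exp (norm_nonneg _) hK1 hB0 (by linarith [ht.2]))
      have : Icc (-N) N ∈ 𝓝 t := Icc_mem_nhds (by linarith [ht.1]) ht.2
      exact ((hz t ⟨by linarith [ht.1], ht.2.le⟩).hasDerivAt this).hasDerivWithinAt
    have h2 : ∀ t ∈ Icc 0 N, ‖z (-t)‖ ≤ R := fun t ht => by
      refine (norm_le_gronwallBound_of_norm_deriv_right_le (f := fun t => z (-t))
        (f' := fun t => -V (-t) (z (-t)))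
        (δ := ‖(a, b)‖) (K := K) (ε := B) (a := 0) (b := N)
        (hc.comp continuous_neg.continuousOn fun t ht => ⟨by simpa using ht.2,
          by linarith [ht.1]⟩) (fun t ht => ?_) (by simp [hz0])
        (fun t ht => by
          rw [norm_neg]; exact hVle (-t) ⟨by linarith [ht.2], by linarith [ht.1]⟩ _) t ht).trans
        (gronwallBound_le_mul_exp (norm_nonneg _) hK1 hB0 (by linarith [ht.2]))
      have : Icc (-N) N ∈ 𝓝 (-t) := Icc_mem_nhds (by linarith [ht.2]) (by linarith [ht.1])
      have h3 := (hz (-t) ⟨by linarith [ht.2], by linarith [ht.1]⟩).hasDerivAt this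
      have h4 := h3.scomp t (hasDerivAt_neg t)
      simpa [Function.comp_def] using h4.hasDerivWithinAt
    intro t ht
    rcases le_total 0 t with h | h
    · exact h1 t ⟨h, ht.2⟩
    · simpa using h2 (-t) ⟨by linarith, by linarith [ht.1]⟩
  refine ⟨z, hz0, fun t ht => ?_⟩
  have := hz t ht
  have e1 : cl (z t).1 = (z t).1 := cl_eq _ ((norm_fst_le _).trans (hbd t ht))
  have e2 : cl (z t).2 = (z t).2 := cl_eq _ ((norm_snd_le _).trans (hbd t ht))
  simpa [hV, e1, e2] using this

theorem RegularForce.eqOn_Ioo {G : ℝ → ℝ → ℝ} (hG : RegularForce G) {N : ℝ} (hN : 0 < N)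
    {z w : ℝ → ℝ × ℝ} (h0 : z 0 = w 0)
    (hz : ∀ t ∈ Ioo (-N) N, HasDerivAt z ((z t).2, -G (z t).1 t) t)
    (hw : ∀ t ∈ Ioo (-N) N, HasDerivAt w ((w t).2, -G (w t).1 t) t) :
    EqOn z w (Ioo (-N) N) := by
  obtain ⟨K₀, hK₀⟩ := hG.2 N
  set K := |K₀| + 1 with hKdef
  have hK1 : 1 ≤ K := by have := abs_nonneg K₀; linarith
  have hK0 : (0 : ℝ) ≤ K := by positivity
  refine ODE_solution_unique_of_mem_Ioo (v := fun t z => (z.2, -G z.1 t)) (s := fun _ => univ)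
    (K := K.toNNReal) (t₀ := 0)
    (fun t ht => LipschitzOnWith.of_dist_le_mul fun z _ w _ => ?_) (by constructor <;> linarith)
    (fun t ht => ⟨hz t ht, trivial⟩) (fun t ht => ⟨hw t ht, trivial⟩) h0
  have h1 : |G z.1 t - G w.1 t| ≤ K * |z.1 - w.1| :=
    (hK₀ t (abs_le.2 ⟨ht.1.le, ht.2.le⟩) _ _).trans (by gcongr; linarith [le_abs_self K₀])
  simp only [Prod.dist_eq, Real.dist_eq, Real.coe_toNNReal _ hK0]
  have h4 : |z.1 - w.1| ≤ max |z.1 - w.1| |z.2 - w.2| := le_max_left _ _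
  have h5 : |z.2 - w.2| ≤ max |z.1 - w.1| |z.2 - w.2| := le_max_right _ _
  have h6 := abs_nonneg (z.2 - w.2)
  rw [show -G z.1 t - -G w.1 t = -(G z.1 t - G w.1 t) by ring, abs_neg]
  refine max_le ?_ ?_ <;> nlinarith

/-- Solutions on the intervals `[-(n+1), n+1]` agree on overlaps by uniqueness, hence glue to a
global one. -/
theorem RegularForce.exists_isSolution {G : ℝ → ℝ → ℝ} (hG : RegularForce G) (a b : ℝ) :
    ∃ x, IsSolution G x ∧ x 0 = a ∧ deriv x 0 = b := by
  have hpos : ∀ n : ℕ, (0 : ℝ) < n + 1 := fun n => by positivity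
  choose z hz0 hz using fun n : ℕ => hG.exists_isSolution_Icc (hpos n) a b
  have hz' : ∀ n : ℕ, ∀ t ∈ Ioo (-((n : ℝ) + 1)) (n + 1),
      HasDerivAt (z n) ((z n t).2, -G (z n t).1 t) t := fun n t ht =>
    (hz n t ⟨ht.1.le, ht.2.le⟩).hasDerivAt (Icc_mem_nhds ht.1 ht.2)
  have hmono : ∀ n m : ℕ, n ≤ m → EqOn (z n) (z m) (Ioo (-((n : ℝ) + 1)) (n + 1)) :=
    fun n m hnm => hG.eqOn_Ioo (hpos n) ((hz0 n).trans (hz0 m).symm) (hz' n) fun t ht => by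
      have : (n : ℝ) ≤ m := by exact_mod_cast hnm
      exact hz' m t ⟨by linarith [ht.1], by linarith [ht.2]⟩
  -- The index `⌈|t|⌉₊` puts `t` strictly inside the interval of half-length `⌈|t|⌉₊ + 1`.
  set w : ℝ → ℝ × ℝ := fun t => z ⌈|t|⌉₊ t with hw
  have hwz : ∀ n : ℕ, EqOn w (z n) (Ioo (-((n : ℝ) + 1)) (n + 1)) := fun n t ht => by
    have h1 : |t| ≤ ⌈|t|⌉₊ := Nat.le_ceil _
    have h2 : t ∈ Ioo (-((⌈|t|⌉₊ : ℝ) + 1)) (⌈|t|⌉₊ + 1) :=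
      ⟨by linarith [neg_abs_le t], by linarith [le_abs_self t]⟩
    rcases le_total ⌈|t|⌉₊ n with h | h
    · exact hmono _ _ h h2
    · exact (hmono _ _ h ht).symm
  have hwd : ∀ t, HasDerivAt w ((w t).2, -G (w t).1 t) t := fun t => by
    obtain ⟨n, hn⟩ := exists_nat_gt |t|
    have hmem : t ∈ Ioo (-((n : ℝ) + 1)) (n + 1) :=
      ⟨by linarith [neg_abs_le t], by linarith [le_abs_self t]⟩
    rw [hwz n hmem]
    exact (hz' n t hmem).congr_of_eventuallyEq
      ((hwz n).eventuallyEq_of_mem (Ioo_mem_nhds hmem.1 hmem.2))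
  have hw0 : w 0 = (a, b) := by rw [hwz 0 (by simp), hz0]
  have h1 : ∀ t, HasDerivAt (fun t => (w t).1) ((w t).2) t := fun t => (hwd t).fst
  have h2 : ∀ t, HasDerivAt (fun t => (w t).2) (-G (w t).1 t) t := fun t => (hwd t).snd
  obtain ⟨h3, h4⟩ := isSolution_of_hasDerivAt h1 h2
  exact ⟨_, h3, by simp [hw0], by simp [h4, hw0]⟩

theorem RegularForce.unique {G : ℝ → ℝ → ℝ} (hG : RegularForce G) {x y : ℝ → ℝ}
    (hx : IsSolution G x) (hy : IsSolution G y) (h0 : x 0 = y 0) (h1 : deriv x 0 = deriv y 0) :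
    x = y := by
  funext t
  have := hG.eqOn_Ioo (N := |t| + 1) (by positivity) (z := fun t => (x t, deriv x t))
    (w := fun t => (y t, deriv y t)) (by simp [h0, h1])
    (fun t _ => (hx.hasDerivAt t).prodMk (hx.2 t)) (fun t _ => (hy.hasDerivAt t).prodMk (hy.2 t))
    (show t ∈ Ioo _ _ from ⟨by linarith [neg_abs_le t], by linarith [le_abs_self t]⟩)
  exact congrArg Prod.fst this

/-- Uniqueness for the initial value problem at an arbitrary initial time. -/
theorem RegularForce.unique_of_eq_at {G : ℝ → ℝ → ℝ} (hG : ∀ c, RegularForce fun x t => G x (t + c))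
    {x y : ℝ → ℝ} {c : ℝ}
    (hx : IsSolution G x) (hy : IsSolution G y) (h0 : x c = y c) (h1 : deriv x c = deriv y c) :
    x = y := by
  have hx' := hx.comp_add_const c
  have hy' := hy.comp_add_const c
  have := (hG c).unique hx'.1 hy'.1 (by simpa using h0) (by simp [hx'.2, hy'.2, h1])
  funext t
  simpa using congrFun this (t - c)

/-- The linear equation `y'' + q(t) y + g(t) = 0` with continuous coefficients is regular. -/
theorem regularForce_linear {q g : ℝ → ℝ} (hq : Continuous q) (hg : Continuous g) :
    RegularForce fun x t => q t * x + g t := by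
  refine ⟨fun x => by fun_prop, fun L => ?_⟩
  obtain ⟨K, hK⟩ := (isCompact_Icc (a := -L) (b := L)).exists_bound_of_continuousOn hq.continuousOn
  refine ⟨K, fun t ht x y => ?_⟩
  rw [show q t * x + g t - (q t * y + g t) = q t * (x - y) by ring, abs_mul]
  have := hK t (abs_le.1 ht)
  rw [Real.norm_eq_abs] at this
  gcongr

theorem regularForce_hill {q : ℝ → ℝ} (hq : Continuous q) : RegularForce fun x t => q t * x := by
  simpa using regularForce_linear hq continuous_zero

/-! ### Kepler's equation and the distance of the primaries -/

theorem abs_eccentricAnomaly_sub_le (t e : ℝ) : |eccentricAnomaly t e - t| ≤ |e| := by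
  have h := eccentricAnomaly_spec t e
  rw [show eccentricAnomaly t e - t = e * sin (eccentricAnomaly t e) by linarith, abs_mul]
  exact mul_le_of_le_one_right (abs_nonneg e) (abs_sin_le_one _)

theorem eccentricAnomaly_neg {e : ℝ} (he : |e| < 1) (t : ℝ) :
    eccentricAnomaly (-t) e = -eccentricAnomaly t e := by
  refine (eccentricAnomaly_unique he ?_).symm
  rw [sin_neg]
  linarith [eccentricAnomaly_spec t e]

theorem eccentricAnomaly_add_two_pi {e : ℝ} (he : |e| < 1) (t : ℝ) :
    eccentricAnomaly (t + 2 * π) e = eccentricAnomaly t e + 2 * π := by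
  refine (eccentricAnomaly_unique he ?_).symm
  rw [sin_add_two_pi]
  linarith [eccentricAnomaly_spec t e]

theorem abs_sin_sub_sin_le' (u v : ℝ) : |sin u - sin v| ≤ |u - v| := by
  simpa [Real.dist_eq] using Real.abs_sin_sub_sin_le u v

theorem abs_cos_sub_cos_le' (u v : ℝ) : |cos u - cos v| ≤ |u - v| := by
  rw [← sin_pi_div_two_sub, ← sin_pi_div_two_sub]
  refine (abs_sin_sub_sin_le' _ _).trans (le_of_eq ?_)
  rw [abs_sub_comm]
  congr 1
  ring

theorem continuous_eccentricAnomaly {e : ℝ} (he : |e| < 1) :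
    Continuous fun t => eccentricAnomaly t e := by
  refine LipschitzWith.continuous (K := (1 - |e|)⁻¹.toNNReal)
    (LipschitzWith.of_dist_le_mul fun s t => ?_)
  have h1 : 0 < 1 - |e| := by linarith
  rw [Real.coe_toNNReal _ (by positivity), Real.dist_eq, Real.dist_eq, inv_mul_eq_div,
    le_div_iff₀ h1]
  have hs := eccentricAnomaly_spec s e
  have ht := eccentricAnomaly_spec t e
  set u := eccentricAnomaly s e
  set v := eccentricAnomaly t e
  have h2 : u - v = (s - t) + e * (sin u - sin v) := by linarith
  have h3 : |u - v| ≤ |s - t| + |e| * |u - v| := by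
    calc |u - v| = |(s - t) + e * (sin u - sin v)| := by rw [← h2]
      _ ≤ |s - t| + |e * (sin u - sin v)| := abs_add_le _ _
      _ ≤ _ := by
        rw [abs_mul]
        exact add_le_add le_rfl (mul_le_mul_of_nonneg_left (abs_sin_sub_sin_le' _ _) (abs_nonneg _))
  linarith

/-- Subtracting the two Kepler equations leaves a term `e'(sin u - sin v)`, which is at most half of
`|u - v|` and can be absorbed. -/
theorem abs_eccentricAnomaly_sub_le_mul {e e' : ℝ} (he' : |e'| ≤ 1 / 2) (t : ℝ) :
    |eccentricAnomaly t e - eccentricAnomaly t e'| ≤ 2 * |e - e'| := by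
  have hs := eccentricAnomaly_spec t e
  have ht := eccentricAnomaly_spec t e'
  set u := eccentricAnomaly t e
  set v := eccentricAnomaly t e'
  have h2 : u - v = (e - e') * sin u + e' * (sin u - sin v) := by linarith
  have h3 : |u - v| ≤ |e - e'| * 1 + 1 / 2 * |u - v| := by
    calc |u - v| = |(e - e') * sin u + e' * (sin u - sin v)| := by rw [← h2]
      _ ≤ |(e - e') * sin u| + |e' * (sin u - sin v)| := abs_add_le _ _
      _ ≤ _ := by
        rw [abs_mul, abs_mul]
        exact add_le_add (mul_le_mul_of_nonneg_left (abs_sin_le_one u) (abs_nonneg _))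
          (mul_le_mul he' (abs_sin_sub_sin_le' _ _) (abs_nonneg _) (by norm_num))
  linarith

theorem radius_zero (t : ℝ) : radius t 0 = 1 / 2 := by simp [radius]

theorem radius_neg {e : ℝ} (he : |e| < 1) (t : ℝ) : radius (-t) e = radius t e := by
  simp [radius, eccentricAnomaly_neg he]

theorem radius_periodic {e : ℝ} (he : |e| < 1) : Function.Periodic (fun t => radius t e) (2 * π) :=
  fun t => by simp [radius, eccentricAnomaly_add_two_pi he]

theorem continuous_radius {e : ℝ} (he : |e| < 1) : Continuous fun t => radius t e := by
  have := continuous_eccentricAnomaly he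
  unfold radius
  fun_prop

theorem radius_mem_Icc {e : ℝ} (he : |e| ≤ 1 / 2) (t : ℝ) : radius t e ∈ Icc (1 / 4) (3 / 4) := by
  have h : |e * cos (eccentricAnomaly t e)| ≤ 1 / 2 := by
    rw [abs_mul]
    exact (mul_le_of_le_one_right (abs_nonneg e) (abs_cos_le_one _)).trans he
  have := abs_le.1 h
  constructor <;> simp only [radius] <;> linarith

/-- The expansion `r = 1/2 - (e/2) cos t + O(e²)` in its strict form, comparing two eccentricities.
The error is uniform in `t`. -/
theorem abs_radius_sub_le {e e' : ℝ} (he' : |e'| ≤ 1 / 2) (t : ℝ) :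
    |radius t e - radius t e' + 1 / 2 * cos t * (e - e')| ≤ (|e| + |e'|) * |e - e'| := by
  have h1 := abs_eccentricAnomaly_sub_le_mul (e := e) he' t
  have h2 := abs_eccentricAnomaly_sub_le t e
  simp only [radius]
  set u := eccentricAnomaly t e
  set v := eccentricAnomaly t e'
  rw [show 1 / 2 * (1 - e * cos u) - 1 / 2 * (1 - e' * cos v) + 1 / 2 * cos t * (e - e') =
    -(1 / 2) * ((e - e') * (cos u - cos t) + e' * (cos u - cos v)) by ring, abs_mul]
  have h3 : |(e - e') * (cos u - cos t) + e' * (cos u - cos v)| ≤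
      |e - e'| * |e| + |e'| * (2 * |e - e'|) := by
    refine (abs_add_le _ _).trans ?_
    rw [abs_mul, abs_mul]
    exact add_le_add
      (mul_le_mul_of_nonneg_left ((abs_cos_sub_cos_le' _ _).trans h2) (abs_nonneg _))
      (mul_le_mul_of_nonneg_left ((abs_cos_sub_cos_le' _ _).trans h1) (abs_nonneg _))
  rw [abs_neg, abs_of_pos (by norm_num : (0 : ℝ) < 1 / 2)]
  nlinarith [abs_nonneg e, abs_nonneg (e - e'), mul_nonneg (abs_nonneg e) (abs_nonneg (e - e'))]

theorem abs_radius_sub_le_abs {e e' : ℝ} (he : |e| ≤ 1 / 2) (he' : |e'| ≤ 1 / 2) (t : ℝ) :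
    |radius t e - radius t e'| ≤ 2 * |e - e'| := by
  have h1 := abs_radius_sub_le (e := e) he' t
  have h2 : |1 / 2 * cos t * (e - e')| ≤ 1 / 2 * |e - e'| := by
    rw [abs_mul, abs_mul, abs_of_pos (by norm_num : (0 : ℝ) < 1 / 2)]
    have := abs_cos_le_one t
    gcongr
    linarith
  have h3 : (|e| + |e'|) * |e - e'| ≤ 1 * |e - e'| := by gcongr; linarith
  have h4 := abs_sub_abs_le_abs_sub (radius t e - radius t e') (-(1 / 2 * cos t * (e - e')))
  rw [sub_neg_eq_add, abs_neg] at h4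
  have := abs_nonneg (e - e')
  linarith

/-! ### The attraction of the primaries and its partial derivatives -/

/-- The inverse of the distance between `(x, 0)` and `(0, r)`. -/
def invDist (x r : ℝ) : ℝ := (√(x ^ 2 + r ^ 2))⁻¹

/-- `x (x² + r²)^{-3/2}`. -/
def attraction (x r : ℝ) : ℝ := x * invDist x r ^ 3

/-- The partial derivative of `attraction` in `x`. -/
def attractionX (x r : ℝ) : ℝ := invDist x r ^ 3 - 3 * x ^ 2 * invDist x r ^ 5

/-- The partial derivative of `attraction` in `r`. -/
def attractionR (x r : ℝ) : ℝ := -3 * x * r * invDist x r ^ 5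

/-- The second partial derivative of `attraction` in `x`. -/
def attractionXX (x r : ℝ) : ℝ := -9 * x * invDist x r ^ 5 + 15 * x ^ 3 * invDist x r ^ 7

/-- The mixed second partial derivative of `attraction`. -/
def attractionXR (x r : ℝ) : ℝ := -3 * r * invDist x r ^ 5 + 15 * x ^ 2 * r * invDist x r ^ 7

theorem force_eq_attraction (x t e : ℝ) : force x t e = attraction x (radius t e) := by
  have h : (0 : ℝ) ≤ x ^ 2 + radius t e ^ 2 := by positivity
  rw [force, attraction, invDist, div_eq_mul_inv, inv_pow]
  rw [sqrt_eq_rpow, ← rpow_mul_natCast h]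
  norm_num

theorem invDist_pos {x r : ℝ} (hr : 0 < r) : 0 < invDist x r := by
  unfold invDist; positivity

theorem invDist_sq {x r : ℝ} (hr : 0 < r) : invDist x r ^ 2 * (x ^ 2 + r ^ 2) = 1 := by
  rw [invDist, inv_pow, sq_sqrt (by positivity)]
  field_simp

theorem abs_mul_invDist_le {x r : ℝ} (hr : 0 < r) : |x| * invDist x r ≤ 1 := by
  have h := invDist_sq (x := x) hr
  have h1 := invDist_pos (x := x) hr
  have h2 := sq_abs x
  have : (|x| * invDist x r) ^ 2 ≤ 1 := by nlinarith [mul_nonneg (sq_nonneg r) (sq_nonneg (invDist x r))]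
  exact (sq_le_one_iff₀ (by positivity)).1 this

theorem mul_invDist_le {x r : ℝ} (hr : 0 < r) : r * invDist x r ≤ 1 := by
  have h := invDist_sq (x := x) hr
  have h1 := invDist_pos (x := x) hr
  have : (r * invDist x r) ^ 2 ≤ 1 := by nlinarith [mul_nonneg (sq_nonneg x) (sq_nonneg (invDist x r))]
  exact (sq_le_one_iff₀ (by positivity)).1 this

theorem invDist_le_four {x r : ℝ} (hr : 1 / 4 ≤ r) : invDist x r ≤ 4 := by
  have h := mul_invDist_le (x := x) (show 0 < r by linarith)
  have h1 := invDist_pos (x := x) (show 0 < r by linarith)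
  nlinarith

theorem hasDerivAt_invDist_fst {x r : ℝ} (hr : 0 < r) :
    HasDerivAt (fun x => invDist x r) (-x * invDist x r ^ 3) x := by
  have hS : 0 < x ^ 2 + r ^ 2 := by positivity
  have h := ((((hasDerivAt_id' x).fun_pow 2).add_const (r ^ 2)).sqrt hS.ne').inv (sqrt_pos.2 hS).ne'
  refine h.congr_deriv ?_
  simp only [invDist]
  have := sqrt_pos.2 hS
  push_cast
  field_simp

theorem hasDerivAt_invDist_snd {x r : ℝ} (hr : 0 < r) :
    HasDerivAt (fun r => invDist x r) (-r * invDist x r ^ 3) r := by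
  have hS : 0 < x ^ 2 + r ^ 2 := by positivity
  have h := ((((hasDerivAt_id' r).fun_pow 2).const_add (x ^ 2)).sqrt hS.ne').inv (sqrt_pos.2 hS).ne'
  refine h.congr_deriv ?_
  simp only [invDist]
  have := sqrt_pos.2 hS
  push_cast
  field_simp

theorem hasDerivAt_attraction_fst {x r : ℝ} (hr : 0 < r) :
    HasDerivAt (fun x => attraction x r) (attractionX x r) x := by
  refine ((hasDerivAt_id' x).mul ((hasDerivAt_invDist_fst hr).fun_pow 3)).congr_deriv ?_
  simp only [attractionX]
  push_cast
  ring

theorem hasDerivAt_attraction_snd {x r : ℝ} (hr : 0 < r) :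
    HasDerivAt (fun r => attraction x r) (attractionR x r) r := by
  refine (((hasDerivAt_invDist_snd hr).fun_pow 3).const_mul x).congr_deriv ?_
  simp only [attractionR]
  push_cast
  ring

theorem hasDerivAt_attractionX_fst {x r : ℝ} (hr : 0 < r) :
    HasDerivAt (fun x => attractionX x r) (attractionXX x r) x := by
  refine (((hasDerivAt_invDist_fst hr).fun_pow 3).sub ((((hasDerivAt_id' x).fun_pow 2).const_mul 3).mul
    ((hasDerivAt_invDist_fst hr).fun_pow 5))).congr_deriv ?_
  simp only [attractionXX]
  push_cast
  ring

theorem hasDerivAt_attractionX_snd {x r : ℝ} (hr : 0 < r) :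
    HasDerivAt (fun r => attractionX x r) (attractionXR x r) r := by
  refine (((hasDerivAt_invDist_snd hr).fun_pow 3).sub
    (((hasDerivAt_invDist_snd hr).fun_pow 5).const_mul (3 * x ^ 2))).congr_deriv ?_
  simp only [attractionXR]
  push_cast
  ring

theorem hasDerivAt_attractionR_fst {x r : ℝ} (hr : 0 < r) :
    HasDerivAt (fun x => attractionR x r) (attractionXR x r) x := by
  refine ((((hasDerivAt_id' x).const_mul (-3)).mul_const r).mul
    ((hasDerivAt_invDist_fst hr).fun_pow 5)).congr_deriv ?_
  simp only [attractionXR]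
  push_cast
  ring

theorem contDiffAt_invDist {z : ℝ × ℝ} (hz : 0 < z.2) :
    ContDiffAt ℝ 1 (fun z : ℝ × ℝ => invDist z.1 z.2) z := by
  have hS : z.1 ^ 2 + z.2 ^ 2 ≠ 0 := by positivity
  have hS' : √(z.1 ^ 2 + z.2 ^ 2) ≠ 0 := by positivity
  exact ((((contDiff_fst.pow 2).add (contDiff_snd.pow 2)).contDiffAt).sqrt hS).inv hS'

theorem contDiffAt_attraction {z : ℝ × ℝ} (hz : 0 < z.2) :
    ContDiffAt ℝ 1 (fun z : ℝ × ℝ => attraction z.1 z.2) z :=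
  contDiffAt_fst.mul ((contDiffAt_invDist hz).pow 3)

theorem contDiffAt_attractionX {z : ℝ × ℝ} (hz : 0 < z.2) :
    ContDiffAt ℝ 1 (fun z : ℝ × ℝ => attractionX z.1 z.2) z :=
  ((contDiffAt_invDist hz).pow 3).sub
    ((contDiffAt_const.mul (contDiffAt_fst.pow 2)).mul ((contDiffAt_invDist hz).pow 5))

theorem continuous_invDist {r : ℝ} (hr : 0 < r) : Continuous fun x => invDist x r :=
  continuous_iff_continuousAt.2 fun _ => (hasDerivAt_invDist_fst hr).continuousAt

theorem continuous_attractionX {r : ℝ} (hr : 0 < r) : Continuous fun x => attractionX x r := by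
  have := continuous_invDist hr
  unfold attractionX
  fun_prop

theorem continuous_attractionR {r : ℝ} (hr : 0 < r) : Continuous fun x => attractionR x r := by
  have := continuous_invDist hr
  unfold attractionR
  fun_prop

theorem continuous_attractionXX {r : ℝ} (hr : 0 < r) : Continuous fun x => attractionXX x r := by
  have := continuous_invDist hr
  unfold attractionXX
  fun_prop

theorem continuous_attractionXR {r : ℝ} (hr : 0 < r) : Continuous fun x => attractionXR x r := by
  have := continuous_invDist hr
  unfold attractionXR
  fun_prop

theorem invDist_neg (x r : ℝ) : invDist (-x) r = invDist x r := by simp [invDist]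

theorem attraction_neg (x r : ℝ) : attraction (-x) r = -attraction x r := by
  simp [attraction, invDist_neg]

theorem attractionX_neg (x r : ℝ) : attractionX (-x) r = attractionX x r := by
  simp [attractionX, invDist_neg]

theorem abs_attraction_le {x r : ℝ} (hr : 1 / 4 ≤ r) : |attraction x r| ≤ 16 := by
  have hr' : 0 < r := by linarith
  have h1 := abs_mul_invDist_le (x := x) hr'
  have h2 := invDist_le_four (x := x) hr
  have h3 := invDist_pos (x := x) hr'
  rw [attraction, abs_mul, abs_pow, abs_of_pos h3,
    show |x| * invDist x r ^ 3 = (|x| * invDist x r) * invDist x r ^ 2 by ring]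
  calc _ ≤ 1 * (4 : ℝ) ^ 2 := by gcongr
    _ = 16 := by norm_num

/-- With `ρ` the inverse distance, the derivative is `ρ³(1 - 3x²ρ²)`, where `ρ ≤ 4` and `x²ρ² ≤ 1`.
The bound holds for all `x`, so the force is globally Lipschitz in space when `|e| ≤ 1/2`. -/
theorem abs_attractionX_le {x r : ℝ} (hr : 1 / 4 ≤ r) : |attractionX x r| ≤ 256 := by
  have hr' : 0 < r := by linarith
  have h1 := abs_mul_invDist_le (x := x) hr'
  have h2 := invDist_le_four (x := x) hr
  have h3 := invDist_pos (x := x) hr'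
  have h4 : x ^ 2 * invDist x r ^ 2 ≤ 1 := by
    rw [← sq_abs x, ← mul_pow]
    exact pow_le_one₀ (by positivity) h1
  have h5 : invDist x r ^ 3 ≤ 4 ^ 3 := by gcongr
  have h6 : 0 < invDist x r ^ 3 := by positivity
  have h7 : 0 ≤ x ^ 2 * invDist x r ^ 2 := by positivity
  rw [attractionX, show invDist x r ^ 3 - 3 * x ^ 2 * invDist x r ^ 5 =
    invDist x r ^ 3 * (1 - 3 * (x ^ 2 * invDist x r ^ 2)) by ring, abs_mul, abs_of_pos h6]
  calc _ ≤ (4 : ℝ) ^ 3 * 4 := by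
        gcongr
        exact abs_le.2 ⟨by linarith, by linarith⟩
    _ = 256 := by norm_num

theorem abs_attractionR_le {x r : ℝ} (hr : 1 / 4 ≤ r) : |attractionR x r| ≤ 256 := by
  have hr' : 0 < r := by linarith
  have h1 := abs_mul_invDist_le (x := x) hr'
  have h0 := mul_invDist_le (x := x) hr'
  have h2 := invDist_le_four (x := x) hr
  have h3 := invDist_pos (x := x) hr'
  have h5 : invDist x r ^ 3 ≤ 4 ^ 3 := by gcongr
  rw [attractionR, show -3 * x * r * invDist x r ^ 5 =
    -3 * x * (r * invDist x r ^ 5) by ring, abs_mul, abs_mul,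
    abs_of_pos (show 0 < r * invDist x r ^ 5 by positivity),
    show |(-3 : ℝ)| * |x| * (r * invDist x r ^ 5) = |(-3 : ℝ)| * (|x| * invDist x r) *
      (r * invDist x r) * invDist x r ^ 3 by ring]
  calc _ ≤ |(-3 : ℝ)| * 1 * 1 * 4 ^ 3 := by gcongr
    _ ≤ 256 := by norm_num

theorem abs_attraction_sub_le {x x' r r' : ℝ} (hr : 1 / 4 ≤ r) (hr' : 1 / 4 ≤ r') :
    |attraction x r - attraction x' r'| ≤ 256 * |x - x'| + 256 * |r - r'| := by
  have h1 := convex_univ.norm_image_sub_le_of_norm_hasDerivWithin_le (f := fun x => attraction x r)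
    (f' := fun x => attractionX x r) (C := 256) (x := x') (y := x)
    (fun x _ => (hasDerivAt_attraction_fst (by linarith)).hasDerivWithinAt)
    (fun x _ => abs_attractionX_le hr) trivial trivial
  have h2 := (convex_Ici (1 / 4 : ℝ)).norm_image_sub_le_of_norm_hasDerivWithin_le
    (f := fun r => attraction x' r) (f' := fun r => attractionR x' r) (C := 256) (x := r') (y := r)
    (fun x hx => (hasDerivAt_attraction_snd (by have := mem_Ici.1 hx; linarith)).hasDerivWithinAt)
    (fun x hx => abs_attractionR_le hx) hr' hr
  simp only [Real.norm_eq_abs] at h1 h2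
  have := abs_sub_le (attraction x r) (attraction x' r) (attraction x' r')
  linarith

theorem continuousOn_attraction_snd (x : ℝ) : ContinuousOn (fun r => attraction x r) (Ioi 0) :=
  fun _ hr => (hasDerivAt_attraction_snd hr).continuousAt.continuousWithinAt

theorem abs_force_sub_le {e e' : ℝ} (he : |e| ≤ 1 / 2) (he' : |e'| ≤ 1 / 2) (x x' t : ℝ) :
    |force x t e - force x' t e'| ≤ 512 * (|x - x'| + |e - e'|) := by
  rw [force_eq_attraction, force_eq_attraction]
  have h1 := abs_attraction_sub_le (x := x) (x' := x') (radius_mem_Icc he t).1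
    (radius_mem_Icc he' t).1
  have h2 := abs_radius_sub_le_abs he he' t
  have := abs_nonneg (x - x')
  linarith

theorem regularForce_force {e : ℝ} (he : |e| ≤ 1 / 2) (c : ℝ) :
    RegularForce fun x t => force x (t + c) e := by
  refine ⟨fun x => ?_, fun L => ⟨512, fun t _ x y => by
    simpa using abs_force_sub_le he he x y (t + c)⟩⟩
  simp only [force_eq_attraction]
  exact (continuousOn_attraction_snd x).comp_continuous
    ((continuous_radius (by linarith)).comp (continuous_add_const c)) fun t =>
      show (0 : ℝ) < _ by have := (radius_mem_Icc he (t + c)).1; linarith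

theorem deriv_force {e : ℝ} (he : |e| ≤ 1 / 2) (x t : ℝ) :
    deriv (fun z => force z t e) x = attractionX x (radius t e) := by
  simp only [force_eq_attraction]
  exact (hasDerivAt_attraction_fst (by have := (radius_mem_Icc he t).1; linarith)).deriv

theorem force_neg (x t e : ℝ) : force (-x) t e = -force x t e := by
  simp [force_eq_attraction, attraction_neg]

theorem force_zero (x t : ℝ) : force x t 0 = attraction x (1 / 2) := by
  rw [force_eq_attraction, radius_zero]

/-! ### First order expansions which are uniform in time -/

/-- Uniform continuity of the derivative on a compact rectangle makes the mean value inequality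
uniform over the base points `(x₀, 1/2)`. A single `δ` then serves a whole orbit segment. -/
theorem exists_uniform_strict_deriv {g gx gr : ℝ → ℝ → ℝ}
    (hg : ∀ z : ℝ × ℝ, 0 < z.2 → ContDiffAt ℝ 1 (fun z : ℝ × ℝ => g z.1 z.2) z)
    (hx : ∀ x r, 0 < r → HasDerivAt (fun x => g x r) (gx x r) x)
    (hr : ∀ x r, 0 < r → HasDerivAt (fun r => g x r) (gr x r) r) (R : ℝ) {ε : ℝ} (hε : 0 < ε) :
    ∃ δ > 0, ∀ x₀ x x' r r', |x₀| ≤ R → |x - x₀| ≤ δ → |x' - x₀| ≤ δ → |r - 1 / 2| ≤ δ →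
      |r' - 1 / 2| ≤ δ → |g x r - g x' r' - (gx x₀ (1 / 2) * (x - x') + gr x₀ (1 / 2) * (r - r'))| ≤
        ε * (|x - x'| + |r - r'|) := by
  set f : ℝ × ℝ → ℝ := fun z => g z.1 z.2 with hf
  set U : Set (ℝ × ℝ) := {z | 0 < z.2} with hU
  have hUo : IsOpen U := isOpen_lt continuous_const continuous_snd
  have hfd : ∀ z ∈ U, HasFDerivAt f (fderiv ℝ f z) z := fun z hz =>
    ((hg z hz).differentiableAt (by norm_num)).hasFDerivAt
  have hform : ∀ z ∈ U, ∀ h k : ℝ, fderiv ℝ f z (h, k) = gx z.1 z.2 * h + gr z.1 z.2 * k := by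
    intro z hz h k
    have h1 : HasDerivAt (fun x => f (x, z.2)) (fderiv ℝ f z (1, 0)) z.1 :=
      HasFDerivAt.comp_hasDerivAt (f := fun x => (x, z.2)) z.1 (hfd z hz)
        ((hasDerivAt_id z.1).prodMk (hasDerivAt_const z.1 z.2))
    have h2 : HasDerivAt (fun r => f (z.1, r)) (fderiv ℝ f z (0, 1)) z.2 :=
      HasFDerivAt.comp_hasDerivAt (f := fun r => (z.1, r)) z.2 (hfd z hz)
        ((hasDerivAt_const z.2 z.1).prodMk (hasDerivAt_id z.2))
    have h3 := h1.unique (hx z.1 z.2 hz)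
    have h4 := h2.unique (hr z.1 z.2 hz)
    rw [← h3, ← h4]
    rw [show ((h, k) : ℝ × ℝ) = h • (1, 0) + k • (0, 1) by simp, map_add, map_smul, map_smul]
    simp [mul_comm]
  have hcont : ContinuousOn (fderiv ℝ f) U :=
    ContDiffOn.continuousOn_fderiv_of_isOpen (n := 1) (fun z hz => (hg z hz).contDiffWithinAt)
      hUo le_rfl
  set C : Set (ℝ × ℝ) := Icc (-(R + 1)) (R + 1) ×ˢ Icc (1 / 4) (3 / 4) with hC
  have hCc : IsCompact C := isCompact_Icc.prod isCompact_Icc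
  have hCU : C ⊆ U := fun z hz => show 0 < z.2 by have := hz.2.1; linarith
  have huc := hCc.uniformContinuousOn_of_continuous (hcont.mono hCU)
  obtain ⟨δ₀, hδ₀, hδ⟩ := Metric.uniformContinuousOn_iff.1 huc ε hε
  set δ := min (δ₀ / 2) (1 / 4) with hδdef
  have hδp : 0 < δ := by positivity
  have hδ1 : δ < δ₀ := (min_le_left _ _).trans_lt (by linarith)
  have hδ2 : δ ≤ 1 / 4 := min_le_right _ _
  refine ⟨δ, hδp, fun x₀ x x' r r' hx₀ h1 h2 h3 h4 => ?_⟩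
  have hsub : Metric.closedBall ((x₀, 1 / 2) : ℝ × ℝ) δ ⊆ C := fun z hz => by
    rw [Metric.mem_closedBall, Prod.dist_eq, Real.dist_eq, Real.dist_eq, max_le_iff] at hz
    have a := abs_le.1 hz.1
    have b := abs_le.1 hz.2
    have c := abs_le.1 hx₀
    simp only at a b
    exact ⟨⟨by linarith, by linarith⟩, ⟨by linarith, by linarith⟩⟩
  have h0C : ((x₀, 1 / 2) : ℝ × ℝ) ∈ C := hsub (Metric.mem_closedBall_self hδp.le)
  have hmv := (convex_closedBall ((x₀, 1 / 2) : ℝ × ℝ) δ).norm_image_sub_le_of_norm_hasFDerivWithin_le'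
    (f := f) (f' := fderiv ℝ f) (φ := fderiv ℝ f (x₀, 1 / 2)) (C := ε) (x := (x', r')) (y := (x, r))
    (fun z hz => (hfd z (hCU (hsub hz))).hasFDerivWithinAt)
    (fun z hz => by
      rw [← dist_eq_norm]
      exact (hδ z (hsub hz) _ h0C ((Metric.mem_closedBall.1 hz).trans_lt hδ1)).le)
    (by rw [Metric.mem_closedBall, Prod.dist_eq]; exact max_le h2 h4)
    (by rw [Metric.mem_closedBall, Prod.dist_eq]; exact max_le h1 h3)
  rw [Prod.mk_sub_mk, hform _ (hCU h0C)] at hmv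
  refine hmv.trans ?_
  gcongr
  rw [Prod.norm_def]
  exact max_le (by simp) (by simp)

theorem exists_uniform_expansion {g gx gr : ℝ → ℝ → ℝ}
    (hg : ∀ z : ℝ × ℝ, 0 < z.2 → ContDiffAt ℝ 1 (fun z : ℝ × ℝ => g z.1 z.2) z)
    (hx : ∀ x r, 0 < r → HasDerivAt (fun x => g x r) (gx x r) x)
    (hr : ∀ x r, 0 < r → HasDerivAt (fun r => g x r) (gr x r) r)
    (hc : Continuous fun x => gr x (1 / 2)) (R : ℝ) {ε : ℝ} (hε : 0 < ε) :
    ∃ δ > 0, δ ≤ 1 / 2 ∧ ∀ t x₀ x x' e e', |x₀| ≤ R → |x - x₀| ≤ δ → |x' - x₀| ≤ δ → |e| ≤ δ →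
      |e'| ≤ δ → |g x (radius t e) - g x' (radius t e') -
        (gx x₀ (1 / 2) * (x - x') + -(1 / 2) * gr x₀ (1 / 2) * cos t * (e - e'))| ≤
        ε * (|x - x'| + |e - e'|) := by
  obtain ⟨M₀, hM₀⟩ := (isCompact_Icc (a := -R) (b := R)).exists_bound_of_continuousOn
    hc.continuousOn
  set M := |M₀| with hMdef
  have hM0 : 0 ≤ M := abs_nonneg _
  obtain ⟨δ₁, hδ₁, h₁⟩ := exists_uniform_strict_deriv hg hx hr R (show 0 < ε / 4 by linarith)
  -- `δ₁ / 2` compensates the Lipschitz constant `2` of `radius` in `e`. The last entry makes `M ·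
  -- 2δ ≤ ε/2`, which absorbs the quadratic error of the radius.
  set δ := min (min (1 / 2) (δ₁ / 2)) (ε / (4 * (M + 1))) with hδ
  have hδp : 0 < δ := by positivity
  have hδ2 : δ ≤ 1 / 2 := (min_le_left _ _).trans (min_le_left _ _)
  have hδ3 : δ ≤ δ₁ / 2 := (min_le_left _ _).trans (min_le_right _ _)
  have hδ4 : δ * (4 * (M + 1)) ≤ ε := by
    rw [← le_div_iff₀ (by positivity)]
    exact min_le_right _ _
  refine ⟨δ, hδp, hδ2, fun t x₀ x x' e e' hx₀ hxδ hx'δ heδ he'δ => ?_⟩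
  have hr0 : ∀ e, |e| ≤ δ → |radius t e - 1 / 2| ≤ δ₁ := fun e he => by
    have := abs_radius_sub_le_abs (e := e) (e' := 0) (he.trans hδ2) (by norm_num) t
    rw [radius_zero, sub_zero] at this
    linarith
  have hA := h₁ x₀ x x' (radius t e) (radius t e') hx₀ (by linarith) (by linarith) (hr0 e heδ)
    (hr0 e' he'δ)
  have hB := abs_radius_sub_le (e := e) (he'δ.trans hδ2) t
  have hC := abs_radius_sub_le_abs (heδ.trans hδ2) (he'δ.trans hδ2) t
  have hD : |gr x₀ (1 / 2)| ≤ M := (hM₀ x₀ (abs_le.1 hx₀)).trans (le_abs_self _)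
  set ρ := radius t e - radius t e' with hρ
  rw [show g x (radius t e) - g x' (radius t e') -
        (gx x₀ (1 / 2) * (x - x') + -(1 / 2) * gr x₀ (1 / 2) * cos t * (e - e')) =
      (g x (radius t e) - g x' (radius t e') - (gx x₀ (1 / 2) * (x - x') + gr x₀ (1 / 2) * ρ)) +
      gr x₀ (1 / 2) * (ρ + 1 / 2 * cos t * (e - e')) by ring]
  refine (abs_add_le _ _).trans ?_
  rw [abs_mul]
  have hE : |gr x₀ (1 / 2)| * |ρ + 1 / 2 * cos t * (e - e')| ≤ M * ((δ + δ) * |e - e'|) := by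
    gcongr
    exact hB.trans (by gcongr)
  have hF : M * ((δ + δ) * |e - e'|) ≤ ε / 2 * |e - e'| := by
    rw [← mul_assoc]
    gcongr
    nlinarith
  have h5 := abs_nonneg (x - x')
  have h6 := abs_nonneg (e - e')
  nlinarith

theorem force_uniform_expansion (R : ℝ) {ε : ℝ} (hε : 0 < ε) :
    ∃ δ > 0, δ ≤ 1 / 2 ∧ ∀ t x₀ x x' e e', |x₀| ≤ R → |x - x₀| ≤ δ → |x' - x₀| ≤ δ → |e| ≤ δ →
      |e'| ≤ δ → |force x t e - force x' t e' -
        (attractionX x₀ (1 / 2) * (x - x') + -(1 / 2) * attractionR x₀ (1 / 2) * cos t * (e - e'))| ≤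
        ε * (|x - x'| + |e - e'|) := by
  simp only [force_eq_attraction]
  exact exists_uniform_expansion (fun _ => contDiffAt_attraction)
    (fun _ _ => hasDerivAt_attraction_fst) (fun _ _ => hasDerivAt_attraction_snd)
    (continuous_attractionR (by norm_num)) R hε

theorem attractionX_uniform_expansion (R : ℝ) {ε : ℝ} (hε : 0 < ε) :
    ∃ δ > 0, δ ≤ 1 / 2 ∧ ∀ t x₀ x x' e e', |x₀| ≤ R → |x - x₀| ≤ δ → |x' - x₀| ≤ δ → |e| ≤ δ →
      |e'| ≤ δ → |attractionX x (radius t e) - attractionX x' (radius t e') -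
        (attractionXX x₀ (1 / 2) * (x - x') +
          -(1 / 2) * attractionXR x₀ (1 / 2) * cos t * (e - e'))| ≤
        ε * (|x - x'| + |e - e'|) :=
  exists_uniform_expansion (fun _ => contDiffAt_attractionX)
    (fun _ _ => hasDerivAt_attractionX_fst) (fun _ _ => hasDerivAt_attractionX_snd)
    (continuous_attractionXR (by norm_num)) R hε

/-! ### Dependence of the solutions on the initial data and on the eccentricity -/

/-- The coefficient of `e cos t` in the expansion of the force at `e = 0`. -/
def tidal (x : ℝ) : ℝ := -(1 / 2) * attractionR x (1 / 2)

theorem continuous_tidal : Continuous tidal :=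
  continuous_const.mul (continuous_attractionR (by norm_num))

/-- The circular Sitnikov problem `x'' + F(x, t, 0) = 0`. -/
def IsCircularSolution (x : ℝ → ℝ) : Prop := IsSolution (fun x _ => attraction x (1 / 2)) x

theorem isSolution_force_zero_iff {x : ℝ → ℝ} :
    IsSolution (fun x t => force x t 0) x ↔ IsCircularSolution x := by
  simp only [force_zero, IsCircularSolution]

theorem abs_sub_le_of_isSolution {e e' L η : ℝ} (he : |e| ≤ 1 / 2) (he' : |e'| ≤ 1 / 2)
    {x x' : ℝ → ℝ} (hx : IsSolution (fun x t => force x t e) x)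
    (hx' : IsSolution (fun x t => force x t e') x') (h0 : |x 0 - x' 0| ≤ η)
    (h1 : |deriv x 0 - deriv x' 0| ≤ η) (h2 : |e - e'| ≤ η) {t : ℝ} (ht : t ∈ Icc 0 L) :
    |x t - x' t| ≤ 513 * exp (512 * L) * η ∧
      |deriv x t - deriv x' t| ≤ 513 * exp (512 * L) * η := by
  have hη : 0 ≤ η := (abs_nonneg _).trans h0
  have := abs_le_of_abs_deriv_deriv_le (x := fun t => x t - x' t)
    (v := fun t => deriv x t - deriv x' t) (a := fun t => -force (x t) t e - -force (x' t) t e')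
    (K := 512) (ε := 512 * η) (δ := η) (L := L) (by norm_num) (by positivity) hη
    (fun t => (hx.hasDerivAt t).sub (hx'.hasDerivAt t)) (fun t => (hx.2 t).sub (hx'.2 t)) h0 h1
    (fun t _ => by
      rw [show -force (x t) t e - -force (x' t) t e' = -(force (x t) t e - force (x' t) t e') by
        ring, abs_neg]
      have := abs_force_sub_le he he' (x t) (x' t) t
      linarith) ht
  rwa [show (η + 512 * η) * exp (512 * L) = 513 * exp (512 * L) * η by ring] at this

/-- Strict differentiability of the flow in initial data and eccentricity. Grönwall is used twice:
first to keep both solutions near `x₀` and bound their difference by a multiple of `η`, then on the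
remainder after subtracting the linearized solution `y`. Here `η` measures the increments and `ζ`
the mismatch of the initial data of `y`. Allowing `e' ≠ 0` is what the implicit function argument
needs. -/
theorem exists_uniform_flow_expansion {x₀ : ℝ → ℝ} (hx₀ : IsCircularSolution x₀) (L : ℝ)
    {ε : ℝ} (hε : 0 < ε) :
    ∃ δ > 0, δ ≤ 1 / 2 ∧ ∀ (e e' η ζ : ℝ) (x x' y : ℝ → ℝ), |e| ≤ δ → |e'| ≤ δ →
      IsSolution (fun x t => force x t e) x → IsSolution (fun x t => force x t e') x' →
      |x 0 - x₀ 0| ≤ δ → |deriv x 0 - deriv x₀ 0| ≤ δ →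
      |x' 0 - x₀ 0| ≤ δ → |deriv x' 0 - deriv x₀ 0| ≤ δ →
      IsSolution (fun y t => attractionX (x₀ t) (1 / 2) * y + (e - e') * (tidal (x₀ t) * cos t)) y →
      |x 0 - x' 0| ≤ η → |deriv x 0 - deriv x' 0| ≤ η → |e - e'| ≤ η →
      |x 0 - x' 0 - y 0| ≤ ζ → |deriv x 0 - deriv x' 0 - deriv y 0| ≤ ζ →
      ∀ t ∈ Icc 0 L, |x t - x' t - y t| ≤ ε * η + exp (256 * L) * ζ ∧
        |deriv x t - deriv x' t - deriv y t| ≤ ε * η + exp (256 * L) * ζ := by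
  obtain ⟨R, hR⟩ := (isCompact_Icc (a := 0) (b := L)).exists_bound_of_continuousOn
    hx₀.continuous.continuousOn
  set C := 513 * exp (512 * L) with hC
  have hC0 : 0 < C := by positivity
  set E := exp (256 * L) with hE
  have hE0 : 0 < E := exp_pos _
  -- The force remainder is at most `ε'(C + 1)η`, and Grönwall multiplies it by `E`; the product is
  -- exactly `εη`.
  set ε' := ε / ((C + 1) * E) with hε'
  have hε'0 : 0 < ε' := by positivity
  have hεε' : ε' * (C + 1) * E = ε := by rw [hε']; field_simp
  obtain ⟨δ₁, hδ₁, -, h₁⟩ := force_uniform_expansion R hε'0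
  have hδ : 0 < min (min δ₁ (1 / 2)) (δ₁ / C) := by positivity
  set δ := min (min δ₁ (1 / 2)) (δ₁ / C) with hδdef
  have hδ2 : δ ≤ 1 / 2 := (min_le_left _ _).trans (min_le_right _ _)
  have hδ1 : δ ≤ δ₁ := (min_le_left _ _).trans (min_le_left _ _)
  have hδC : C * δ ≤ δ₁ := by
    have : δ ≤ δ₁ / C := min_le_right _ _
    rw [le_div_iff₀ hC0] at this
    linarith
  refine ⟨δ, hδ, hδ2, fun e e' η ζ x x' y he he' hx hx' hx0 hx1 hx'0 hx'1 hy h0 h1 h2 h3 h4 => ?_⟩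
  have hη : 0 ≤ η := (abs_nonneg _).trans h0
  have hζ : 0 ≤ ζ := (abs_nonneg _).trans h3
  have hx₀f := isSolution_force_zero_iff.2 hx₀
  have key : ∀ t ∈ Icc 0 L, |-force (x t) t e - -force (x' t) t e' -
      -(attractionX (x₀ t) (1 / 2) * y t + (e - e') * (tidal (x₀ t) * cos t))| ≤
      256 * |x t - x' t - y t| + ε' * (C + 1) * η := by
    intro t ht
    have a1 := abs_sub_le_of_isSolution (he.trans hδ2) (by norm_num) hx hx₀f hx0 hx1
      (by simpa using he) ht
    have a2 := abs_sub_le_of_isSolution (he'.trans hδ2) (by norm_num) hx' hx₀f hx'0 hx'1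
      (by simpa using he') ht
    have a3 := abs_sub_le_of_isSolution (he.trans hδ2) (he'.trans hδ2) hx hx' h0 h1 h2 ht
    have a4 := h₁ t (x₀ t) (x t) (x' t) e e' (hR t ht) (a1.1.trans hδC) (a2.1.trans hδC)
      (he.trans hδ1) (he'.trans hδ1)
    have a5 : |attractionX (x₀ t) (1 / 2)| ≤ 256 := abs_attractionX_le (by norm_num)
    rw [show -force (x t) t e - -force (x' t) t e' -
      -(attractionX (x₀ t) (1 / 2) * y t + (e - e') * (tidal (x₀ t) * cos t)) =
      -(attractionX (x₀ t) (1 / 2) * (x t - x' t - y t)) -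
      (force (x t) t e - force (x' t) t e' - (attractionX (x₀ t) (1 / 2) * (x t - x' t) +
        -(1 / 2) * attractionR (x₀ t) (1 / 2) * cos t * (e - e'))) by rw [tidal]; ring]
    refine (abs_sub _ _).trans ?_
    rw [abs_neg, abs_mul]
    have a6 : ε' * (|x t - x' t| + |e - e'|) ≤ ε' * (C * η + η) := by
      gcongr
      exact a3.1
    have a7 : |attractionX (x₀ t) (1 / 2)| * |x t - x' t - y t| ≤ 256 * |x t - x' t - y t| := by
      gcongr
    linarith
  intro t ht
  have := abs_le_of_abs_deriv_deriv_le (x := fun t => x t - x' t - y t)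
    (v := fun t => deriv x t - deriv x' t - deriv y t)
    (a := fun t => -force (x t) t e - -force (x' t) t e' -
      -(attractionX (x₀ t) (1 / 2) * y t + (e - e') * (tidal (x₀ t) * cos t)))
    (K := 256) (ε := ε' * (C + 1) * η) (δ := ζ) (L := L) (by norm_num) (by positivity) hζ
    (fun t => ((hx.hasDerivAt t).sub (hx'.hasDerivAt t)).sub (hy.hasDerivAt t))
    (fun t => ((hx.2 t).sub (hx'.2 t)).sub (hy.2 t)) h3 h4 key ht
  rwa [← hE, show (ζ + ε' * (C + 1) * η) * E = ε' * (C + 1) * E * η + E * ζ by ring, hεε'] at this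

/-! ### First order expansions of families at `e = 0` -/

/-- The right derivative of `f` at `0` is `a`, in terms of `ε` and `δ`. -/
def HasRightDeriv (f : ℝ → ℝ) (a : ℝ) : Prop :=
  ∀ ε > 0, ∃ δ > 0, ∀ e ∈ Icc 0 δ, |f e - f 0 - e * a| ≤ ε * e

theorem HasRightDeriv.hasDerivWithinAt {f : ℝ → ℝ} {a : ℝ} (h : HasRightDeriv f a) :
    HasDerivWithinAt f a (Ici 0) 0 := by
  rw [hasDerivWithinAt_iff_isLittleO, Asymptotics.isLittleO_iff]
  intro c hc
  obtain ⟨δ, hδ, H⟩ := h c hc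
  filter_upwards [Icc_mem_nhdsGE hδ] with e he
  simpa [abs_of_nonneg he.1] using H e he

theorem hasRightDeriv_of_eventually_const {f : ℝ → ℝ} {c δ : ℝ} (hδ : 0 < δ)
    (h : ∀ e ∈ Icc 0 δ, f e = c) : HasRightDeriv f 0 := fun ε hε =>
  ⟨δ, hδ, fun e he => by
    rw [h e he, h 0 ⟨le_rfl, hδ.le⟩]
    simpa using mul_nonneg hε.le he.1⟩

/-- Right differentiability of the initial data propagates to all times of `[0, L]`: the flow
expansion is applied with `e' = 0`, `y = e w`, increments of size `M e` and initial error `o(e)`. -/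
theorem exists_family_expansion {x : ℝ → ℝ → ℝ} {e₀ : ℝ} (he₀ : 0 < e₀)
    (hx : ∀ e ∈ Ico 0 e₀, IsSolution (fun x t => force x t e) (fun t => x t e)) {w : ℝ → ℝ}
    (hw : IsSolution (fun y t => attractionX (x t 0) (1 / 2) * y + tidal (x t 0) * cos t) w)
    (h0 : HasRightDeriv (fun e => x 0 e) (w 0))
    (h1 : HasRightDeriv (fun e => deriv (fun t => x t e) 0) (deriv w 0)) (L : ℝ)
    {ε : ℝ} (hε : 0 < ε) :
    ∃ δ > 0, δ < e₀ ∧ δ ≤ 1 / 2 ∧ ∀ e ∈ Icc 0 δ, ∀ t ∈ Icc 0 L, |x t e - x t 0 - e * w t| ≤ ε * e ∧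
      |deriv (fun t => x t e) t - deriv (fun t => x t 0) t - e * deriv w t| ≤ ε * e := by
  have hx₀f := hx 0 ⟨le_rfl, he₀⟩
  have hx₀ := isSolution_force_zero_iff.1 hx₀f
  set M := |w 0| + |deriv w 0| + 1 with hM
  have hM1 : 1 ≤ M := by
    have := abs_nonneg (w 0)
    have := abs_nonneg (deriv w 0)
    linarith
  set E := exp (256 * L) with hE
  have hE0 : 0 < E := exp_pos _
  obtain ⟨δ₁, hδ₁, hδ₁2, H⟩ := exists_uniform_flow_expansion hx₀ L (ε := ε / (2 * M))
    (by positivity)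
  set ζ := min 1 (ε / (2 * E)) with hζ
  have hζ0 : 0 < ζ := by positivity
  have hζ1 : ζ ≤ 1 := min_le_left _ _
  have hζE : E * ζ ≤ ε / 2 := by
    have : ζ ≤ ε / (2 * E) := min_le_right _ _
    rw [le_div_iff₀ (by positivity)] at this
    linarith
  obtain ⟨δ₂, hδ₂, H2⟩ := h0 ζ hζ0
  obtain ⟨δ₃, hδ₃, H3⟩ := h1 ζ hζ0
  have hδpos : 0 < min (min (min δ₂ δ₃) (e₀ / 2)) (δ₁ / M) := by positivity
  set δ := min (min (min δ₂ δ₃) (e₀ / 2)) (δ₁ / M) with hδ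
  have d2 : δ ≤ δ₂ := ((min_le_left _ _).trans (min_le_left _ _)).trans (min_le_left _ _)
  have d3 : δ ≤ δ₃ := ((min_le_left _ _).trans (min_le_left _ _)).trans (min_le_right _ _)
  have d4 : δ ≤ e₀ / 2 := (min_le_left _ _).trans (min_le_right _ _)
  have d5 : M * δ ≤ δ₁ := by
    have : δ ≤ δ₁ / M := min_le_right _ _
    rw [le_div_iff₀ (by positivity)] at this
    linarith
  have d6 : δ ≤ δ₁ := by nlinarith
  refine ⟨δ, hδpos, by linarith, by linarith, fun e he => ?_⟩
  have he1 : |e| ≤ δ₁ := by rw [abs_of_nonneg he.1]; linarith [he.2]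
  have hee : e ∈ Ico 0 e₀ := ⟨he.1, by linarith [he.2]⟩
  have b0 := H2 e ⟨he.1, he.2.trans d2⟩
  have b1 := H3 e ⟨he.1, he.2.trans d3⟩
  have hMe : M * e ≤ δ₁ := by nlinarith [he.2]
  have c0 : |x 0 e - x 0 0| ≤ M * e := by
    have := abs_sub_abs_le_abs_sub (x 0 e - x 0 0) (e * w 0)
    rw [abs_mul, abs_of_nonneg he.1] at this
    nlinarith [he.1, abs_nonneg (deriv w 0)]
  have c1 : |deriv (fun t => x t e) 0 - deriv (fun t => x t 0) 0| ≤ M * e := by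
    have := abs_sub_abs_le_abs_sub (deriv (fun t => x t e) 0 - deriv (fun t => x t 0) 0)
      (e * deriv w 0)
    rw [abs_mul, abs_of_nonneg he.1] at this
    nlinarith [he.1, abs_nonneg (w 0)]
  have hy := isSolution_of_hasDerivAt (x := fun t => e * w t) (v := fun t => e * deriv w t)
    (G := fun y t => attractionX (x t 0) (1 / 2) * y + (e - 0) * (tidal (x t 0) * cos t))
    (fun t => (hw.hasDerivAt t).const_mul e)
    (fun t => ((hw.2 t).const_mul e).congr_deriv (by ring))
  intro t ht
  have := H e 0 (M * e) (ζ * e) (fun t => x t e) (fun t => x t 0) (fun t => e * w t) he1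
    (by simpa using hδ₁.le) (hx e hee) hx₀f (c0.trans hMe) (c1.trans hMe) (by simpa using hδ₁.le)
    (by simpa using hδ₁.le) hy.1 c0 c1 (by rw [sub_zero, abs_of_nonneg he.1]; nlinarith [he.1])
    b0 (by simpa [hy.2] using b1) t ht
  simp only [hy.2] at this
  have hfin : ε / (2 * M) * (M * e) + E * (ζ * e) ≤ ε * e := by
    have e1 : ε / (2 * M) * (M * e) = ε / 2 * e := by field_simp
    rw [e1, ← mul_assoc]
    nlinarith [he.1, mul_le_mul_of_nonneg_right hζE he.1]
  exact ⟨this.1.trans hfin, this.2.trans hfin⟩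

/-- If `x(·,e)` is `T`-periodic for small `e`, then so is its derivative `w` in `e` at `0`. -/
theorem eq_of_family_expansion {f g : ℝ → ℝ} {e₀ a b : ℝ} (he₀ : 0 < e₀)
    (hfg : ∀ e ∈ Ico 0 e₀, f e = g e) (hf : HasRightDeriv f a) (hg : HasRightDeriv g b) :
    a = b := by
  by_contra hne
  have hpos : 0 < |a - b| := abs_pos.2 (sub_ne_zero.2 hne)
  obtain ⟨δ₁, hδ₁, H1⟩ := hf (|a - b| / 4) (by linarith)
  obtain ⟨δ₂, hδ₂, H2⟩ := hg (|a - b| / 4) (by linarith)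
  have hpe : 0 < min (min δ₁ δ₂) (e₀ / 2) := by positivity
  set e := min (min δ₁ δ₂) (e₀ / 2) with he
  have e1 : e ≤ δ₁ := (min_le_left _ _).trans (min_le_left _ _)
  have e2 : e ≤ δ₂ := (min_le_left _ _).trans (min_le_right _ _)
  have e3 : e ≤ e₀ / 2 := min_le_right _ _
  have a1 := H1 e ⟨hpe.le, e1⟩
  have a2 := H2 e ⟨hpe.le, e2⟩
  rw [← hfg e ⟨hpe.le, by linarith⟩, ← hfg 0 ⟨le_rfl, he₀⟩] at a2
  have a3 := abs_sub (f e - f 0 - e * a) (f e - f 0 - e * b)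
  rw [show f e - f 0 - e * a - (f e - f 0 - e * b) = -(e * (a - b)) by ring, abs_neg, abs_mul,
    abs_of_pos hpe] at a3
  nlinarith

theorem exists_potential_expansion {x : ℝ → ℝ → ℝ} {w : ℝ → ℝ} {L e₀ : ℝ}
    (hxc : Continuous fun t => x t 0) (hwc : Continuous w)
    (hx : ∀ ε > 0, ∃ δ > 0, δ < e₀ ∧ δ ≤ 1 / 2 ∧ ∀ e ∈ Icc 0 δ, ∀ t ∈ Icc 0 L,
      |x t e - x t 0 - e * w t| ≤ ε * e) {ε : ℝ} (hε : 0 < ε) :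
    ∃ δ > 0, δ < e₀ ∧ δ ≤ 1 / 2 ∧ ∀ e ∈ Icc 0 δ, ∀ t ∈ Icc 0 L,
      |attractionX (x t e) (radius t e) - attractionX (x t 0) (1 / 2) -
        e * (attractionXX (x t 0) (1 / 2) * w t +
          -(1 / 2) * attractionXR (x t 0) (1 / 2) * cos t)| ≤ ε * e := by
  obtain ⟨R, hR⟩ := (isCompact_Icc (a := 0) (b := L)).exists_bound_of_continuousOn
    hxc.continuousOn
  obtain ⟨W₀, hW₀⟩ := (isCompact_Icc (a := 0) (b := L)).exists_bound_of_continuousOn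
    hwc.continuousOn
  obtain ⟨A₀, hA₀⟩ := (isCompact_Icc (a := 0) (b := L)).exists_bound_of_continuousOn
    ((continuous_attractionXX (r := 1 / 2) (by norm_num)).comp hxc).continuousOn
  set W := |W₀| + 1 with hW
  have hW1 : 1 ≤ W := by have := abs_nonneg W₀; linarith
  set A := |A₀| + 1 with hA
  have hA1 : 1 ≤ A := by have := abs_nonneg A₀; linarith
  obtain ⟨δ₁, hδ₁, hδ₁2, H⟩ := attractionX_uniform_expansion R
    (show 0 < ε / (2 * (W + 1)) by positivity)
  obtain ⟨δ₂, hδ₂, hδ₂e, hδ₂2, H2⟩ := hx (min 1 (ε / (2 * A))) (by positivity)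
  have hδpos : 0 < min δ₂ (δ₁ / W) := by positivity
  set δ := min δ₂ (δ₁ / W) with hδ
  have d1 : δ ≤ δ₂ := min_le_left _ _
  have d2 : W * δ ≤ δ₁ := by
    have : δ ≤ δ₁ / W := min_le_right _ _
    rw [le_div_iff₀ (by positivity)] at this
    linarith
  have d3 : δ ≤ δ₁ := by nlinarith
  refine ⟨δ, hδpos, by linarith, by linarith, fun e he t ht => ?_⟩
  have b := H2 e ⟨he.1, he.2.trans d1⟩ t ht
  have b1 : |x t e - x t 0 - e * w t| ≤ e := by
    refine b.trans ?_
    nlinarith [min_le_left 1 (ε / (2 * A)), he.1]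
  have b2 : A * |x t e - x t 0 - e * w t| ≤ ε / 2 * e := by
    have : min 1 (ε / (2 * A)) ≤ ε / (2 * A) := min_le_right _ _
    rw [le_div_iff₀ (by positivity)] at this
    nlinarith [he.1, mul_le_mul_of_nonneg_right this he.1]
  have hwt : |w t| ≤ W - 1 := by
    have := (hW₀ t ht).trans (le_abs_self _)
    rw [Real.norm_eq_abs] at this
    linarith
  have c : |x t e - x t 0| ≤ W * e := by
    have := abs_sub_abs_le_abs_sub (x t e - x t 0) (e * w t)
    rw [abs_mul, abs_of_nonneg he.1] at this
    nlinarith [he.1]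
  have hAt : |attractionXX (x t 0) (1 / 2)| ≤ A := by
    have := (hA₀ t ht).trans (le_abs_self _)
    simp only [Function.comp, Real.norm_eq_abs] at this
    linarith
  have k := H t (x t 0) (x t e) (x t 0) e 0 (hR t ht)
    (c.trans (by nlinarith [he.2])) (by simpa using hδ₁.le)
    (by rw [abs_of_nonneg he.1]; linarith [he.2]) (by simpa using hδ₁.le)
  rw [radius_zero, sub_zero, abs_of_nonneg he.1] at k
  rw [show attractionX (x t e) (radius t e) - attractionX (x t 0) (1 / 2) -
        e * (attractionXX (x t 0) (1 / 2) * w t +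
          -(1 / 2) * attractionXR (x t 0) (1 / 2) * cos t) =
      (attractionX (x t e) (radius t e) - attractionX (x t 0) (1 / 2) -
        (attractionXX (x t 0) (1 / 2) * (x t e - x t 0) +
          -(1 / 2) * attractionXR (x t 0) (1 / 2) * cos t * e)) +
      attractionXX (x t 0) (1 / 2) * (x t e - x t 0 - e * w t) by ring]
  refine (abs_add_le _ _).trans ?_
  rw [abs_mul]
  have k2 : ε / (2 * (W + 1)) * (|x t e - x t 0| + e) ≤ ε / 2 * e := by
    calc _ ≤ ε / (2 * (W + 1)) * (W * e + e) := by gcongr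
      _ = ε / 2 * e := by field_simp
  have k3 : |attractionXX (x t 0) (1 / 2)| * |x t e - x t 0 - e * w t| ≤
      A * |x t e - x t 0 - e * w t| := by gcongr
  linarith

/-! ### The trace of Hill's equation -/

theorem hillSolution_spec {q : ℝ → ℝ} (hq : Continuous q) (a b : ℝ) :
    IsSolution (fun x t => q t * x) (hillSolution q a b) ∧ hillSolution q a b 0 = a ∧
      deriv (hillSolution q a b) 0 = b :=
  Classical.epsilon_spec ((regularForce_hill hq).exists_isSolution a b)

theorem hillSolution_eq {q : ℝ → ℝ} (hq : Continuous q) {y : ℝ → ℝ}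
    (hy : IsSolution (fun x t => q t * x) y) : hillSolution q (y 0) (deriv y 0) = y :=
  have h := hillSolution_spec hq (y 0) (deriv y 0)
  (regularForce_hill hq).unique h.1 hy h.2.1 h.2.2

theorem IsSolution.linear_comb {q g h : ℝ → ℝ} {y z : ℝ → ℝ}
    (hy : IsSolution (fun x t => q t * x + g t) y) (hz : IsSolution (fun x t => q t * x + h t) z)
    (a b : ℝ) :
    IsSolution (fun x t => q t * x + (a * g t + b * h t)) (fun t => a * y t + b * z t) ∧
      deriv (fun t => a * y t + b * z t) = fun t => a * deriv y t + b * deriv z t :=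
  isSolution_of_hasDerivAt
    (fun t => ((hy.hasDerivAt t).const_mul a).add ((hz.hasDerivAt t).const_mul b))
    (fun t => (((hy.2 t).const_mul a).add ((hz.2 t).const_mul b)).congr_deriv (by ring))

theorem IsSolution.hill_linear_comb {q : ℝ → ℝ} {y z : ℝ → ℝ}
    (hy : IsSolution (fun x t => q t * x) y) (hz : IsSolution (fun x t => q t * x) z)
    (a b : ℝ) :
    IsSolution (fun x t => q t * x) (fun t => a * y t + b * z t) ∧
      deriv (fun t => a * y t + b * z t) = fun t => a * deriv y t + b * deriv z t :=
  isSolution_of_hasDerivAt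
    (fun t => ((hy.hasDerivAt t).const_mul a).add ((hz.hasDerivAt t).const_mul b))
    (fun t => (((hy.2 t).const_mul a).add ((hz.2 t).const_mul b)).congr_deriv (by ring))

/-- The Wronskian of two solutions of Hill's equation is constant. -/
theorem IsSolution.wronskian_eq {q : ℝ → ℝ} {y z : ℝ → ℝ}
    (hy : IsSolution (fun x t => q t * x) y) (hz : IsSolution (fun x t => q t * x) z) (t : ℝ) :
    y t * deriv z t - deriv y t * z t = y 0 * deriv z 0 - deriv y 0 * z 0 := by
  have hd : ∀ t, HasDerivAt (fun t => y t * deriv z t - deriv y t * z t) 0 t := fun t =>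
    (((hy.hasDerivAt t).mul (hz.2 t)).sub ((hy.2 t).mul (hz.hasDerivAt t))).congr_deriv (by ring)
  exact is_const_of_deriv_eq_zero (fun t => (hd t).differentiableAt) (fun t => (hd t).deriv) t 0

/-- Lagrange's identity for a solution of the forced equation with zero initial data. -/
theorem lagrange_identity {q g η ψ : ℝ → ℝ} (hg : Continuous g)
    (hη : IsSolution (fun x t => q t * x + g t) η) (hψ : IsSolution (fun x t => q t * x) ψ)
    (h0 : η 0 = 0) (h1 : deriv η 0 = 0) (T : ℝ) :
    η T * deriv ψ T - deriv η T * ψ T = ∫ t in (0 : ℝ)..T, g t * ψ t := by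
  have hd : ∀ t, HasDerivAt (fun t => η t * deriv ψ t - deriv η t * ψ t) (g t * ψ t) t := fun t =>
    (((hη.hasDerivAt t).mul (hψ.2 t)).sub ((hη.2 t).mul (hψ.hasDerivAt t))).congr_deriv (by ring)
  rw [intervalIntegral.integral_eq_sub_of_hasDerivAt (fun t _ => hd t)
    ((hg.mul hψ.continuous).intervalIntegrable _ _)]
  simp [h0, h1]

/-- The remainder of the solution after subtracting `ψ + eη` solves the Hill equation of `q e` with
forcing `(q e - q 0 - e q₁)ψ + (q e - q 0) e η`. This is `o(e)`, and the initial data vanish, so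
Grönwall applies. -/
theorem exists_hillSolution_expansion {q : ℝ → ℝ → ℝ} {q₁ : ℝ → ℝ} {e₀ T : ℝ}
    (hqc : ∀ e ∈ Ico 0 e₀, Continuous (q e)) (he₀ : 0 < e₀) (hq₁ : Continuous q₁)
    (hq : ∀ ε > 0, ∃ δ > 0, ∀ e ∈ Icc 0 δ, ∀ t ∈ Icc 0 T, |q e t - q 0 t - e * q₁ t| ≤ ε * e)
    {ψ η : ℝ → ℝ} (hψ : IsSolution (fun x t => q 0 t * x) ψ)
    (hη : IsSolution (fun x t => q 0 t * x + q₁ t * ψ t) η) (h0 : η 0 = 0) (h1 : deriv η 0 = 0)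
    (hT : 0 ≤ T) :
    HasRightDeriv (fun e => hillSolution (q e) (ψ 0) (deriv ψ 0) T) (η T) ∧
      HasRightDeriv (fun e => deriv (hillSolution (q e) (ψ 0) (deriv ψ 0)) T) (deriv η T) := by
  have hb : ∀ f : ℝ → ℝ, Continuous f → ∃ B : ℝ, 1 ≤ B ∧ ∀ t ∈ Icc 0 T, |f t| ≤ B := fun f hf => by
    obtain ⟨B, hB⟩ := (isCompact_Icc (a := 0) (b := T)).exists_bound_of_continuousOn hf.continuousOn
    exact ⟨|B| + 1, by linarith [abs_nonneg B], fun t ht => by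
      have := hB t ht
      rw [Real.norm_eq_abs] at this
      linarith [le_abs_self B]⟩
  obtain ⟨A, hA1, hA⟩ := hb _ (hqc 0 ⟨le_rfl, he₀⟩)
  obtain ⟨B, hB1, hB⟩ := hb _ hq₁
  obtain ⟨Y, hY1, hY⟩ := hb _ hψ.continuous
  obtain ⟨N, hN1, hN⟩ := hb _ hη.continuous
  set K := A + B + 1 with hK
  set E := exp (K * T) with hE
  have hE0 : 0 < E := exp_pos _
  have key : ∀ ε > 0, ∃ δ > 0, ∀ e ∈ Icc 0 δ,
      |hillSolution (q e) (ψ 0) (deriv ψ 0) T - ψ T - e * η T| ≤ ε * e ∧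
      |deriv (hillSolution (q e) (ψ 0) (deriv ψ 0)) T - deriv ψ T - e * deriv η T| ≤ ε * e := by
    intro ε hε
    obtain ⟨δ₁, hδ₁, H⟩ := hq (min 1 (ε / (2 * Y * E))) (by positivity)
    have hδp : 0 < min (min δ₁ (e₀ / 2)) (min 1 (ε / (2 * ((B + 1) * N) * E))) := by positivity
    set δ := min (min δ₁ (e₀ / 2)) (min 1 (ε / (2 * ((B + 1) * N) * E))) with hδ
    have d1 : δ ≤ δ₁ := (min_le_left _ _).trans (min_le_left _ _)
    have d2 : δ ≤ e₀ / 2 := (min_le_left _ _).trans (min_le_right _ _)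
    have d3 : δ ≤ 1 := (min_le_right _ _).trans (min_le_left _ _)
    have d4 : δ * (2 * ((B + 1) * N) * E) ≤ ε := by
      have : δ ≤ ε / (2 * ((B + 1) * N) * E) := (min_le_right _ _).trans (min_le_right _ _)
      rwa [le_div_iff₀ (by positivity)] at this
    refine ⟨δ, hδp, fun e he => ?_⟩
    have he0 := he.1
    obtain ⟨hy, hy0, hy1⟩ := hillSolution_spec (hqc e ⟨he.1, by linarith [he.2]⟩) (ψ 0) (deriv ψ 0)
    set y := hillSolution (q e) (ψ 0) (deriv ψ 0) with hydef
    set κ := min 1 (ε / (2 * Y * E)) with hκ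
    have hκ0 : 0 < κ := by positivity
    have hκ1 : κ ≤ 1 := min_le_left _ _
    have hκ2 : κ * (2 * Y * E) ≤ ε := by
      have : κ ≤ ε / (2 * Y * E) := min_le_right _ _
      rwa [le_div_iff₀ (by positivity)] at this
    have hdiff : ∀ t ∈ Icc 0 T, |q e t - q 0 t| ≤ (B + 1) * e := fun t ht => by
      have a1 := H e ⟨he.1, he.2.trans d1⟩ t ht
      have a2 := abs_sub_abs_le_abs_sub (q e t - q 0 t) (e * q₁ t)
      rw [abs_mul, abs_of_nonneg he0] at a2
      have a3 := hB t ht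
      nlinarith
    have := abs_le_of_abs_deriv_deriv_le (x := fun t => y t - ψ t - e * η t)
      (v := fun t => deriv y t - deriv ψ t - e * deriv η t)
      (a := fun t => -(q e t * y t) - -(q 0 t * ψ t) - e * -(q 0 t * η t + q₁ t * ψ t))
      (K := K) (ε := κ * e * Y + (B + 1) * e * (e * N)) (δ := 0) (L := T) (by linarith)
      (by positivity) le_rfl
      (fun t => ((hy.hasDerivAt t).sub (hψ.hasDerivAt t)).sub ((hη.hasDerivAt t).const_mul e))
      (fun t => ((hy.2 t).sub (hψ.2 t)).sub ((hη.2 t).const_mul e)) (by simp [hy0, h0])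
      (by simp [hy1, h1])
      (fun t ht => by
        have a1 := H e ⟨he.1, he.2.trans d1⟩ t ht
        have a2 := hdiff t ht
        have a3 : |q e t| ≤ K := by
          have := abs_sub_abs_le_abs_sub (q e t) (q 0 t)
          have := hA t ht
          nlinarith [he.2]
        rw [show -(q e t * y t) - -(q 0 t * ψ t) - e * -(q 0 t * η t + q₁ t * ψ t) =
          -(q e t * (y t - ψ t - e * η t)) + (-((q e t - q 0 t - e * q₁ t) * ψ t) +
            -((q e t - q 0 t) * (e * η t))) by ring]
        refine (abs_add_le _ _).trans (add_le_add ?_ ((abs_add_le _ _).trans (add_le_add ?_ ?_)))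
        · rw [abs_neg, abs_mul]
          gcongr
        · rw [abs_neg, abs_mul]
          gcongr
          exact hY t ht
        · rw [abs_neg, abs_mul, abs_mul, abs_of_nonneg he0]
          gcongr
          exact hN t ht) (t := T) ⟨hT, le_rfl⟩
    have hfin : (0 + (κ * e * Y + (B + 1) * e * (e * N))) * exp (K * T) ≤ ε * e := by
      have b1 : κ * Y * E ≤ ε / 2 := by linarith
      have b2 : e * ((B + 1) * N) * E ≤ ε / 2 := by
        have : e * ((B + 1) * N * E) ≤ δ * ((B + 1) * N * E) := by
          gcongr
          exact he.2
        linarith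
      calc _ = (κ * Y * E + e * ((B + 1) * N) * E) * e := by rw [← hE]; ring
        _ ≤ (ε / 2 + ε / 2) * e := by gcongr
        _ = ε * e := by ring
    exact ⟨this.1.trans hfin, this.2.trans hfin⟩
  have e1 := hillSolution_eq (hqc 0 ⟨le_rfl, he₀⟩) hψ
  constructor <;> intro ε hε <;> obtain ⟨δ, hδ, H⟩ := key ε hε <;> refine ⟨δ, hδ, fun e he => ?_⟩ <;>
    simp only [e1]
  · exact (H e he).1
  · exact (H e he).2

theorem HasRightDeriv.add {f g : ℝ → ℝ} {a b : ℝ} (hf : HasRightDeriv f a)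
    (hg : HasRightDeriv g b) : HasRightDeriv (fun e => f e + g e) (a + b) := by
  intro ε hε
  obtain ⟨δ₁, hδ₁, H1⟩ := hf (ε / 2) (by linarith)
  obtain ⟨δ₂, hδ₂, H2⟩ := hg (ε / 2) (by linarith)
  refine ⟨min δ₁ δ₂, by positivity, fun e he => ?_⟩
  have h1 := H1 e ⟨he.1, he.2.trans (min_le_left _ _)⟩
  have h2 := H2 e ⟨he.1, he.2.trans (min_le_right _ _)⟩
  rw [show f e + g e - (f 0 + g 0) - e * (a + b) = (f e - f 0 - e * a) + (g e - g 0 - e * b) by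
    ring]
  exact (abs_add_le _ _).trans (by linarith)

/-- The derivative of the trace at a parabolic potential: `χ` is a `T`-periodic solution and
`y(t + T) = y(t) + c χ(t)` for a second solution `y`, the Wronskian of `χ, y` being `1`. -/
theorem hasRightDeriv_hillTrace {q : ℝ → ℝ → ℝ} {q₁ : ℝ → ℝ} {e₀ T : ℝ}
    (hqc : ∀ e ∈ Ico 0 e₀, Continuous (q e)) (he₀ : 0 < e₀) (hq₁ : Continuous q₁)
    (hq : ∀ ε > 0, ∃ δ > 0, ∀ e ∈ Icc 0 δ, ∀ t ∈ Icc 0 T, |q e t - q 0 t - e * q₁ t| ≤ ε * e)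
    (hT : 0 ≤ T) {χ y : ℝ → ℝ} {c : ℝ} (hχ : IsSolution (fun x t => q 0 t * x) χ)
    (hy : IsSolution (fun x t => q 0 t * x) y) (hW : χ 0 * deriv y 0 - deriv χ 0 * y 0 = 1)
    (hχT : χ T = χ 0) (hχT' : deriv χ T = deriv χ 0) (hyT : y T = y 0 + c * χ 0)
    (hyT' : deriv y T = deriv y 0 + c * deriv χ 0) :
    HasRightDeriv (fun e => hillTrace (q e) T) (-c * ∫ t in (0 : ℝ)..T, q₁ t * χ t ^ 2) := by
  have hq0 := hqc 0 ⟨le_rfl, he₀⟩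
  have hχg := hq₁.mul hχ.continuous
  have hyg := hq₁.mul hy.continuous
  obtain ⟨α, hα, hα0, hα1⟩ := (regularForce_linear hq0 hχg).exists_isSolution 0 0
  obtain ⟨β, hβ, hβ0, hβ1⟩ := (regularForce_linear hq0 hyg).exists_isSolution 0 0
  -- The normalized fundamental solutions in the basis `χ, y` of Wronskian `1`. Their first
  -- variations are the same combinations of `α` and `β`, the responses to the forcings `q₁χ` and
  -- `q₁y`.
  have hψ₁ := hχ.hill_linear_comb hy (deriv y 0) (-deriv χ 0)
  have hψ₂ := hχ.hill_linear_comb hy (-y 0) (χ 0)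
  have hη₁ := hα.linear_comb hβ (deriv y 0) (-deriv χ 0)
  have hη₂ := hα.linear_comb hβ (-y 0) (χ 0)
  have h1 := (exists_hillSolution_expansion hqc he₀ hq₁ hq hψ₁.1
    (by
      have := hη₁.1
      convert this using 4
      simp only [Pi.mul_apply]
      ring) (by simp [hα0, hβ0]) (by rw [hη₁.2]; simp [hα1, hβ1]) hT).1
  have h2 := (exists_hillSolution_expansion hqc he₀ hq₁ hq hψ₂.1
    (by
      have := hη₂.1
      convert this using 4
      simp only [Pi.mul_apply]
      ring) (by simp [hα0, hβ0]) (by rw [hη₂.2]; simp [hα1, hβ1]) hT).2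
  have e1 : deriv y 0 * χ 0 + -deriv χ 0 * y 0 = 1 := by linarith
  have e2 : deriv y 0 * deriv χ 0 + -deriv χ 0 * deriv y 0 = 0 := by ring
  have e3 : -y 0 * χ 0 + χ 0 * y 0 = 0 := by ring
  have e4 : -y 0 * deriv χ 0 + χ 0 * deriv y 0 = 1 := by linarith
  simp only [hψ₁.2, hψ₂.2, hη₂.2, e1, e2, e3, e4] at h1 h2
  have h3 := h1.add h2
  have L1 := lagrange_identity hχg hα hχ hα0 hα1 T
  have L2 := lagrange_identity hχg hα hy hα0 hα1 T
  have L3 := lagrange_identity hyg hβ hχ hβ0 hβ1 T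
  have i1 : ∫ t in (0 : ℝ)..T, (q₁ * χ) t * χ t = ∫ t in (0 : ℝ)..T, q₁ t * χ t ^ 2 := by
    congr 1
    funext t
    simp only [Pi.mul_apply]
    ring
  have i2 : ∫ t in (0 : ℝ)..T, (q₁ * χ) t * y t = ∫ t in (0 : ℝ)..T, (q₁ * y) t * χ t := by
    congr 1
    funext t
    simp only [Pi.mul_apply]
    ring
  have L1' : α T * deriv χ 0 - deriv α T * χ 0 = ∫ t in (0 : ℝ)..T, q₁ t * χ t ^ 2 := by
    rw [← i1, ← hχT, ← hχT']
    exact L1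
  have L2' : α T * (deriv y 0 + c * deriv χ 0) - deriv α T * (y 0 + c * χ 0) =
      ∫ t in (0 : ℝ)..T, (q₁ * y) t * χ t := by
    rw [← i2, ← hyT, ← hyT']
    exact L2
  have L3' : β T * deriv χ 0 - deriv β T * χ 0 = ∫ t in (0 : ℝ)..T, (q₁ * y) t * χ t := by
    rw [← hχT, ← hχT']
    exact L3
  -- `L2'` and `L3'` have the same right-hand side `∫ q₁ y χ`. In their difference only the
  -- contribution of the monodromy coefficient `c` survives, and `L1'` evaluates it.
  have h4 : -c * ∫ t in (0 : ℝ)..T, q₁ t * χ t ^ 2 = deriv y 0 * α T + -deriv χ 0 * β T +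
      (-y 0 * deriv α T + χ 0 * deriv β T) := by
    rw [← L1']
    linear_combination (-1) * L2' + L3'
  rw [h4]
  exact h3

/-! ### The derivative of the trace along a family of periodic solutions -/

theorem IsCircularSolution.isSolution_deriv {x : ℝ → ℝ} (hx : IsCircularSolution x) :
    IsSolution (fun y t => attractionX (x t) (1 / 2) * y) (deriv x) ∧
      deriv (deriv x) = fun t => -attraction (x t) (1 / 2) :=
  isSolution_of_hasDerivAt (fun t => hx.2 t) fun t =>
    ((hasDerivAt_attraction_fst (by norm_num)).comp t (hx.hasDerivAt t)).neg

/-- The first variation of the potential along a periodic family, tested against `χ² = (x')²`. -/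
theorem integral_variation_mul_sq {x w : ℝ → ℝ} {T : ℝ} (hx : IsCircularSolution x)
    (hw : IsSolution (fun y t => attractionX (x t) (1 / 2) * y + tidal (x t) * cos t) w)
    (hxT : x T = x 0) (hxT' : deriv x T = deriv x 0) (hwT : w T = w 0)
    (hwT' : deriv w T = deriv w 0) (hc : cos T = 1) :
    ∫ t in (0 : ℝ)..T, (attractionXX (x t) (1 / 2) * w t +
        -(1 / 2) * attractionXR (x t) (1 / 2) * cos t) * deriv x t ^ 2 =
      ∫ t in (0 : ℝ)..T, tidal (x t) * deriv x t * sin t := by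
  have hχ := hx.isSolution_deriv
  have hχ2 : ∀ t, HasDerivAt (deriv x) (-attraction (x t) (1 / 2)) t := hx.2
  have hxx : ∀ t, HasDerivAt (fun t => -attraction (x t) (1 / 2))
      (-(attractionX (x t) (1 / 2) * deriv x t)) t := fun t => by
    have := hχ.1.2 t
    rwa [hχ.2] at this
  have hq : ∀ t, HasDerivAt (fun t => attractionX (x t) (1 / 2))
      (attractionXX (x t) (1 / 2) * deriv x t) t := fun t =>
    (hasDerivAt_attractionX_fst (by norm_num)).comp t (hx.hasDerivAt t)
  have htd : ∀ t, HasDerivAt (fun t => tidal (x t))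
      (-(1 / 2) * (attractionXR (x t) (1 / 2) * deriv x t)) t := fun t =>
    ((hasDerivAt_attractionR_fst (by norm_num)).comp t (hx.hasDerivAt t)).const_mul _
  -- With `χ = x'`, this is the Wronskian `w'χ' - w''χ`, with `w''` and `χ'` replaced through the
  -- equations. The function `w'` solves the linearization with the time derivative of coefficient
  -- and forcing as inhomogeneity. Hence `Φ'` is the difference of the two integrands, and
  -- periodicity makes its integral vanish.
  set Φ : ℝ → ℝ := fun t =>
    (attractionX (x t) (1 / 2) * w t + tidal (x t) * cos t) * deriv x t +
      deriv w t * -attraction (x t) (1 / 2) with hΦ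
  have hΦd : ∀ t, HasDerivAt Φ ((attractionXX (x t) (1 / 2) * w t +
      -(1 / 2) * attractionXR (x t) (1 / 2) * cos t) * deriv x t ^ 2 -
      tidal (x t) * deriv x t * sin t) t := fun t =>
    (((((hq t).mul (hw.hasDerivAt t)).add ((htd t).mul (hasDerivAt_cos t))).mul (hχ2 t)).add
      ((hw.2 t).mul (hxx t))).congr_deriv (by
        simp only [Pi.add_apply, Pi.mul_apply]
        ring)
  have hxc := hx.continuous
  have hxc' := hx.continuous_deriv
  have hwc := hw.continuous
  have c1 := (continuous_attractionXX (r := 1 / 2) (by norm_num)).comp hxc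
  have c2 := (continuous_attractionXR (r := 1 / 2) (by norm_num)).comp hxc
  have c3 := continuous_tidal.comp hxc
  simp only [Function.comp_def] at c1 c2 c3
  have k1 : Continuous fun t => (attractionXX (x t) (1 / 2) * w t +
      -(1 / 2) * attractionXR (x t) (1 / 2) * cos t) * deriv x t ^ 2 := by fun_prop
  have k2 : Continuous fun t => tidal (x t) * deriv x t * sin t := by fun_prop
  have := intervalIntegral.integral_eq_sub_of_hasDerivAt (a := 0) (b := T) (fun t _ => hΦd t)
    ((k1.sub k2).intervalIntegrable _ _)
  rw [intervalIntegral.integral_sub (k1.intervalIntegrable _ _) (k2.intervalIntegrable _ _)] at this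
  have e : Φ T = Φ 0 := by simp only [hΦ, hxT, hxT', hwT, hwT', hc, cos_zero]
  rw [e, sub_self] at this
  linarith

/-- The common core of the odd and even cases. Only existence of the derivatives `a`, `b` of the
initial data matters: they enter through `w`, which drops out of the final integral. -/
theorem hasDerivWithinAt_linearizedTrace {x : ℝ → ℝ → ℝ} {e₀ a b c : ℝ} {m : ℕ} (he₀ : 0 < e₀)
    (hx : ∀ e ∈ Ico 0 e₀, IsSolution (fun x t => force x t e) (fun t => x t e))
    (h0 : HasRightDeriv (fun e => x 0 e) a)
    (h1 : HasRightDeriv (fun e => deriv (fun t => x t e) 0) b)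
    (hper : ∃ δ > 0, ∀ e ∈ Ico 0 δ, x (2 * m * π) e = x 0 e ∧
      deriv (fun t => x t e) (2 * m * π) = deriv (fun t => x t e) 0)
    {x₀ y : ℝ → ℝ} (hx₀ : (fun t => x t 0) = x₀)
    (hy : IsSolution (fun y t => attractionX (x₀ t) (1 / 2) * y) y)
    (hW : deriv x₀ 0 * deriv y 0 - deriv (deriv x₀) 0 * y 0 = 1)
    (hyT : y (2 * m * π) = y 0 + c * deriv x₀ 0)
    (hyT' : deriv y (2 * m * π) = deriv y 0 + c * deriv (deriv x₀) 0) :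
    HasDerivWithinAt (linearizedTrace m x)
      (-c * ∫ t in (0 : ℝ)..2 * m * π, tidal (x₀ t) * deriv x₀ t * sin t) (Ici 0) 0 := by
  subst hx₀
  set T : ℝ := 2 * m * π with hT
  have hT0 : 0 ≤ T := by positivity
  have hcosT : cos T = 1 := by
    rw [hT, show (2 : ℝ) * m * π = m * (2 * π) by ring]
    exact cos_nat_mul_two_pi m
  have hx0 := isSolution_force_zero_iff.1 (hx 0 ⟨le_rfl, he₀⟩)
  set x₀ : ℝ → ℝ := fun t => x t 0 with hx₀
  have hxc := hx0.continuous
  have cX := (continuous_attractionX (r := 1 / 2) (by norm_num)).comp hxc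
  have cT := continuous_tidal.comp hxc
  have c1 := (continuous_attractionXX (r := 1 / 2) (by norm_num)).comp hxc
  have c2 := (continuous_attractionXR (r := 1 / 2) (by norm_num)).comp hxc
  simp only [Function.comp_def] at c1 c2 cX cT
  obtain ⟨w, hw, hw0, hw1⟩ := (regularForce_linear cX
    (show Continuous fun t => tidal (x₀ t) * cos t by fun_prop)).exists_isSolution a b
  have hexp := fun (ε : ℝ) (hε : 0 < ε) =>
    exists_family_expansion he₀ hx hw (by rwa [hw0]) (by rwa [hw1]) T hε
  obtain ⟨δ₀, hδ₀, hper⟩ := hper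
  have hper0 := hper 0 ⟨le_rfl, hδ₀⟩
  -- Periodicity of the members of the family passes to their derivative in `e`.
  have hwT : w T = w 0 := by
    refine eq_of_family_expansion hδ₀ (f := fun e => x T e) (g := fun e => x 0 e)
      (fun e he => (hper e he).1) (fun ε hε => ?_) (by rwa [hw0])
    obtain ⟨δ, hδ, -, -, H⟩ := hexp ε hε
    exact ⟨δ, hδ, fun e he => (H e he T ⟨hT0, le_rfl⟩).1⟩
  have hwT' : deriv w T = deriv w 0 := by
    refine eq_of_family_expansion hδ₀ (f := fun e => deriv (fun t => x t e) T)
      (g := fun e => deriv (fun t => x t e) 0)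
      (fun e he => (hper e he).2) (fun ε hε => ?_) (by rwa [hw1])
    obtain ⟨δ, hδ, -, -, H⟩ := hexp ε hε
    exact ⟨δ, hδ, fun e he => (H e he T ⟨hT0, le_rfl⟩).2⟩
  have hqexp := fun (ε : ℝ) (hε : 0 < ε) =>
    exists_potential_expansion (e₀ := e₀) (L := T) hxc hw.continuous (fun ε hε => by
      obtain ⟨δ, hδ, h1, h2, H⟩ := hexp ε hε
      exact ⟨δ, hδ, h1, h2, fun e he t ht => (H e he t ht).1⟩) hε
  have hmin : 0 < min e₀ (1 / 2) := by positivity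
  have hq0 : ∀ t, deriv (fun z => force z t 0) (x t 0) = attractionX (x t 0) (1 / 2) := fun t => by
    rw [deriv_force (by norm_num), radius_zero]
  have htr := hasRightDeriv_hillTrace (e₀ := min e₀ (1 / 2)) (T := T)
    (q := fun e t => deriv (fun z => force z t e) (x t e))
    (q₁ := fun t => attractionXX (x₀ t) (1 / 2) * w t +
          -(1 / 2) * attractionXR (x₀ t) (1 / 2) * cos t) (χ := deriv x₀) (y := y) (c := c)
    (fun e he => by
      have he1 : |e| ≤ 1 / 2 := by
        rw [abs_of_nonneg he.1]
        exact (he.2.trans_le (min_le_right _ _)).le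
      have hxe := (hx e ⟨he.1, he.2.trans_le (min_le_left _ _)⟩).continuous
      have hre := continuous_radius (e := e) (by linarith)
      simp only [deriv_force he1]
      refine continuous_iff_continuousAt.2 fun t => ?_
      exact ContinuousAt.comp (g := fun z : ℝ × ℝ => attractionX z.1 z.2)
        (f := fun t => (x t e, radius t e))
        (contDiffAt_attractionX (z := (x t e, radius t e))
          (show 0 < radius t e by linarith [(radius_mem_Icc he1 t).1])).continuousAt
        (hxe.prodMk hre).continuousAt) hmin
    (by have := hw.continuous; fun_prop)
    (fun ε hε => by
      obtain ⟨δ, hδ, -, h2, H⟩ := hqexp ε hε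
      refine ⟨δ, hδ, fun e he t ht => ?_⟩
      rw [hq0, deriv_force (by rw [abs_of_nonneg he.1]; linarith [he.2])]
      exact H e he t ht) hT0
    (by simpa only [hq0] using hx0.isSolution_deriv.1) (by simpa only [hq0] using hy) hW
    hper0.2 (by
      have := hper0.1
      simp only [hx0.isSolution_deriv.2]
      simp only [hx₀, this]) hyT hyT'
  rw [integral_variation_mul_sq hx0 hw hper0.1 hper0.2 hwT hwT' hcosT] at htr
  exact htr.hasDerivWithinAt

/-! ### First zeros -/

theorem exists_first_zero {f : ℝ → ℝ} (hf : Continuous f) {δ s : ℝ} (hδ : 0 < δ)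
    (hpos : ∀ t ∈ Ioo 0 δ, 0 < f t) (hs : 0 < s) (hfs : f s ≤ 0) :
    ∃ c ∈ Ioc 0 s, f c = 0 ∧ ∀ t ∈ Ioo 0 c, 0 < f t := by
  have hδs : δ ≤ s := by
    by_contra h
    exact absurd (hpos s ⟨hs, not_le.1 h⟩) (not_lt.2 hfs)
  have hK : IsCompact (Icc (δ / 2) s ∩ f ⁻¹' Iic 0) :=
    isCompact_Icc.inter_right (isClosed_Iic.preimage hf)
  obtain ⟨c, ⟨⟨hc1, hc2⟩, hc3⟩, hmin⟩ := hK.exists_isLeast ⟨s, ⟨by linarith, le_rfl⟩, hfs⟩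
  have hc0 : 0 < c := by linarith
  have hcpos : ∀ t ∈ Ioo 0 c, 0 < f t := fun t ht => by
    by_contra h
    rcases lt_or_ge t δ with h1 | h1
    · exact h (hpos t ⟨ht.1, h1⟩)
    · exact absurd (hmin ⟨⟨by linarith, by linarith [ht.2]⟩, not_lt.1 h⟩) (not_le.2 ht.2)
  refine ⟨c, ⟨hc0, hc2⟩, le_antisymm hc3 ?_, hcpos⟩
  have hcl : c ∈ closure (Ioo 0 c) := by
    rw [closure_Ioo hc0.ne]
    exact right_mem_Icc.2 hc0.le
  have : closure (Ioo 0 c) ⊆ f ⁻¹' Ici 0 :=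
    closure_minimal (fun t ht => (hcpos t ht).le) (isClosed_Ici.preimage hf)
  exact this hcl

theorem exists_pos_right_of_deriv_pos {f : ℝ → ℝ} {f' : ℝ} (hf : HasDerivAt f f' 0)
    (h0 : f 0 = 0) (h' : 0 < f') : ∃ δ > 0, ∀ t ∈ Ioo 0 δ, 0 < f t := by
  have h := (hasDerivAt_iff_tendsto_slope.1 hf).eventually (lt_mem_nhds h')
  rw [eventually_nhdsWithin_iff, Metric.eventually_nhds_iff] at h
  obtain ⟨δ, hδ, H⟩ := h
  refine ⟨δ, hδ, fun t ht => ?_⟩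
  have := H (y := t) (by rw [Real.dist_eq, sub_zero, abs_of_pos ht.1]; exact ht.2) ht.1.ne'
  rw [slope_def_field, h0, sub_zero, sub_zero] at this
  exact (div_pos_iff_of_pos_right ht.1).1 this

theorem deriv_nonpos_of_pos_left {f : ℝ → ℝ} {f' c : ℝ} (hf : HasDerivAt f f' c) (hc : 0 < c)
    (h0 : f c = 0) (hpos : ∀ t ∈ Ioo 0 c, 0 < f t) : f' ≤ 0 := by
  have h := (hasDerivAt_iff_tendsto_slope.1 hf).mono_left
    (nhdsWithin_mono c (fun t (ht : t < c) => ht.ne) : 𝓝[<] c ≤ 𝓝[≠] c)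
  refine le_of_tendsto h ?_
  filter_upwards [Ioo_mem_nhdsLT hc] with t ht
  rw [slope_def_field, h0, sub_zero]
  exact div_nonpos_of_nonneg_of_nonpos (hpos t ht).le (by linarith [ht.2])

theorem pos_of_deriv_pos {f f' : ℝ → ℝ} {s : ℝ} (hf : ∀ t, HasDerivAt f (f' t) t) (h0 : f 0 = 0)
    (hpos : ∀ t ∈ Ioo 0 s, 0 < f' t) : ∀ t ∈ Ioc 0 s, 0 < f t := fun t ht => by
  have := strictMonoOn_of_deriv_pos (convex_Icc 0 s)
    (HasDerivAt.continuousOn fun t _ => hf t) (fun t ht => by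
      rw [interior_Icc] at ht
      rw [(hf t).deriv]
      exact hpos t ht)
  rw [← h0]
  exact this ⟨le_rfl, by linarith [ht.1, ht.2]⟩ ⟨ht.1.le, ht.2⟩ ht.1

/-! ### The circular problem -/

theorem regularForce_circular : RegularForce fun x _ => attraction x (1 / 2) := by
  have := regularForce_force (e := 0) (by norm_num) 0
  simpa only [force_zero] using this

theorem IsCircularSolution.unique {x y : ℝ → ℝ} (hx : IsCircularSolution x)
    (hy : IsCircularSolution y) {c : ℝ} (h0 : x c = y c) (h1 : deriv x c = deriv y c) : x = y :=
  RegularForce.unique_of_eq_at (fun _ => regularForce_circular) hx hy h0 h1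

theorem IsCircularSolution.shift {x : ℝ → ℝ} (hx : IsCircularSolution x) (c : ℝ) :
    IsCircularSolution fun t => x (t + c) := (IsSolution.comp_add_const hx c).1

theorem IsCircularSolution.deriv_shift {x : ℝ → ℝ} (hx : IsCircularSolution x) (c : ℝ) :
    deriv (fun t => x (t + c)) = fun t => deriv x (t + c) := (IsSolution.comp_add_const hx c).2

theorem IsCircularSolution.neg {x : ℝ → ℝ} (hx : IsCircularSolution x) :
    IsCircularSolution fun t => -x t := by
  have := (IsSolution.neg hx).1
  simpa only [IsCircularSolution, attraction_neg, neg_neg] using this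

theorem IsCircularSolution.deriv_neg {x : ℝ → ℝ} (hx : IsCircularSolution x) :
    deriv (fun t => -x t) = fun t => -deriv x t := (IsSolution.neg hx).2

theorem IsCircularSolution.comp_neg {x : ℝ → ℝ} (hx : IsCircularSolution x) :
    IsCircularSolution fun t => x (-t) := (IsSolution.comp_neg hx).1

theorem IsCircularSolution.deriv_comp_neg {x : ℝ → ℝ} (hx : IsCircularSolution x) :
    deriv (fun t => x (-t)) = fun t => -deriv x (-t) := (IsSolution.comp_neg hx).2

theorem IsCircularSolution.odd {x : ℝ → ℝ} (hx : IsCircularSolution x) (h0 : x 0 = 0) (t : ℝ) :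
    x (-t) = -x t := by
  have := hx.unique hx.comp_neg.neg (c := 0) (by simp [h0])
    (by rw [hx.comp_neg.deriv_neg, hx.deriv_comp_neg]; simp)
  have := congrFun this t
  linarith

theorem IsCircularSolution.even {x : ℝ → ℝ} (hx : IsCircularSolution x) (h0 : deriv x 0 = 0)
    (t : ℝ) : x (-t) = x t := by
  have := hx.unique hx.comp_neg (c := 0) (by simp) (by rw [hx.deriv_comp_neg]; simp [h0])
  exact (congrFun this t).symm

theorem IsCircularSolution.zero : IsCircularSolution fun _ => 0 :=
  (isSolution_of_hasDerivAt (v := fun _ => 0) (fun t => hasDerivAt_const t 0)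
    fun t => (hasDerivAt_const t 0).congr_deriv (by simp [attraction])).1

theorem IsCircularSolution.eq_zero {x : ℝ → ℝ} (hx : IsCircularSolution x) {c : ℝ} (h0 : x c = 0)
    (h1 : deriv x c = 0) : x = fun _ => 0 :=
  hx.unique IsCircularSolution.zero h0 (by simpa using h1)

theorem IsCircularSolution.energy {x : ℝ → ℝ} (hx : IsCircularSolution x) (t : ℝ) :
    deriv x t ^ 2 - 2 * invDist (x t) (1 / 2) = deriv x 0 ^ 2 - 2 * invDist (x 0) (1 / 2) := by
  have hd : ∀ t, HasDerivAt (fun t => deriv x t ^ 2 - 2 * invDist (x t) (1 / 2)) 0 t := fun t =>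
    (((hx.2 t).fun_pow 2).sub
      (((hasDerivAt_invDist_fst (by norm_num)).comp t (hx.hasDerivAt t)).const_mul 2)).congr_deriv
      (by simp only [attraction]; push_cast; ring)
  exact is_const_of_deriv_eq_zero (fun t => (hd t).differentiableAt) (fun t => (hd t).deriv) t 0

theorem invDist_lt {x y r : ℝ} (hr : 0 < r) (hy : 0 ≤ y) (h : y < x) :
    invDist x r < invDist y r := by
  unfold invDist
  gcongr

theorem attraction_pos {x r : ℝ} (hr : 0 < r) (hx : 0 < x) : 0 < attraction x r := by
  have := invDist_pos (x := x) hr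
  unfold attraction
  positivity

/-- `x` is an odd solution of the circular problem with positive initial velocity and first
positive zero `s`. -/
structure IsArch (x : ℝ → ℝ) (s : ℝ) : Prop where
  circular : IsCircularSolution x
  zero : x 0 = 0
  velocity_pos : 0 < deriv x 0
  length_pos : 0 < s
  right_zero : x s = 0
  pos : ∀ t ∈ Ioo 0 s, 0 < x t

namespace IsArch

variable {x y : ℝ → ℝ} {s : ℝ}

/-- Energy conservation fixes the speed at the second zero; reaching zero from above fixes the sign.
-/
theorem deriv_right (h : IsArch x s) : deriv x s = -deriv x 0 := by
  have h1 := h.circular.energy s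
  rw [h.right_zero, h.zero] at h1
  have h2 := deriv_nonpos_of_pos_left (h.circular.hasDerivAt s) h.length_pos h.right_zero h.pos
  have h3 : (deriv x s - deriv x 0) * (deriv x s + deriv x 0) = 0 := by linarith
  rcases mul_eq_zero.1 h3 with h4 | h4 <;> linarith [h.velocity_pos]

theorem antiperiodic (h : IsArch x s) (t : ℝ) : x (t + s) = -x t := by
  have h1 := h.circular.neg.unique (h.circular.shift s) (c := 0)
    (by simp [h.zero, h.right_zero])
    (by rw [h.circular.deriv_shift, h.circular.deriv_neg]; simp [h.deriv_right])
  exact (congrFun h1 t).symm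

theorem periodic (h : IsArch x s) : Function.Periodic x (2 * s) := fun t => by
  rw [show t + 2 * s = t + s + s by ring, h.antiperiodic, h.antiperiodic, neg_neg]

theorem deriv_half (h : IsArch x s) : deriv x (s / 2) = 0 := by
  have h1 : ∀ t, x (t + s / 2) = x (-t + s / 2) := fun t => by
    rw [show t + s / 2 = (t - s / 2) + s by ring, h.antiperiodic,
      show -t + s / 2 = -(t - s / 2) by ring, h.circular.odd h.zero]
  have h2 := congrArg (fun f => deriv f 0) (funext h1)
  have h3 : deriv (fun t => x (-t + s / 2)) = _ := (h.circular.shift (s / 2)).deriv_comp_neg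
  simp only [h3, h.circular.deriv_shift] at h2
  simp only [zero_add, neg_zero] at h2
  linarith

theorem isMinimalPeriod (h : IsArch x s) : IsMinimalPeriod x (2 * s) := by
  have hs := h.length_pos
  refine ⟨⟨by linarith, h.periodic⟩, fun S hS => ?_⟩
  obtain ⟨hS0, hSp⟩ := hS
  by_contra hlt
  rw [not_le] at hlt
  have hx0 : x S = 0 := by rw [← zero_add S, hSp 0, h.zero]
  have hx1 : deriv x S = deriv x 0 := by
    have := congrArg (fun f => deriv f 0) (funext hSp)
    simpa only [h.circular.deriv_shift, zero_add] using this
  rcases lt_trichotomy S s with h1 | h1 | h1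
  · exact absurd hx0 (h.pos S ⟨hS0, h1⟩).ne'
  · rw [h1, h.deriv_right] at hx1
    linarith [h.velocity_pos]
  · have := h.pos (S - s) ⟨by linarith, by linarith⟩
    have h2 := h.antiperiodic (S - s)
    rw [sub_add_cancel, hx0] at h2
    linarith

/-- Sturm comparison. While `x > y > 0`, the Wronskian `x'y - xy'` increases strictly from `0`,
since the attraction divided by its argument is smaller for `x`. At the first meeting point `c ≤ s`
it equals `y(c)(x'(c) - y'(c)) ≤ 0`, a contradiction. -/
theorem not_velocity_lt (hx : IsArch x s) (hy : IsArch y s) : ¬ deriv y 0 < deriv x 0 := by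
  intro hlt
  obtain ⟨δ, hδ, hpos⟩ := exists_pos_right_of_deriv_pos (f := fun t => x t - y t)
    ((hx.circular.hasDerivAt 0).sub (hy.circular.hasDerivAt 0)) (by simp [hx.zero, hy.zero])
    (sub_pos.2 hlt)
  obtain ⟨c, hc, hc0, hcp⟩ := exists_first_zero
    (hx.circular.continuous.sub hy.circular.continuous) hδ hpos hx.length_pos
    (by simp [hx.right_zero, hy.right_zero])
  have hc0' : x c = y c := sub_eq_zero.1 hc0
  have hW : ∀ t, HasDerivAt (fun t => deriv x t * y t - x t * deriv y t)
      (x t * y t * (invDist (y t) (1 / 2) ^ 3 - invDist (x t) (1 / 2) ^ 3)) t := fun t =>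
    (((hx.circular.2 t).mul (hy.circular.hasDerivAt t)).sub
      ((hx.circular.hasDerivAt t).mul (hy.circular.2 t))).congr_deriv
      (by simp only [attraction]; ring)
  have hWc := pos_of_deriv_pos hW (by simp [hx.zero, hy.zero]) (s := c) (fun t ht => by
    have h1 := hx.pos t ⟨ht.1, ht.2.trans_le hc.2⟩
    have h2 := hy.pos t ⟨ht.1, ht.2.trans_le hc.2⟩
    have h3 := invDist_lt (r := 1 / 2) (by norm_num) h2.le (sub_pos.1 (hcp t ht))
    have h4 := invDist_pos (x := x t) (r := 1 / 2) (by norm_num)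
    have h5 : invDist (x t) (1 / 2) ^ 3 < invDist (y t) (1 / 2) ^ 3 := by gcongr
    have := sub_pos.2 h5
    positivity) c ⟨hc.1, le_rfl⟩
  have hd : deriv x c - deriv y c ≤ 0 := deriv_nonpos_of_pos_left
    ((hx.circular.hasDerivAt c).sub (hy.circular.hasDerivAt c)) hc.1 hc0 hcp
  have hyc : 0 ≤ y c := by
    rcases hc.2.lt_or_eq with h | h
    · exact (hy.pos c ⟨hc.1, h⟩).le
    · rw [h, hy.right_zero]
  simp only [hc0'] at hWc
  nlinarith

theorem unique (hx : IsArch x s) (hy : IsArch y s) : x = y :=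
  hx.circular.unique hy.circular (hx.zero.trans hy.zero.symm)
    (le_antisymm (not_lt.1 (hx.not_velocity_lt hy)) (not_lt.1 (hy.not_velocity_lt hx)))

end IsArch

theorem IsMinimalPeriod.unique {x : ℝ → ℝ} {S T : ℝ} (hS : IsMinimalPeriod x S)
    (hT : IsMinimalPeriod x T) : S = T := IsLeast.unique hS hT

theorem IsMinimalPeriod.shift {x : ℝ → ℝ} {T : ℝ} (h : IsMinimalPeriod x T) (c : ℝ) :
    IsMinimalPeriod (fun t => x (t + c)) T := by
  have : {S : ℝ | 0 < S ∧ Function.Periodic (fun t => x (t + c)) S} =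
      {S : ℝ | 0 < S ∧ Function.Periodic x S} := by
    ext S
    refine and_congr_right fun _ => ⟨fun h t => ?_, fun h t => ?_⟩
    · have := h (t - c)
      simp only [sub_add_cancel] at this
      rwa [show t - c + S + c = t + S by ring] at this
    · simp only
      rw [show t + S + c = t + c + S by ring, h]
  unfold IsMinimalPeriod
  rwa [this]

theorem IsMinimalPeriod.neg {x : ℝ → ℝ} {T : ℝ} (h : IsMinimalPeriod x T) :
    IsMinimalPeriod (fun t => -x t) T := by
  have : {S : ℝ | 0 < S ∧ Function.Periodic (fun t => -x t) S} =
      {S : ℝ | 0 < S ∧ Function.Periodic x S} := by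
    ext S
    simp [Function.Periodic]
  unfold IsMinimalPeriod
  rwa [this]

theorem IsCircularSolution.isArch_of_isMinimalPeriod {x : ℝ → ℝ} (hx : IsCircularSolution x)
    (h0 : x 0 = 0) (h1 : 0 < deriv x 0) {T : ℝ} (hT : IsMinimalPeriod x T) : IsArch x (T / 2) := by
  obtain ⟨δ, hδ, hpos⟩ := exists_pos_right_of_deriv_pos (hx.hasDerivAt 0) h0 h1
  have hxT : x T = 0 := by rw [← zero_add T, hT.1.2 0, h0]
  -- Some arch length `c` exists because `x T = 0`; uniqueness of the minimal period then gives `2c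
  -- = T`.
  obtain ⟨c, hc, hc0, hcp⟩ := exists_first_zero hx.continuous hδ hpos hT.1.1 hxT.le
  have hA : IsArch x c := ⟨hx, h0, h1, hc.1, hc0, hcp⟩
  have := hT.unique hA.isMinimalPeriod
  rwa [this, mul_div_cancel_left₀ _ (by norm_num : (2 : ℝ) ≠ 0)]

/-- An even periodic solution is a quarter period shift of an odd one. -/
theorem IsCircularSolution.exists_isArch_of_even {x : ℝ → ℝ} (hx : IsCircularSolution x)
    (h0 : 0 < x 0) (h1 : deriv x 0 = 0) {T : ℝ} (hT : IsMinimalPeriod x T) :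
    ∃ z, IsArch z (T / 2) ∧ x = fun t => z (t + T / 4) := by
  have hT0 : 0 < T := hT.1.1
  have hxT' : deriv x T = 0 := by
    have := congrArg (fun f => deriv f 0) (funext hT.1.2)
    simpa only [hx.deriv_shift, zero_add, h1] using this
  have hzero : ∃ t ∈ Icc 0 T, x t ≤ 0 := by
    by_contra! hcon
    -- A solution that stays positive is strictly concave, so its velocity could not return to `0`
    -- at time `T`.
    have := pos_of_deriv_pos (f := fun t => -deriv x t) (s := T)
      (fun t => (hx.2 t).neg.congr_deriv (neg_neg _)) (by simp [h1])
      (fun t ht => attraction_pos (by norm_num) (hcon t ⟨ht.1.le, ht.2.le⟩)) T ⟨hT0, le_rfl⟩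
    simp [hxT'] at this
  obtain ⟨r, hr, hxr⟩ := hzero
  have hr0 : 0 < r := lt_of_le_of_ne hr.1 (by rintro rfl; linarith)
  obtain ⟨δ, hδ, hpos⟩ : ∃ δ > 0, ∀ t ∈ Ioo 0 δ, 0 < x t := by
    obtain ⟨δ, hδ, H⟩ := Metric.eventually_nhds_iff.1
      (hx.continuous.continuousAt.eventually (lt_mem_nhds h0))
    exact ⟨δ, hδ, fun t ht => H (by rw [Real.dist_eq, sub_zero, abs_of_pos ht.1]; exact ht.2)⟩
  obtain ⟨c, hc, hc0, hcp⟩ := exists_first_zero hx.continuous hδ hpos hr0 hxr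
  set z : ℝ → ℝ := fun t => -x (t + c) with hz
  have hzc : IsCircularSolution z := (hx.shift c).neg
  have hz0 : z 0 = 0 := by simp [hz, hc0]
  have hz1 : deriv z 0 = -deriv x c := by
    rw [hz, (hx.shift c).deriv_neg, hx.deriv_shift]
    simp
  have hz1pos : 0 < deriv z 0 := by
    have h2 := deriv_nonpos_of_pos_left (hx.hasDerivAt c) hc.1 hc0 hcp
    rcases h2.lt_or_eq with h3 | h3
    · linarith
    · rw [hx.eq_zero hc0 h3] at h0
      exact absurd h0 (lt_irrefl _)
  have hA := hzc.isArch_of_isMinimalPeriod hz0 hz1pos (hT.shift c).neg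
  -- Evenness makes `x` positive on `(-c, c)`, so the arch `z` has length exactly `2c`. Comparing
  -- its minimal period `4c` with `T` identifies the shift.
  have hB : IsArch z (2 * c) := by
    refine ⟨hzc, hz0, hz1pos, by linarith [hc.1], ?_, fun t ht => ?_⟩
    · have := hzc.odd hz0 (-(2 * c))
      rw [neg_neg] at this
      rw [this, hz]
      simp only
      rw [show -(2 * c) + c = -c by ring, hx.even h1, hc0]
      simp
    · have := hzc.odd hz0 (-t)
      rw [neg_neg] at this
      rw [this, hz]
      simp only [neg_neg]
      rcases lt_trichotomy t c with h2 | h2 | h2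
      · exact hcp _ ⟨by linarith, by linarith [ht.1]⟩
      · simpa [h2] using h0
      · rw [show -t + c = -(t - c) by ring, hx.even h1]
        exact hcp _ ⟨by linarith, by linarith [ht.2]⟩
  have hcT : c = T / 4 := by
    have := hA.isMinimalPeriod.unique hB.isMinimalPeriod
    linarith
  refine ⟨z, hA, funext fun t => ?_⟩
  have := hA.antiperiodic (t - T / 4)
  rw [show t - T / 4 + T / 2 = t + T / 4 by ring] at this
  rw [this, hz, hcT]
  simp

/-! ### Existence of odd periodic solutions of given period -/

/-- Shooting: the velocity is the infimum of those whose solution stays positive on `(0, s]`. Fast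
launches stay positive and slow ones return before `π`, so the infimum is positive. At the infimum
the solution is nonnegative, cannot touch zero inside the interval, and must vanish at `s`, for
otherwise a smaller velocity would still be admissible. -/
theorem exists_isArch {s : ℝ} (hs : π ≤ s) : ∃ x, IsArch x s := by
  have hs0 : 0 < s := pi_pos.trans_le hs
  choose X hX hX0 hX1 using fun v => regularForce_circular.exists_isSolution 0 v
  have hXc : ∀ v, IsCircularSolution (X v) := hX
  set C := 513 * exp (512 * s) with hC
  have hC0 : 0 < C := by positivity
  have hdep : ∀ v v', ∀ t ∈ Icc 0 s, |X v t - X v' t| ≤ C * |v - v'| ∧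
      |deriv (X v) t - deriv (X v') t| ≤ C * |v - v'| := fun v v' t ht =>
    abs_sub_le_of_isSolution (e := 0) (e' := 0) (by norm_num) (by norm_num)
      (isSolution_force_zero_iff.2 (hXc v)) (isSolution_force_zero_iff.2 (hXc v'))
      (by simp [hX0]) (by simp [hX1]) (by simp) ht
  set S : Set ℝ := {v | 0 < v ∧ ∀ t ∈ Ioc 0 s, 0 < X v t} with hS
  have hSne : S.Nonempty := by
    -- The acceleration is at most `16` in absolute value, so the velocity stays at least `1` up to
    -- time `s`.
    refine ⟨16 * s + 1, by positivity, pos_of_deriv_pos (fun t => (hXc _).hasDerivAt t) (hX0 _)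
      fun t ht => ?_⟩
    have h1 := convex_univ.norm_image_sub_le_of_norm_hasDerivWithin_le
      (f := deriv (X (16 * s + 1))) (C := 16) (x := 0) (y := t)
      (fun t _ => ((hXc _).2 t).hasDerivWithinAt)
      (fun t _ => by rw [norm_neg]; exact abs_attraction_le (by norm_num)) trivial trivial
    rw [hX1, Real.norm_eq_abs, Real.norm_eq_abs, sub_zero, abs_of_pos ht.1] at h1
    linarith [(abs_le.1 h1).1, ht.2]
  -- Sturm comparison with `sin t`. For smaller `v`, a positive solution obeys `X < vt < 3/4` on
  -- `(0, π]`, hence `X² + 1/4 < 1` and the force is at least `X`. Then `X cos t - X' sin t` is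
  -- nondecreasing, which contradicts its value `-X(π) < 0` at `π`.
  have hSlow : ∀ v ∈ S, 3 / (4 * π) ≤ v := by
    rintro v ⟨hv0, hv⟩
    by_contra! hlt
    rw [lt_div_iff₀ (by positivity)] at hlt
    have hpos : ∀ t ∈ Ioc 0 π, 0 < X v t := fun t ht => hv t ⟨ht.1, ht.2.trans hs⟩
    have hd : ∀ t ∈ Ioc 0 π, deriv (X v) t < v := fun t ht => by
      have := pos_of_deriv_pos (f := fun t => v - deriv (X v) t) (s := π)
        (fun t => ((hXc v).2 t).const_sub v) (by simp [hX1])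
        (fun t ht => by
          rw [neg_neg]
          exact attraction_pos (by norm_num) (hpos t ⟨ht.1, ht.2.le⟩)) t ht
      linarith
    have hle : ∀ t ∈ Ioc 0 π, X v t < v * t := fun t ht => by
      have := pos_of_deriv_pos (f := fun t => v * t - X v t) (s := π)
        (fun t => ((hasDerivAt_id' t).const_mul v).sub ((hXc v).hasDerivAt t)) (by simp [hX0])
        (fun t ht => by
          have := hd t ⟨ht.1, ht.2.le⟩
          linarith) t ht
      linarith
    have hW : ∀ t, HasDerivAt (fun t => X v t * cos t - deriv (X v) t * sin t)
        (X v t * sin t * (invDist (X v t) (1 / 2) ^ 3 - 1)) t := fun t =>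
      ((((hXc v).hasDerivAt t).mul (hasDerivAt_cos t)).sub
        (((hXc v).2 t).mul (hasDerivAt_sin t))).congr_deriv (by simp only [attraction]; ring)
    have hmono := monotoneOn_of_deriv_nonneg (convex_Icc 0 π)
      (HasDerivAt.continuousOn fun t _ => hW t)
      (fun t _ => (hW t).differentiableAt.differentiableWithinAt) (fun t ht => by
        rw [interior_Icc] at ht
        rw [(hW t).deriv]
        have h1 := hpos t ⟨ht.1, ht.2.le⟩
        have h2 := hle t ⟨ht.1, ht.2.le⟩
        have h3 := sin_pos_of_pos_of_lt_pi ht.1 ht.2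
        have h4 : X v t < 3 / 4 := by nlinarith [ht.2]
        have h5 := invDist_sq (x := X v t) (r := 1 / 2) (by norm_num)
        have h6 := invDist_pos (x := X v t) (r := 1 / 2) (by norm_num)
        have h7 : 1 ≤ invDist (X v t) (1 / 2) := by
          by_contra! h8
          have h9 : invDist (X v t) (1 / 2) ^ 2 < 1 := by nlinarith
          have h10 : X v t ^ 2 + (1 / 2) ^ 2 < 1 := by nlinarith
          nlinarith [sq_nonneg (invDist (X v t) (1 / 2))]
        have := sub_nonneg.2 (one_le_pow₀ h7 (n := 3))
        positivity)
    have := hmono ⟨le_rfl, pi_pos.le⟩ ⟨pi_pos.le, le_rfl⟩ pi_pos.le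
    simp only [hX0, sin_zero, cos_zero, cos_pi, sin_pi] at this
    have h2 := hpos π ⟨pi_pos, le_rfl⟩
    linarith
  have hbdd : BddBelow S := ⟨_, hSlow⟩
  set v := sInf S with hv
  have hvpos : 0 < v := lt_of_lt_of_le (by positivity) (le_csInf hSne hSlow)
  set x := X v with hx
  have hxc : IsCircularSolution x := hXc v
  have hx0 : x 0 = 0 := hX0 v
  have hx1 : deriv x 0 = v := hX1 v
  have hnonneg : ∀ t ∈ Icc 0 s, 0 ≤ x t := fun t ht => by
    refine le_of_forall_pos_le_add fun ε hε => ?_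
    obtain ⟨v', hv'S, hv'⟩ := exists_lt_of_csInf_lt hSne
      (show v < v + ε / C by have : 0 < ε / C := by positivity
                             linarith)
    have h1 : v ≤ v' := csInf_le hbdd hv'S
    have h2 := (hdep v' v t ht).1
    rw [abs_of_nonneg (by linarith : 0 ≤ v' - v)] at h2
    have h3 : C * (v' - v) ≤ ε := by
      have : C * (ε / C) = ε := by field_simp
      nlinarith
    have h4 : 0 ≤ X v' t := by
      rcases ht.1.eq_or_lt with h | h
      · rw [← h, hX0]
      · exact (hv'S.2 t ⟨h, ht.2⟩).le
    linarith [(abs_le.1 h2).2]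
  have hpos : ∀ t ∈ Ioo 0 s, 0 < x t := fun t ht => by
    refine lt_of_le_of_ne (hnonneg t ⟨ht.1.le, ht.2.le⟩) fun h => ?_
    have hmin : IsLocalMin x t := by
      filter_upwards [Icc_mem_nhds ht.1 ht.2] with r hr
      rw [← h]
      exact hnonneg r hr
    -- An interior zero of a nonnegative solution is a double zero, which forces the trivial
    -- solution.
    have := hxc.eq_zero h.symm hmin.deriv_eq_zero
    rw [this] at hx1
    simp at hx1
    linarith
  refine ⟨x, hxc, hx0, by rw [hx1]; exact hvpos, hs0, ?_, hpos⟩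
  by_contra hne
  have hxs : 0 < x s := lt_of_le_of_ne (hnonneg s ⟨hs0.le, le_rfl⟩) (Ne.symm hne)
  obtain ⟨δ, hδ, hδv⟩ := Metric.eventually_nhds_iff.1
    (hxc.continuous_deriv.continuousAt.eventually (lt_mem_nhds (show v / 2 < deriv x 0 by linarith)))
  -- Positivity at the smaller velocity `v - η` is proved separately on two pieces: on `(0, δ']` the
  -- derivative stays above `v/4`, and on `[δ', s]` the solution stays above half of the minimum of
  -- `x`.
  set δ' := min (δ / 2) s with hδ'
  have hδ'0 : 0 < δ' := by positivity
  have hδ'δ : δ' < δ := (min_le_left _ _).trans_lt (by linarith)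
  have hδ's : δ' ≤ s := min_le_right _ _
  obtain ⟨t₁, ht₁, hmin⟩ := (isCompact_Icc (a := δ') (b := s)).exists_isMinOn
    ⟨δ', le_rfl, hδ's⟩ hxc.continuous.continuousOn
  have hμ : 0 < x t₁ := by
    rcases ht₁.2.lt_or_eq with h | h
    · exact hpos t₁ ⟨hδ'0.trans_le ht₁.1, h⟩
    · rwa [h]
  have hη0 : 0 < min (min (v / 2) (v / (4 * C))) (x t₁ / (2 * C)) := by positivity
  set η := min (min (v / 2) (v / (4 * C))) (x t₁ / (2 * C)) with hη
  have hη1 : η ≤ v / 2 := (min_le_left _ _).trans (min_le_left _ _)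
  have hη2 : C * η ≤ v / 4 := by
    have : η ≤ v / (4 * C) := (min_le_left _ _).trans (min_le_right _ _)
    rw [le_div_iff₀ (by positivity)] at this
    linarith
  have hη3 : C * η ≤ x t₁ / 2 := by
    have : η ≤ x t₁ / (2 * C) := min_le_right _ _
    rw [le_div_iff₀ (by positivity)] at this
    linarith
  have hmem : v - η ∈ S := by
    refine ⟨by linarith, fun t ht => ?_⟩
    have hd : ∀ t ∈ Icc 0 s, |X (v - η) t - x t| ≤ C * η ∧
        |deriv (X (v - η)) t - deriv x t| ≤ C * η := fun t ht => by
      have := hdep (v - η) v t ht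
      rwa [show v - η - v = -η by ring, abs_neg, abs_of_pos hη0] at this
    rcases le_total t δ' with h | h
    · refine pos_of_deriv_pos (fun t => (hXc _).hasDerivAt t) (hX0 _) (s := δ') (fun r hr => ?_) t
        ⟨ht.1, h⟩
      have h1 := hδv (y := r) (by
        rw [Real.dist_eq, sub_zero, abs_of_pos hr.1]
        linarith [hr.2])
      have h2 := (hd r ⟨hr.1.le, hr.2.le.trans hδ's⟩).2
      linarith [(abs_le.1 h2).1]
    · have h1 : x t₁ ≤ x t := hmin ⟨h, ht.2⟩
      have h2 := (hd t ⟨ht.1.le, ht.2⟩).1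
      linarith [(abs_le.1 h2).1]
  have := csInf_le hbdd hmem
  linarith

/-! ### The linearization along a periodic solution of the circular problem -/

/-- `x` is a solution of the circular problem of antiperiod `s`, and `y` a solution of the
linearized equation of Wronskian `1` with `x'` which is changed by multiples of `x'` under
translations by `s`. -/
structure IsParabolicFrame (x y : ℝ → ℝ) (s d : ℝ) : Prop where
  circular : IsCircularSolution x
  hill : IsSolution (fun y t => attractionX (x t) (1 / 2) * y) y
  wronskian : deriv x 0 * deriv y 0 - deriv (deriv x) 0 * y 0 = 1
  antiperiodic : ∀ t, x (t + s) = -x t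
  shift : ∀ t, y (t + s) = -y t + d * deriv x t
  ne_zero : d ≠ 0

/-- The solution `y` with `y(0) = 0` is translated by `s`; the coefficient of the linearization has
period `s`, so matching data at `0` gives the shift rule with `d = y(s)/v`. Nondegeneracy is `y(s) >
0`, again by Sturm: `xy' - x'y` increases strictly from `0` while `x, y > 0`, whereas at a first
zero `c ≤ s` of `y` it would be `x(c)y'(c) ≤ 0`. -/
theorem IsArch.exists_isParabolicFrame {x : ℝ → ℝ} {s : ℝ} (h : IsArch x s) :
    ∃ y d, IsParabolicFrame x y s d := by
  have hx := h.circular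
  have hqc : Continuous fun t => attractionX (x t) (1 / 2) :=
    (continuous_attractionX (by norm_num)).comp hx.continuous
  set v := deriv x 0 with hv
  have hv0 : 0 < v := h.velocity_pos
  obtain ⟨y, hy, hy0, hy1⟩ := (regularForce_hill hqc).exists_isSolution 0 (1 / v)
  have hχ := hx.isSolution_deriv
  have hχ0 : deriv (deriv x) 0 = 0 := by rw [hχ.2]; simp [h.zero, attraction]
  have hχs : deriv (deriv x) s = 0 := by rw [hχ.2]; simp [h.right_zero, attraction]
  have hW0 : deriv x 0 * deriv y 0 - deriv (deriv x) 0 * y 0 = 1 := by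
    rw [hy0, hy1, ← hv]
    field_simp
    ring
  have hWs := hχ.1.wronskian_eq hy s
  rw [hW0, hχs, h.deriv_right, ← hv] at hWs
  have hys : 0 < y s := by
    by_contra! hle
    obtain ⟨δ, hδ, hpos⟩ := exists_pos_right_of_deriv_pos (hy.hasDerivAt 0) hy0
      (by rw [hy1]; positivity)
    obtain ⟨c, hc, hc0, hcp⟩ := exists_first_zero hy.continuous hδ hpos h.length_pos hle
    have hWd : ∀ t, HasDerivAt (fun t => x t * deriv y t - deriv x t * y t)
        (x t * y t * (3 * x t ^ 2 * invDist (x t) (1 / 2) ^ 5)) t := fun t =>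
      (((hx.hasDerivAt t).mul (hy.2 t)).sub ((hx.2 t).mul (hy.hasDerivAt t))).congr_deriv
        (by simp only [attraction, attractionX]; ring)
    have hWc := pos_of_deriv_pos hWd (by simp [h.zero, hy0]) (s := c) (fun t ht => by
      have h1 := h.pos t ⟨ht.1, ht.2.trans_le hc.2⟩
      have h2 := hcp t ht
      have h4 := invDist_pos (x := x t) (r := 1 / 2) (by norm_num)
      positivity) c ⟨hc.1, le_rfl⟩
    have hd := deriv_nonpos_of_pos_left (hy.hasDerivAt c) hc.1 hc0 hcp
    have hxc : 0 ≤ x c := by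
      rcases hc.2.lt_or_eq with h' | h'
      · exact (h.pos c ⟨hc.1, h'⟩).le
      · rw [h', h.right_zero]
    simp only [hc0] at hWc
    nlinarith
  refine ⟨y, y s / v, hx, hy, hW0, h.antiperiodic, fun t => ?_, by positivity⟩
  have hsh := hy.comp_add_const s
  have hsh1 : IsSolution (fun y t => attractionX (x t) (1 / 2) * y) fun t => y (t + s) := by
    have := hsh.1
    simpa only [h.antiperiodic, attractionX_neg] using this
  have hcomb := hy.hill_linear_comb hχ.1 (-1) (y s / v)
  have := (regularForce_hill hqc).unique hsh1 hcomb.1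
    (by simp only [zero_add, hy0]; rw [← hv]; field_simp; ring)
    (by
      rw [hsh.2, hcomb.2]
      simp only [zero_add, hy1, hχ0]
      have : deriv y s = -(1 / v) := by field_simp; linarith
      rw [this]
      ring)
  have := congrFun this t
  linarith

namespace IsParabolicFrame

variable {x y : ℝ → ℝ} {s d : ℝ}

theorem translate (h : IsParabolicFrame x y s d) (c : ℝ) :
    IsParabolicFrame (fun t => x (t + c)) (fun t => y (t + c)) s d := by
  have h1 := h.circular.isSolution_deriv.1
  have h2 := h1.comp_add_const c
  have h3 := h.hill.comp_add_const c
  refine ⟨h.circular.shift c, h3.1, ?_, fun t => ?_, fun t => ?_, h.ne_zero⟩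
  · rw [h.circular.deriv_shift, h2.2, h3.2]
    simp only [zero_add]
    rw [← h.wronskian]
    exact h1.wronskian_eq h.hill c
  · rw [show t + s + c = t + c + s by ring, h.antiperiodic]
  · rw [show t + s + c = t + c + s by ring, h.shift, h.circular.deriv_shift]

theorem deriv_antiperiodic (h : IsParabolicFrame x y s d) (t : ℝ) :
    deriv x (t + s) = -deriv x t := by
  have := congrArg deriv (funext h.antiperiodic)
  rw [h.circular.deriv_shift, h.circular.deriv_neg] at this
  exact congrFun this t

theorem deriv_deriv_antiperiodic (h : IsParabolicFrame x y s d) (t : ℝ) :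
    deriv (deriv x) (t + s) = -deriv (deriv x) t := by
  rw [h.circular.isSolution_deriv.2]
  simp only [h.antiperiodic, attraction_neg]

theorem deriv_shift (h : IsParabolicFrame x y s d) (t : ℝ) :
    deriv y (t + s) = -deriv y t + d * deriv (deriv x) t := by
  have := congrArg deriv (funext h.shift)
  rw [(h.hill.comp_add_const s).2] at this
  have h2 := congrFun this t
  rw [h2]
  exact ((h.hill.hasDerivAt t).neg.add
    ((h.circular.isSolution_deriv.1.hasDerivAt t).const_mul d)).deriv

theorem shift_nat (h : IsParabolicFrame x y s d) (k : ℕ) :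
    deriv x (k * s) = (-1) ^ k * deriv x 0 ∧
      deriv (deriv x) (k * s) = (-1) ^ k * deriv (deriv x) 0 ∧
      y (k * s) = (-1) ^ k * (y 0 - k * d * deriv x 0) ∧
      deriv y (k * s) = (-1) ^ k * (deriv y 0 - k * d * deriv (deriv x) 0) := by
  induction k with
  | zero => simp
  | succ k ih =>
    obtain ⟨h1, h2, h3, h4⟩ := ih
    have e : ((k + 1 : ℕ) : ℝ) * s = k * s + s := by push_cast; ring
    rw [e, h.deriv_antiperiodic, h.deriv_deriv_antiperiodic, h.shift, h.deriv_shift, h1, h2, h3, h4]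
    push_cast
    refine ⟨by ring, by ring, by ring, by ring⟩

end IsParabolicFrame

/-! ### An implicit function theorem with a parameter -/

/-- `(v, e) ↦ G v e` is strictly differentiable at `(v₀, 0)`, with partial derivatives `A`, `B`. -/
def HasStrictPartials (G : ℝ → ℝ → ℝ) (v₀ A B : ℝ) : Prop :=
  ∀ ε > 0, ∃ δ > 0, ∀ v v' e e', |v - v₀| ≤ δ → |v' - v₀| ≤ δ → |e| ≤ δ → |e'| ≤ δ →
    |G v e - G v' e' - (A * (v - v') + B * (e - e'))| ≤ ε * (|v - v'| + |e - e'|)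

theorem HasStrictPartials.neg {G : ℝ → ℝ → ℝ} {v₀ A B : ℝ} (h : HasStrictPartials G v₀ A B) :
    HasStrictPartials (fun v e => -G v e) v₀ (-A) (-B) := fun ε hε => by
  obtain ⟨δ, hδ, H⟩ := h ε hε
  refine ⟨δ, hδ, fun v v' e e' h1 h2 h3 h4 => ?_⟩
  rw [show -G v e - -G v' e' - (-A * (v - v') + -B * (e - e')) =
    -(G v e - G v' e' - (A * (v - v') + B * (e - e'))) by ring, abs_neg]
  exact H v v' e e' h1 h2 h3 h4

theorem HasStrictPartials.abs_sub_le {A B g v e ε : ℝ}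
    (h : |g - (A * v + B * e)| ≤ ε * (|v| + |e|)) (hg : g = 0) :
    |A| * |v| ≤ |B| * |e| + ε * (|v| + |e|) := by
  rw [hg, zero_sub, abs_neg] at h
  have h1 := abs_sub_abs_le_abs_sub (A * v) (-(B * e))
  rw [sub_neg_eq_add, abs_neg, abs_mul, abs_mul] at h1
  linarith

/-- With tolerance `A/2`, `G(·, e)` changes sign on `[v₀ - δ, v₀ + δ]`, so the intermediate value
theorem gives a zero. The same expansion bounds `|V e - v|` by a multiple of `|e - e'|` for any
nearby zero `v` at `e'`: this gives continuity, and `V 0 = v₀` although `V` is chosen arbitrarily.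
-/
theorem HasStrictPartials.exists_implicit_of_pos {G : ℝ → ℝ → ℝ} {v₀ A B : ℝ}
    (h : HasStrictPartials G v₀ A B) (hA : 0 < A) (h0 : G v₀ 0 = 0) :
    ∃ e₀ > 0, e₀ ≤ 1 / 2 ∧ ∃ V : ℝ → ℝ, V 0 = v₀ ∧ ContinuousOn V (Ico 0 e₀) ∧
      ∀ e ∈ Ico 0 e₀, G (V e) e = 0 := by
  obtain ⟨δ, hδ, H⟩ := h (A / 2) (by linarith)
  set M := |B| + A / 2 with hM
  have hM0 : 0 < M := by positivity
  have hpos : 0 < min (min δ (1 / 2)) (A * δ / (2 * M)) := by positivity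
  -- At `v₀ ± δ` the linear term has size `Aδ`; the remaining terms are at most `Aδ/2 + M e`, so `M
  -- e₀ ≤ Aδ/2` preserves its sign.
  set e₀ := min (min δ (1 / 2)) (A * δ / (2 * M)) with he₀
  have e1 : e₀ ≤ δ := (min_le_left _ _).trans (min_le_left _ _)
  have e2 : e₀ ≤ 1 / 2 := (min_le_left _ _).trans (min_le_right _ _)
  have e3 : M * e₀ ≤ A * δ / 2 := by
    have : e₀ ≤ A * δ / (2 * M) := min_le_right _ _
    rw [le_div_iff₀ (by positivity)] at this
    linarith
  have hδ0 : |(0 : ℝ)| ≤ δ := by simpa using hδ.le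
  have hv0 : |v₀ - v₀| ≤ δ := by simpa using hδ.le
  have hex : ∀ e, ∃ v, e ∈ Ico 0 e₀ → |v - v₀| ≤ δ ∧ G v e = 0 := by
    intro e
    by_cases he : e ∈ Ico 0 e₀
    swap
    · exact ⟨0, fun h => absurd h he⟩
    have hee : |e| ≤ δ := by rw [abs_of_nonneg he.1]; linarith [he.2]
    have hBe : |B * e| ≤ |B| * e := by rw [abs_mul, abs_of_nonneg he.1]
    have hMe : M * e ≤ A * δ / 2 := (mul_le_mul_of_nonneg_left he.2.le hM0.le).trans e3
    rw [hM] at hMe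
    have hlow : G (v₀ - δ) e ≤ 0 := by
      have := H (v₀ - δ) v₀ e 0 (by simp [abs_of_pos hδ]) hv0 hee hδ0
      rw [h0, show v₀ - δ - v₀ = -δ by ring, abs_neg, abs_of_pos hδ, sub_zero,
        sub_zero, abs_of_nonneg he.1] at this
      nlinarith [(abs_le.1 this).2, (abs_le.1 hBe).2]
    have hhigh : 0 ≤ G (v₀ + δ) e := by
      have := H (v₀ + δ) v₀ e 0 (by simp [abs_of_pos hδ]) hv0 hee hδ0
      rw [h0, show v₀ + δ - v₀ = δ by ring, abs_of_pos hδ, sub_zero,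
        sub_zero, abs_of_nonneg he.1] at this
      nlinarith [(abs_le.1 this).1, (abs_le.1 hBe).1]
    have hc : ContinuousOn (fun v => G v e) (Icc (v₀ - δ) (v₀ + δ)) := by
      have hl : LipschitzOnWith (3 * A / 2).toNNReal (fun v => G v e) (Icc (v₀ - δ) (v₀ + δ)) := by
        refine LipschitzOnWith.of_dist_le_mul fun v hv v' hv' => ?_
        rw [Real.coe_toNNReal _ (by positivity), Real.dist_eq, Real.dist_eq]
        have := H v v' e e (abs_le.2 ⟨by linarith [hv.1], by linarith [hv.2]⟩)
          (abs_le.2 ⟨by linarith [hv'.1], by linarith [hv'.2]⟩) hee hee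
        rw [sub_self, mul_zero, add_zero, abs_zero, add_zero] at this
        have h2 := abs_sub_abs_le_abs_sub (G v e - G v' e) (A * (v - v'))
        rw [abs_mul, abs_of_pos hA] at h2
        linarith
      exact hl.continuousOn
    obtain ⟨v, hv, hv'⟩ := intermediate_value_Icc (by linarith) hc
      (show (0 : ℝ) ∈ Icc _ _ from ⟨hlow, hhigh⟩)
    exact ⟨v, fun _ => ⟨abs_le.2 ⟨by linarith [hv.1], by linarith [hv.2]⟩, hv'⟩⟩
  choose V hV using hex
  have hlip : ∀ e ∈ Ico 0 e₀, ∀ e' ∈ Ico 0 e₀, ∀ v, |v - v₀| ≤ δ → G v e' = 0 →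
      A / 2 * |V e - v| ≤ M * |e - e'| := fun e he e' he' v hv hG => by
    have := HasStrictPartials.abs_sub_le (H (V e) v e e' (hV e he).1 hv
      (by rw [abs_of_nonneg he.1]; linarith [he.2]) (by rw [abs_of_nonneg he'.1]; linarith [he'.2]))
      (by rw [(hV e he).2, hG, sub_zero])
    rw [abs_of_pos hA] at this
    rw [hM]
    linarith
  have h0mem : (0 : ℝ) ∈ Ico 0 e₀ := ⟨le_rfl, hpos⟩
  refine ⟨e₀, hpos, e2, V, ?_, ?_, fun e he => (hV e he).2⟩
  · have := hlip 0 h0mem 0 h0mem v₀ hv0 h0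
    rw [sub_self, abs_zero, mul_zero] at this
    have h2 : |V 0 - v₀| ≤ 0 := by nlinarith
    exact sub_eq_zero.1 (abs_nonpos_iff.1 h2)
  · have hl : LipschitzOnWith (2 * M / A).toNNReal V (Ico 0 e₀) := by
      refine LipschitzOnWith.of_dist_le_mul fun e he e' he' => ?_
      rw [Real.coe_toNNReal _ (by positivity), Real.dist_eq, Real.dist_eq, div_mul_eq_mul_div,
        le_div_iff₀ hA]
      have := hlip e he e' he' (V e') (hV e' he').1 (hV e' he').2
      linarith
    exact hl.continuousOn

theorem HasStrictPartials.exists_implicit {G : ℝ → ℝ → ℝ} {v₀ A B : ℝ}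
    (h : HasStrictPartials G v₀ A B) (hA : A ≠ 0) (h0 : G v₀ 0 = 0) :
    ∃ e₀ > 0, e₀ ≤ 1 / 2 ∧ ∃ V : ℝ → ℝ, V 0 = v₀ ∧ ContinuousOn V (Ico 0 e₀) ∧
      ∀ e ∈ Ico 0 e₀, G (V e) e = 0 := by
  rcases hA.lt_or_gt with hA | hA
  · simpa using h.neg.exists_implicit_of_pos (by linarith) (by simp [h0])
  · exact h.exists_implicit_of_pos hA h0

/-- This applies to every continuous branch of zeros, not just a constructed one. A crude tolerance
first gives `|V e - V 0| ≤ C e`; inserting it into the expansion gives the derivative. -/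
theorem HasStrictPartials.hasRightDeriv {G : ℝ → ℝ → ℝ} {V : ℝ → ℝ} {A B e₀ : ℝ}
    (h : HasStrictPartials G (V 0) A B) (hA : A ≠ 0) (he₀ : 0 < e₀)
    (hV : ContinuousOn V (Ico 0 e₀)) (hG : ∀ e ∈ Ico 0 e₀, G (V e) e = 0) :
    HasRightDeriv V (-B / A) := by
  intro ε hε
  have hA0 : 0 < |A| := abs_pos.2 hA
  set C := 2 * (|B| + |A| / 2) / |A| with hC
  have hC0 : 0 < C := by positivity
  set ε₁ := min (|A| / 2) (ε * |A| / (C + 1)) with hε₁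
  have hε₁0 : 0 < ε₁ := by positivity
  have hε₁1 : ε₁ ≤ |A| / 2 := min_le_left _ _
  have hε₁2 : ε₁ * (C + 1) ≤ ε * |A| := by
    rw [← le_div_iff₀ (by positivity)]
    exact min_le_right _ _
  obtain ⟨δ, hδ, H⟩ := h ε₁ hε₁0
  obtain ⟨δ₂, hδ₂, H2⟩ := Metric.continuousWithinAt_iff.1 (hV 0 ⟨le_rfl, he₀⟩) δ hδ
  refine ⟨min (min δ (δ₂ / 2)) (e₀ / 2), by positivity, fun e he => ?_⟩
  have he1 : e ≤ δ := he.2.trans ((min_le_left _ _).trans (min_le_left _ _))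
  have he2 : e ≤ δ₂ / 2 := he.2.trans ((min_le_left _ _).trans (min_le_right _ _))
  have he3 : e ≤ e₀ / 2 := he.2.trans (min_le_right _ _)
  have hemem : e ∈ Ico 0 e₀ := ⟨he.1, by linarith⟩
  have hVe : |V e - V 0| ≤ δ := (H2 hemem (by
    rw [Real.dist_eq, sub_zero, abs_of_nonneg he.1]
    linarith)).le
  have k := H (V e) (V 0) e 0 hVe (by simpa using hδ.le) (by rwa [abs_of_nonneg he.1])
    (by simpa using hδ.le)
  have k2 := HasStrictPartials.abs_sub_le k (by rw [hG e hemem, hG 0 ⟨le_rfl, he₀⟩, sub_zero])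
  rw [hG e hemem, hG 0 ⟨le_rfl, he₀⟩, sub_zero, zero_sub, abs_neg] at k
  rw [sub_zero, abs_of_nonneg he.1] at k k2
  have k3 : |V e - V 0| ≤ C * e := by
    rw [hC, div_mul_eq_mul_div, le_div_iff₀ hA0]
    nlinarith [abs_nonneg (V e - V 0), he.1]
  have k4 : |A| * |V e - V 0 - e * (-B / A)| ≤ ε₁ * (C + 1) * e := by
    rw [← abs_mul, show A * (V e - V 0 - e * (-B / A)) = A * (V e - V 0) + B * e by
      field_simp; ring]
    refine k.trans ?_
    nlinarith
  have k5 : |A| * |V e - V 0 - e * (-B / A)| ≤ |A| * (ε * e) :=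
    k4.trans (by nlinarith [mul_le_mul_of_nonneg_right hε₁2 he.1])
  exact le_of_mul_le_mul_left k5 hA0

/-! ### The bifurcation equations -/

/-- The solution of `(S_e)` with initial data `(a, b)` at time `0`. -/
def flow (e a b : ℝ) : ℝ → ℝ :=
  Classical.epsilon fun x : ℝ → ℝ =>
    IsSolution (fun x t => force x t e) x ∧ x 0 = a ∧ deriv x 0 = b

theorem regularForce_force' {e : ℝ} (he : |e| ≤ 1 / 2) : RegularForce fun x t => force x t e := by
  simpa using regularForce_force he 0

theorem flow_spec {e : ℝ} (he : |e| ≤ 1 / 2) (a b : ℝ) :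
    IsSolution (fun x t => force x t e) (flow e a b) ∧ flow e a b 0 = a ∧
      deriv (flow e a b) 0 = b :=
  Classical.epsilon_spec ((regularForce_force' he).exists_isSolution a b)

theorem flow_eq {e : ℝ} (he : |e| ≤ 1 / 2) {x : ℝ → ℝ}
    (hx : IsSolution (fun x t => force x t e) x) : flow e (x 0) (deriv x 0) = x :=
  have h := flow_spec he (x 0) (deriv x 0)
  (regularForce_force' he).unique h.1 hx h.2.1 h.2.2

/-- The partial derivative in the velocity is `ψ(ks)`, with `ψ` the linearized solution of data `(0,
1)`. Iterating the shift rule gives `ψ(ks) = -(-1)^k k d x'(0)²`, nonzero precisely because of `d`.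
-/
theorem IsParabolicFrame.exists_hasStrictPartials_odd {x y : ℝ → ℝ} {s d : ℝ}
    (h : IsParabolicFrame x y s d) (h0 : x 0 = 0) (h1 : deriv x 0 ≠ 0) {k : ℕ} (hk : 1 ≤ k)
    (hs : 0 ≤ s) :
    ∃ A B, A ≠ 0 ∧ HasStrictPartials (fun v e => flow e 0 v (k * s)) (deriv x 0) A B := by
  have hqc : Continuous fun t => attractionX (x t) (1 / 2) :=
    (continuous_attractionX (by norm_num)).comp h.circular.continuous
  have htc : Continuous fun t => tidal (x t) * cos t :=
    (continuous_tidal.comp h.circular.continuous).mul continuous_cos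
  obtain ⟨ω, hω, hω0, hω1⟩ := (regularForce_linear hqc htc).exists_isSolution 0 0
  have hχ := h.circular.isSolution_deriv.1
  have hψ := hχ.hill_linear_comb h.hill (-y 0) (deriv x 0)
  set ψ : ℝ → ℝ := fun t => -y 0 * deriv x t + deriv x 0 * y t with hψdef
  have hψ0 : ψ 0 = 0 := by simp only [hψdef]; ring
  have hψ1 : deriv ψ 0 = 1 := by rw [hψ.2]; linarith [h.wronskian]
  have hA : ψ (k * s) = -((-1) ^ k * k * d * deriv x 0 ^ 2) := by
    obtain ⟨e1, -, e2, -⟩ := h.shift_nat k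
    simp only [hψdef, e1, e2]
    ring
  refine ⟨ψ (k * s), ω (k * s), ?_, fun ε hε => ?_⟩
  · rw [hA]
    have : (k : ℝ) ≠ 0 := by positivity
    simp [this, h1, h.ne_zero]
  obtain ⟨δ, hδ, hδ2, H⟩ := exists_uniform_flow_expansion h.circular (k * s) hε
  refine ⟨δ, hδ, fun v v' e e' hv hv' he he' => ?_⟩
  have f1 := flow_spec (he.trans hδ2) 0 v
  have f2 := flow_spec (he'.trans hδ2) 0 v'
  have hy := isSolution_of_hasDerivAt (x := fun t => (v - v') * ψ t + (e - e') * ω t)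
    (v := fun t => (v - v') * deriv ψ t + (e - e') * deriv ω t)
    (G := fun y t => attractionX (x t) (1 / 2) * y + (e - e') * (tidal (x t) * cos t))
    (fun t => ((hψ.1.hasDerivAt t).const_mul _).add ((hω.hasDerivAt t).const_mul _))
    (fun t => (((hψ.1.2 t).const_mul _).add ((hω.2 t).const_mul _)).congr_deriv (by ring))
  have := (H e e' (|v - v'| + |e - e'|) 0 _ _ _ he he' f1.1 f2.1 (by simp [f1.2.1, h0, hδ.le])
    (by rwa [f1.2.2]) (by simp [f2.2.1, h0, hδ.le]) (by rwa [f2.2.2]) hy.1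
    (by simp only [f1.2.1, f2.2.1, sub_self, abs_zero]; positivity)
    (by rw [f1.2.2, f2.2.2]; linarith [abs_nonneg (e - e')]) (by linarith [abs_nonneg (v - v')])
    (by simp [f1.2.1, f2.2.1, hψ0, hω0]) (by rw [hy.2]; simp [f1.2.2, f2.2.2, hψ1, hω1])
    (k * s) ⟨by positivity, le_rfl⟩).1
  rw [mul_zero, add_zero] at this
  rwa [mul_comm (ψ _), mul_comm (ω _)]

/-- Here `ψ` has data `(1, 0)`, and the partial derivative in the position is `ψ'(ks) = (-1)^k k d
x''(0)²`. -/
theorem IsParabolicFrame.exists_hasStrictPartials_even {x y : ℝ → ℝ} {s d : ℝ}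
    (h : IsParabolicFrame x y s d) (h0 : deriv x 0 = 0) (h1 : deriv (deriv x) 0 ≠ 0) {k : ℕ}
    (hk : 1 ≤ k) (hs : 0 ≤ s) :
    ∃ A B, A ≠ 0 ∧ HasStrictPartials (fun v e => deriv (flow e v 0) (k * s)) (x 0) A B := by
  have hqc : Continuous fun t => attractionX (x t) (1 / 2) :=
    (continuous_attractionX (by norm_num)).comp h.circular.continuous
  have htc : Continuous fun t => tidal (x t) * cos t :=
    (continuous_tidal.comp h.circular.continuous).mul continuous_cos
  obtain ⟨ω, hω, hω0, hω1⟩ := (regularForce_linear hqc htc).exists_isSolution 0 0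
  have hχ := h.circular.isSolution_deriv.1
  have hψ := hχ.hill_linear_comb h.hill (deriv y 0) (-deriv (deriv x) 0)
  set ψ : ℝ → ℝ := fun t => deriv y 0 * deriv x t + -deriv (deriv x) 0 * y t with hψdef
  have hψ0 : ψ 0 = 1 := by simp only [hψdef]; linarith [h.wronskian]
  have hψ1 : deriv ψ 0 = 0 := by rw [hψ.2]; ring
  have hA : deriv ψ (k * s) = (-1) ^ k * k * d * deriv (deriv x) 0 ^ 2 := by
    obtain ⟨-, e1, -, e2⟩ := h.shift_nat k
    simp only [hψ.2, e1, e2]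
    ring
  refine ⟨deriv ψ (k * s), deriv ω (k * s), ?_, fun ε hε => ?_⟩
  · rw [hA]
    have : (k : ℝ) ≠ 0 := by positivity
    simp [this, h1, h.ne_zero]
  obtain ⟨δ, hδ, hδ2, H⟩ := exists_uniform_flow_expansion h.circular (k * s) hε
  refine ⟨δ, hδ, fun v v' e e' hv hv' he he' => ?_⟩
  have f1 := flow_spec (he.trans hδ2) v 0
  have f2 := flow_spec (he'.trans hδ2) v' 0
  have hy := isSolution_of_hasDerivAt (x := fun t => (v - v') * ψ t + (e - e') * ω t)
    (v := fun t => (v - v') * deriv ψ t + (e - e') * deriv ω t)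
    (G := fun y t => attractionX (x t) (1 / 2) * y + (e - e') * (tidal (x t) * cos t))
    (fun t => ((hψ.1.hasDerivAt t).const_mul _).add ((hω.hasDerivAt t).const_mul _))
    (fun t => (((hψ.1.2 t).const_mul _).add ((hω.2 t).const_mul _)).congr_deriv (by ring))
  have := (H e e' (|v - v'| + |e - e'|) 0 _ _ _ he he' f1.1 f2.1 (by rwa [f1.2.1])
    (by simp [f1.2.2, h0, hδ.le]) (by rwa [f2.2.1]) (by simp [f2.2.2, h0, hδ.le]) hy.1
    (by rw [f1.2.1, f2.2.1]; linarith [abs_nonneg (e - e')])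
    (by simp only [f1.2.2, f2.2.2, sub_self, abs_zero]; positivity)
    (by linarith [abs_nonneg (v - v')])
    (by simp [f1.2.1, f2.2.1, hψ0, hω0]) (by rw [hy.2]; simp [f1.2.2, f2.2.2, hψ1, hω1])
    (k * s) ⟨by positivity, le_rfl⟩).2
  rw [mul_zero, add_zero, hy.2] at this
  rwa [mul_comm (deriv ψ _), mul_comm (deriv ω _)]

/-! ### Periodicity by symmetry -/

theorem force_reflect {e : ℝ} (he : |e| ≤ 1 / 2) (m : ℕ) (x t : ℝ) :
    force x (-t + 2 * m * π) e = force x t e := by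
  have he1 : |e| < 1 := by linarith
  have h := (radius_periodic he1).nat_mul m (-t)
  rw [force_eq_attraction, force_eq_attraction, show -t + 2 * m * π = -t + m * (2 * π) by ring]
  rw [h, radius_neg he1]

theorem isSolution_reflect {e : ℝ} (he : |e| ≤ 1 / 2) (m : ℕ) {x : ℝ → ℝ}
    (hx : IsSolution (fun x t => force x t e) x) :
    IsSolution (fun x t => force x t e) (fun t => x (-t + 2 * m * π)) ∧
      deriv (fun t => x (-t + 2 * m * π)) = fun t => -deriv x (-t + 2 * m * π) := by
  have h1 := hx.comp_add_const (2 * m * π)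
  have h2 := h1.1.comp_neg
  rw [h1.2] at h2
  simpa only [force_reflect he] using h2

/-- The reflection `t ↦ 2mπ - t` combined with `x ↦ -x` preserves the equation and the data at `mπ`,
so it fixes the solution; comparison at `t = 0` gives periodicity. -/
theorem periodic_of_odd {e : ℝ} (he : |e| ≤ 1 / 2) {m : ℕ} {x : ℝ → ℝ}
    (hx : IsSolution (fun x t => force x t e) x) (h0 : x 0 = 0) (hm : x (m * π) = 0) :
    x (2 * m * π) = x 0 ∧ deriv x (2 * m * π) = deriv x 0 := by
  have h1 := isSolution_reflect he m hx
  have h2 := h1.1.neg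
  simp only [force_neg, neg_neg] at h2
  have e1 : -((m : ℝ) * π) + 2 * m * π = m * π := by ring
  have h3 := RegularForce.unique_of_eq_at (regularForce_force he) (c := m * π) hx h2.1
    (by simp only [e1, hm, neg_zero]) (by simp only [h2.2, h1.2, e1, neg_neg])
  have h4 := congrFun h3 0
  have h5 := congrFun (congrArg deriv h3) 0
  simp only [h2.2, h1.2, neg_neg, neg_zero, zero_add] at h4 h5
  exact ⟨by linarith, h5.symm⟩

theorem periodic_of_even {e : ℝ} (he : |e| ≤ 1 / 2) {m : ℕ} {x : ℝ → ℝ}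
    (hx : IsSolution (fun x t => force x t e) x) (h0 : deriv x 0 = 0)
    (hm : deriv x (m * π) = 0) :
    x (2 * m * π) = x 0 ∧ deriv x (2 * m * π) = deriv x 0 := by
  have h1 := isSolution_reflect he m hx
  have e1 : -((m : ℝ) * π) + 2 * m * π = m * π := by ring
  have h3 := RegularForce.unique_of_eq_at (regularForce_force he) (c := m * π) hx h1.1
    (by simp only [e1]) (by simp only [h1.2, e1, hm, neg_zero])
  have h4 := congrFun h3 0
  have h5 := congrFun (congrArg deriv h3) 0
  simp only [h1.2, neg_zero, zero_add] at h4 h5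
  exact ⟨h4.symm, by linarith⟩

/-! ### Families -/

theorem abs_le_half {e e₀ : ℝ} (he : e ∈ Ico 0 e₀) (h : e₀ ≤ 1 / 2) : |e| ≤ 1 / 2 := by
  rw [abs_of_nonneg he.1]
  linarith [he.2]

section

variable {p n : ℕ} {X y : ℝ → ℝ} {s d e₀ : ℝ} {φ : ℝ → ℝ → ℝ}

theorem IsArch.exists_isOddFamily (hX : IsArch X s) (h : IsParabolicFrame X y s d) (hp : 1 ≤ p)
    (hs : s = 2 * n * π) : ∃ e₀ φ, IsOddFamily (2 * p * n) p e₀ φ := by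
  have hp0 : (p : ℝ) ≠ 0 := by positivity
  -- The half period `mπ` is `p` arch lengths, so the partial derivatives are needed at `k = p`.
  have hps : ((2 * p * n : ℕ) : ℝ) * π = p * s := by rw [hs]; push_cast; ring
  obtain ⟨A, B, hA, hG⟩ := h.exists_hasStrictPartials_odd hX.zero hX.velocity_pos.ne' hp
    hX.length_pos.le
  have hX0 : flow 0 0 (deriv X 0) = X := by
    have := flow_eq (e := 0) (by norm_num) (isSolution_force_zero_iff.2 hX.circular)
    rwa [hX.zero] at this
  have hXp : X (p * s) = 0 := by
    have h2 : ∀ k : ℕ, X (k * s) = 0 := fun k => by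
      induction k with
      | zero => simpa using hX.zero
      | succ k ih => rw [Nat.cast_succ, add_mul, one_mul, hX.antiperiodic, ih, neg_zero]
    exact h2 p
  obtain ⟨e₀, he₀, he₀2, V, hV0, hVc, hV⟩ := hG.exists_implicit hA (by simp only [hX0, hXp])
  have hf := fun e (he : e ∈ Ico 0 e₀) => flow_spec (abs_le_half he he₀2) 0 (V e)
  have h0 : flow 0 0 (V 0) = X := by rw [hV0, hX0]
  refine ⟨e₀, fun t e => flow e 0 (V e) t, he₀, by linarith, fun e he => (hf e he).1,
    fun e he => (hf e he).2.1, fun e he => ?_, hVc.congr fun e he => (hf e he).2.2, ?_, ?_⟩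
  · rw [hps]
    exact hV e he
  · rw [h0]
    exact hX.velocity_pos
  · rw [h0]
    convert hX.isMinimalPeriod using 1
    rw [hs]
    push_cast
    field_simp

theorem IsArch.exists_isEvenFamily (hX : IsArch X s) (h : IsParabolicFrame X y s d) (hp : 1 ≤ p)
    (hs : s = 2 * n * π) : ∃ e₀ φ, IsEvenFamily (2 * p * n) p e₀ φ := by
  have hp0 : (p : ℝ) ≠ 0 := by positivity
  have hps : ((2 * p * n : ℕ) : ℝ) * π = p * s := by rw [hs]; push_cast; ring
  have hE := h.translate (s / 2)
  have hXs := hX.length_pos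
  set Z : ℝ → ℝ := fun t => X (t + s / 2) with hZ
  have hZ0 : 0 < Z 0 := by
    simp only [hZ, zero_add]
    exact hX.pos _ ⟨by linarith, by linarith⟩
  have hZ1 : deriv Z 0 = 0 := by
    rw [hZ, hX.circular.deriv_shift]
    simpa using hX.deriv_half
  have hZ2 : deriv (deriv Z) 0 ≠ 0 := by
    rw [hE.circular.isSolution_deriv.2]
    exact (neg_lt_zero.2 (attraction_pos (by norm_num) hZ0)).ne
  obtain ⟨A, B, hA, hG⟩ := hE.exists_hasStrictPartials_even hZ1 hZ2 hp hXs.le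
  have hfl0 : flow 0 (Z 0) 0 = Z := by
    have := flow_eq (e := 0) (by norm_num) (isSolution_force_zero_iff.2 hE.circular)
    rwa [hZ1] at this
  have hZp : deriv Z (p * s) = 0 := by rw [(hE.shift_nat p).1, hZ1, mul_zero]
  obtain ⟨e₀, he₀, he₀2, V, hV0, hVc, hV⟩ := hG.exists_implicit hA (by simp only [hfl0, hZp])
  have hf := fun e (he : e ∈ Ico 0 e₀) => flow_spec (abs_le_half he he₀2) (V e) 0
  have h0 : flow 0 (V 0) 0 = Z := by rw [hV0, hfl0]
  refine ⟨e₀, fun t e => flow e (V e) 0 t, he₀, by linarith, fun e he => (hf e he).1,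
    fun e he => (hf e he).2.2, fun e he => ?_, hVc.congr fun e he => (hf e he).2.1, ?_, ?_⟩
  · rw [hps]
    exact hV e he
  · rw [h0]
    exact hZ0
  · rw [h0]
    convert hX.isMinimalPeriod.shift (s / 2) using 1
    rw [hs]
    push_cast
    field_simp

theorem IsOddFamily.hasDerivWithinAt_trace (hφ : IsOddFamily (2 * p * n) p e₀ φ) (hX : IsArch X s)
    (h : IsParabolicFrame X y s d) (hp : 1 ≤ p) (hs : s = 2 * n * π) :
    HasDerivWithinAt (linearizedTrace (2 * p * n) φ)
      (2 * p * d * ∫ t in (0 : ℝ)..2 * p * s, tidal (X t) * deriv X t * sin t) (Ici 0) 0 := by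
  have hp0 : (p : ℝ) ≠ 0 := by positivity
  have hps : ((2 * p * n : ℕ) : ℝ) * π = p * s := by rw [hs]; push_cast; ring
  have hps2 : 2 * ((2 * p * n : ℕ) : ℝ) * π = 2 * p * s := by rw [mul_assoc, hps]; ring
  have hφ0 : (fun t => φ t 0) = X := by
    have h1 := (isSolution_force_zero_iff.1 (hφ.solution 0 ⟨le_rfl, hφ.pos⟩)).isArch_of_isMinimalPeriod
      (hφ.initial 0 ⟨le_rfl, hφ.pos⟩) hφ.velocity_pos hφ.minimal_period
    rw [hps2, show 2 * (p : ℝ) * s / p / 2 = s by field_simp] at h1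
    exact h1.unique hX
  obtain ⟨A, B, hA, hG⟩ := h.exists_hasStrictPartials_odd hX.zero hX.velocity_pos.ne' hp
    hX.length_pos.le
  have hmin : 0 < min e₀ (1 / 2) := lt_min hφ.pos (by norm_num)
  have hmem : ∀ e ∈ Ico 0 (min e₀ (1 / 2)), e ∈ Ico 0 e₀ := fun e he =>
    ⟨he.1, he.2.trans_le (min_le_left _ _)⟩
  have hV := HasStrictPartials.hasRightDeriv (V := fun e => deriv (fun t => φ t e) 0)
    (by simpa only [hφ0] using hG) hA hmin
    (hφ.continuousOn_velocity.mono fun e he => hmem e he) (fun e he => by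
      have h1 := flow_eq (abs_le_half he (min_le_right _ _)) (hφ.solution e (hmem e he))
      rw [hφ.initial e (hmem e he)] at h1
      rw [← hps]
      simp only [h1]
      exact hφ.half_period e (hmem e he))
  have h0 : HasRightDeriv (fun e => φ 0 e) 0 :=
    hasRightDeriv_of_eventually_const (δ := e₀ / 2) (c := 0) (half_pos hφ.pos)
      fun e he => hφ.initial e ⟨he.1, by linarith [he.2, hφ.pos]⟩
  have hsh := h.shift_nat (2 * p)
  -- Over `2mπ`, that is `2p` arch lengths, the sign `(-1)^(2p)` is `1` and the shift rule gives
  -- `y(T) = y(0) - 2p d x'(0)`.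
  have := hasDerivWithinAt_linearizedTrace (c := -(2 * p * d)) hφ.pos hφ.solution h0 hV
    ⟨_, hmin, fun e he => periodic_of_odd (abs_le_half he (min_le_right _ _))
      (hφ.solution e (hmem e he)) (hφ.initial e (hmem e he)) (hφ.half_period e (hmem e he))⟩
    hφ0 h.hill h.wronskian
    (by
      rw [hps2, show 2 * (p : ℝ) * s = (2 * p : ℕ) * s by push_cast; ring, hsh.2.2.1]
      simp only [pow_mul, even_two, Even.neg_pow, one_pow]
      push_cast
      ring)
    (by
      rw [hps2, show 2 * (p : ℝ) * s = (2 * p : ℕ) * s by push_cast; ring, hsh.2.2.2]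
      simp only [pow_mul, even_two, Even.neg_pow, one_pow]
      push_cast
      ring)
  rwa [hps2, neg_neg] at this

theorem IsEvenFamily.hasDerivWithinAt_trace (hφ : IsEvenFamily (2 * p * n) p e₀ φ)
    (hX : IsArch X s) (h : IsParabolicFrame X y s d) (hp : 1 ≤ p) (hs : s = 2 * n * π) :
    HasDerivWithinAt (linearizedTrace (2 * p * n) φ)
      (2 * p * d * ∫ t in (0 : ℝ)..2 * p * s,
        tidal (X (t + s / 2)) * deriv X (t + s / 2) * sin t) (Ici 0) 0 := by
  have hp0 : (p : ℝ) ≠ 0 := by positivity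
  have hps : ((2 * p * n : ℕ) : ℝ) * π = p * s := by rw [hs]; push_cast; ring
  have hps2 : 2 * ((2 * p * n : ℕ) : ℝ) * π = 2 * p * s := by rw [mul_assoc, hps]; ring
  have hE := h.translate (s / 2)
  have hdZ := hX.circular.deriv_shift (s / 2)
  set Z : ℝ → ℝ := fun t => X (t + s / 2) with hZ
  have hφ0 : (fun t => φ t 0) = Z := by
    obtain ⟨z, hz, hzφ⟩ := (isSolution_force_zero_iff.1
      (hφ.solution 0 ⟨le_rfl, hφ.pos⟩)).exists_isArch_of_even hφ.position_pos
      (hφ.initial 0 ⟨le_rfl, hφ.pos⟩) hφ.minimal_period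
    rw [hps2, show 2 * (p : ℝ) * s / p / 2 = s by field_simp] at hz
    rw [hps2, show 2 * (p : ℝ) * s / p / 4 = s / 2 by field_simp; ring, hz.unique hX] at hzφ
    exact hzφ
  have hZ0 : 0 < Z 0 := by
    rw [← hφ0]
    exact hφ.position_pos
  have hZ1 : deriv Z 0 = 0 := by
    rw [← hφ0]
    exact hφ.initial 0 ⟨le_rfl, hφ.pos⟩
  have hZ2 : deriv (deriv Z) 0 ≠ 0 := by
    rw [hE.circular.isSolution_deriv.2]
    exact (neg_lt_zero.2 (attraction_pos (by norm_num) hZ0)).ne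
  obtain ⟨A, B, hA, hG⟩ := hE.exists_hasStrictPartials_even hZ1 hZ2 hp hX.length_pos.le
  have hmin : 0 < min e₀ (1 / 2) := lt_min hφ.pos (by norm_num)
  have hmem : ∀ e ∈ Ico 0 (min e₀ (1 / 2)), e ∈ Ico 0 e₀ := fun e he =>
    ⟨he.1, he.2.trans_le (min_le_left _ _)⟩
  have hV := HasStrictPartials.hasRightDeriv (V := fun e => φ 0 e)
    (by simpa only [← hφ0] using hG) hA hmin
    (hφ.continuousOn_position.mono fun e he => hmem e he) (fun e he => by
      have h1 := flow_eq (abs_le_half he (min_le_right _ _)) (hφ.solution e (hmem e he))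
      rw [hφ.initial e (hmem e he)] at h1
      rw [← hps]
      simp only [h1]
      exact hφ.half_period e (hmem e he))
  have h0 : HasRightDeriv (fun e => deriv (fun t => φ t e) 0) 0 :=
    hasRightDeriv_of_eventually_const (δ := e₀ / 2) (c := 0) (half_pos hφ.pos)
      fun e he => hφ.initial e ⟨he.1, by linarith [he.2, hφ.pos]⟩
  have hsh := hE.shift_nat (2 * p)
  have := hasDerivWithinAt_linearizedTrace (c := -(2 * p * d)) hφ.pos hφ.solution hV h0
    ⟨_, hmin, fun e he => periodic_of_even (abs_le_half he (min_le_right _ _))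
      (hφ.solution e (hmem e he)) (hφ.initial e (hmem e he)) (hφ.half_period e (hmem e he))⟩
    hφ0 hE.hill hE.wronskian
    (by
      rw [hps2, show 2 * (p : ℝ) * s = (2 * p : ℕ) * s by push_cast; ring, hsh.2.2.1]
      simp only [pow_mul, even_two, Even.neg_pow, one_pow]
      push_cast
      ring)
    (by
      rw [hps2, show 2 * (p : ℝ) * s = (2 * p : ℕ) * s by push_cast; ring, hsh.2.2.2]
      simp only [pow_mul, even_two, Even.neg_pow, one_pow]
      push_cast
      ring)
  rw [hps2, neg_neg, hdZ] at this
  exact this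

/-- Since `s/2 = nπ`, the factor `sin t` is `(-1)^n sin(t + s/2)`. The integrand becomes a translate
of the other one, and periodicity removes the translation of the interval. -/
theorem IsArch.integral_shift (hX : IsArch X s) (hs : s = 2 * n * π) :
    ∫ t in (0 : ℝ)..2 * p * s, tidal (X (t + s / 2)) * deriv X (t + s / 2) * sin t =
      (-1) ^ n * ∫ t in (0 : ℝ)..2 * p * s, tidal (X t) * deriv X t * sin t := by
  have hsin : ∀ t, sin (t + s / 2) = (-1) ^ n * sin t := fun t => by
    rw [hs, show 2 * (n : ℝ) * π / 2 = n * π by ring]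
    exact sin_add_nat_mul_pi t n
  have hper : Function.Periodic (fun t => tidal (X t) * deriv X t * sin t) (2 * p * s) := by
    have h1 := hX.periodic.nat_mul p
    have h2 : Function.Periodic (deriv X) (p * (2 * s)) := fun t => by
      have := congrArg deriv (funext h1)
      rw [hX.circular.deriv_shift] at this
      exact congrFun this t
    have h3 : Function.Periodic sin (p * (2 * s)) := by
      have := sin_periodic.nat_mul (p * (2 * n))
      rwa [show ((p * (2 * n) : ℕ) : ℝ) * (2 * π) = p * (2 * s) by rw [hs]; push_cast; ring] at this
    rw [show 2 * (p : ℝ) * s = p * (2 * s) by ring]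
    intro t
    simp only [h1 t, h2 t, h3 t]
  have h1 : ((-1 : ℝ) ^ n) * (-1) ^ n = 1 := by rw [← mul_pow]; simp
  have h2 : ∀ t, tidal (X (t + s / 2)) * deriv X (t + s / 2) * sin t =
      (-1) ^ n * (fun t => tidal (X t) * deriv X t * sin t) (t + s / 2) := fun t => by
    simp only [hsin]
    linear_combination (-tidal (X (t + s / 2)) * deriv X (t + s / 2) * sin t) * h1
  simp only [h2]
  rw [intervalIntegral.integral_const_mul,
    intervalIntegral.integral_comp_add_right (fun t => tidal (X t) * deriv X t * sin t) (s / 2)]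
  congr 1
  have := hper.intervalIntegral_add_eq (s / 2) 0
  rw [zero_add] at this ⊢
  rw [add_comm (2 * (p : ℝ) * s)]
  exact this

end

end Sitnikov

end

theorem lemma4p4 (p n : ℕ) (hp : 1 ≤ p) (hn : 1 ≤ n) :
    (∃ (e₀ : ℝ) (φ : ℝ → ℝ → ℝ), Sitnikov.IsOddFamily (2 * p * n) p e₀ φ) ∧
    (∃ (e₀ : ℝ) (φ : ℝ → ℝ → ℝ), Sitnikov.IsEvenFamily (2 * p * n) p e₀ φ) ∧
    ∃ τodd τeven : ℝ,
      (∀ (e₀ : ℝ) (φ : ℝ → ℝ → ℝ), Sitnikov.IsOddFamily (2 * p * n) p e₀ φ →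
        HasDerivWithinAt (Sitnikov.linearizedTrace (2 * p * n) φ) τodd (Set.Ici 0) 0) ∧
      (∀ (e₀ : ℝ) (φ : ℝ → ℝ → ℝ), Sitnikov.IsEvenFamily (2 * p * n) p e₀ φ →
        HasDerivWithinAt (Sitnikov.linearizedTrace (2 * p * n) φ) τeven (Set.Ici 0) 0) ∧
      τeven = (-1) ^ n * τodd := by
  have hn1 : (1 : ℝ) ≤ n := by exact_mod_cast hn
  -- The prescribed minimal period `2mπ/p` is `4nπ`, twice the arch length; `n ≥ 1` secures the
  -- threshold `π ≤ s`.
  obtain ⟨X, hX⟩ := Sitnikov.exists_isArch (s := 2 * n * π) (by nlinarith [pi_pos])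
  obtain ⟨y, d, h⟩ := hX.exists_isParabolicFrame
  refine ⟨hX.exists_isOddFamily h hp rfl, hX.exists_isEvenFamily h hp rfl, _, _,
    fun e₀ φ hφ => hφ.hasDerivWithinAt_trace hX h hp rfl,
    fun e₀ φ hφ => hφ.hasDerivWithinAt_trace hX h hp rfl, ?_⟩
  rw [hX.integral_shift rfl]
  ring
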